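/- **Setting.** Let $\mathbb U$ be the set of finite words over $\{1,2,\dots\}$ and let $\partial\mathbb U$ be the set of infinite sequences $\mathbf u=(i_k)_{k\ge1}$ of positive integers, with $\mathbf u_{|n}=(i_1,\dots,i_n)$ and the metric $\delta(\mathbf u,\mathbf v)=e^{-n}$ for $\mathbf u\ne\mathbf v$, where $n$ is the number of initial terms on which $\mathbf u$ and $\mathbf v$ agree; $B(\mathbf u,r)$ is the open ball. For $u\in\mathbb U$ let $|u|$ be its length and $B_u=\{\mathbf v:\mathbf v_{|\,|u|}=u\}$. A finite-degree ordered rooted tree is coded as a prefix-closed set $T\subset\mathbb U$ in which the children of each vertex $u$ are $u1,\dots,uk$ for some integer $k\ge0$. Let $\theta_uT=\{v: uv\in T\}$, let $Z_n(T)$ be the number of words of length $n$ in $T$, and let $\partial T=\{\mathbf u:\mathbf u_{|n}\in T \text{ for all } n\}$. Let $\xi$ be a probability distribution on $\{0,1,2,\dots\}$ with mean $m=\sum_k k\,\xi(k)\in(1,\infty)$ and $\sum_{k\ge2}k\log k\,\xi(k)<\infty$. Let $\mathcal T$ be a Galton–Watson tree with offspring distribution $\xi$: the number of children of the root has law $\xi$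 and, for each $k$ with $\xi(k)>0$, given that the root has $k$ children, the subtrees $\theta_1\mathcal T,\dots,\theta_k\mathcal T$ are independent with the same law as $\mathcal T$. For $u\in\mathbb U$ let $W_u=\limsup_n m^{-n}Z_n(\theta_u\mathcal T)$, and let $W=W_\varnothing$, which is almost surely the (Kesten–Stigum) limit of $m^{-n}Z_n(\mathcal T)$. The branching measure $M$ is the almost surely unique finite Borel measure on $\partial\mathbb U$ with $M(B_u)=m^{-|u|}W_u$ for all $u\in\mathbb U$. Put $F(x)=-\log\mathbf P(W>x)\in[0,\infty]$, $F^{-1}(x)=\inf\{y\ge0:F(y)>x\}$ and $g(r)=r^{\log m}F^{-1}(\log\log 1/r)$ for $r\in(0,e^{-1})$, with $g(0)=0$. For $A\subset\partial\mathbb U$ let $$\mathcal H_g(A)=\lim_{\varepsilon\to0}\ \inf\Big\{\sum_{n}g(\operatorname{diam}C_n)\ :\ A\subset\bigcup_{n\in\mathbb N}C_n,\ \operatorname{diam}C_n\le\varepsilon\Big\}.$$ **Theorem.** Assume that $$\sup_{x\ge1}\frac{F^{-1}(2x)}{F^{-1}(x)}<\infty .$$ Then the branching measure $M$ exists almost surely,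 and there is a constant $c_\xi\in(0,\infty)$, depending only on $\xi$, such that almost surely, for $M$-almost every $\mathbf u$, $$\limsup_{r\to0}\frac{M(B(\mathbf u,r))}{g(r)}=c_\xi^{-1},$$ and such that almost surely $\mathcal H_g(\,\cdot\,\cap\partial\mathcal T)=c_\xi\,M$ as Borel measures on $\partial\mathbb U$. -/

import Mathlib

open MeasureTheory ProbabilityTheory Filter Set
open scoped ENNReal NNReal Topology

namespace GW

/-! ### Words, trees, boundary -/

/-- Finite words written with positive integers. The empty word is `[]`, the length of a word is
its generation, and concatenation is `++`. -/
abbrev Word := List ℕ+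

/-- An ordered rooted tree with finite degrees, coded as a set of words: it is closed under taking
prefixes, and the children of each vertex `u` are `u1, …, uk` for some `k ≥ 0`. The empty set is
allowed (it is the shift of a tree at a word outside the tree). -/
structure OrderedTree where
  carrier : Set Word
  prefix_mem : ∀ u v : Word, u ++ v ∈ carrier → u ∈ carrier
  children : ∀ u ∈ carrier, ∃ k : ℕ, ∀ i : ℕ+, u ++ [i] ∈ carrier ↔ (i : ℕ) ≤ k

/-- The sigma-field on trees generated by the events that a given word belongs to the tree. -/
instance : MeasurableSpace OrderedTree :=
  MeasurableSpace.generateFrom (Set.range fun u : Word => {T : OrderedTree | u ∈ T.carrier})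

/-- The tree `θ_u T` of the words `v` with `uv ∈ T`. -/
def OrderedTree.shift (u : Word) (T : OrderedTree) : OrderedTree where
  carrier := {v | u ++ v ∈ T.carrier}
  prefix_mem v w h := T.prefix_mem (u ++ v) w (by simpa [List.append_assoc] using h)
  children v h := by
    obtain ⟨k, hk⟩ := T.children (u ++ v) h
    exact ⟨k, fun i => by simpa [List.append_assoc] using hk i⟩

open Classical in
/-- The number of children of `u` in `T`, with value `-1` if `u` is not in `T`. -/
noncomputable def OrderedTree.numChildren (T : OrderedTree) (u : Word) : ℤ :=
  if u ∈ T.carrier then (Set.ncard {i : ℕ+ | u ++ [i] ∈ T.carrier} : ℤ) else -1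

/-- The number of vertices of `T` at generation `n` (a finite number, as degrees are finite). -/
noncomputable def OrderedTree.genSize (T : OrderedTree) (n : ℕ) : ℕ :=
  Set.ncard {u : Word | u ∈ T.carrier ∧ u.length = n}

/-- Infinite sequences of positive integers; `digit k` is the `(k+1)`-st term. -/
@[ext]
structure Ray where
  digit : ℕ → ℕ+

/-- The word made of the first `n` terms of a sequence. -/
def Ray.trunc (x : Ray) (n : ℕ) : Word := (List.range n).map x.digit

/-- The boundary of a tree: its infinite lines of descent. -/
def OrderedTree.boundary (T : OrderedTree) : Set Ray := {x | ∀ n, x.trunc n ∈ T.carrier}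

/-- The set of the sequences that start with the word `u`. -/
def cylinder (u : Word) : Set Ray := {x | x.trunc u.length = u}

open Classical in
/-- `δ(x, y) = exp(-n)`, where `n` is the number of initial terms on which `x ≠ y` agree. -/
noncomputable def rayDist (x y : Ray) : ℝ :=
  if x = y then 0 else Real.exp (-(PiNat.firstDiff (E := fun _ => ℕ+) x.digit y.digit : ℝ))

theorem rayDist_comm (x y : Ray) : rayDist x y = rayDist y x := by
  by_cases h : x = y
  · rw [h]
  · rw [rayDist, rayDist, if_neg h, if_neg (Ne.symm h), PiNat.firstDiff_comm]

theorem rayDist_triangle (x y z : Ray) : rayDist x z ≤ rayDist x y + rayDist y z := by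
  have nonneg : ∀ a b : Ray, 0 ≤ rayDist a b := fun a b => by
    unfold rayDist
    split_ifs <;> positivity
  by_cases hxz : x = z
  · rw [rayDist, if_pos hxz]
    exact add_nonneg (nonneg _ _) (nonneg _ _)
  by_cases hxy : x = y
  · rw [hxy]
    linarith [nonneg y y]
  by_cases hyz : y = z
  · rw [hyz]
    linarith [nonneg z z]
  have h := PiNat.min_firstDiff_le (E := fun _ => ℕ+) x.digit y.digit z.digit (fun h => hxz (Ray.ext h))
  rcases min_le_iff.1 h with h | h
  · have : rayDist x z ≤ rayDist x y := by
      rw [rayDist, rayDist, if_neg hxz, if_neg hxy, Real.exp_le_exp, neg_le_neg_iff]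
      exact_mod_cast h
    linarith [nonneg y z]
  · have : rayDist x z ≤ rayDist y z := by
      rw [rayDist, rayDist, if_neg hxz, if_neg hyz, Real.exp_le_exp, neg_le_neg_iff]
      exact_mod_cast h
    linarith [nonneg x y]

noncomputable instance : MetricSpace Ray where
  dist := rayDist
  dist_self x := by simp [rayDist]
  dist_comm := rayDist_comm
  dist_triangle := rayDist_triangle
  eq_of_dist_eq_zero {x y} h := by
    by_contra hxy
    have h' : rayDist x y = 0 := h
    rw [rayDist, if_neg hxy] at h'
    exact absurd h' (Real.exp_ne_zero _)

noncomputable instance : MeasurableSpace Ray := borel Ray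

instance : BorelSpace Ray := ⟨rfl⟩

theorem Ray.trunc_length (x : Ray) (n : ℕ) : (x.trunc n).length = n := by simp [Ray.trunc]

theorem Ray.trunc_eq_iff (x y : Ray) (n : ℕ) : x.trunc n = y.trunc n ↔ ∀ k < n, x.digit k = y.digit k := by
  simp [Ray.trunc]

theorem Ray.dist_lt_iff (x y : Ray) (n : ℕ) (r : ℝ) (h1 : Real.exp (-n) < r) (h2 : r ≤ Real.exp (-(n-1:ℝ))) :
   dist x y < r ↔ x.trunc n = y.trunc n := by
  rw [Ray.trunc_eq_iff]
  show rayDist x y < r ↔ _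
  unfold rayDist
  split_ifs with h
  · subst h; simp; exact (Real.exp_pos _).trans h1
  · constructor
    · intro h3 k hk
      have := Real.exp_lt_exp.1 (h3.trans_le h2)
      have h5 : (n:ℝ) < PiNat.firstDiff (E := fun _ => ℕ+) x.digit y.digit + 1 := by linarith
      have h5 : n < PiNat.firstDiff (E := fun _ => ℕ+) x.digit y.digit + 1 := by exact_mod_cast h5
      exact PiNat.apply_eq_of_lt_firstDiff (E := fun _ => ℕ+) (by omega)
    · intro h3
      refine lt_of_le_of_lt (Real.exp_le_exp.2 ?_) h1
      have : n ≤ PiNat.firstDiff (E := fun _ => ℕ+) x.digit y.digit := by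
        by_contra hc
        push Not at hc
        exact PiNat.apply_firstDiff_ne (E := fun _ => ℕ+) (fun h4 => h (Ray.ext h4)) (h3 _ hc)
      have : (n:ℝ) ≤ PiNat.firstDiff (E := fun _ => ℕ+) x.digit y.digit := by exact_mod_cast this
      linarith

theorem isPiSystem_cylinder : IsPiSystem (Set.range cylinder) := by
  rintro _ ⟨u, rfl⟩ _ ⟨v, rfl⟩ ⟨z, hz⟩
  have key : ∀ a b : Word, a.length ≤ b.length → z ∈ cylinder a → z ∈ cylinder b → cylinder b ⊆ cylinder a := by
    intro a b hab ha hb x hx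
    have h : x.trunc b.length = z.trunc b.length := Eq.trans hx (Eq.symm hb)
    rw [Ray.trunc_eq_iff] at h
    have : x.trunc a.length = z.trunc a.length := (Ray.trunc_eq_iff _ _ _).2 fun k hk => h k (hk.trans_le hab)
    exact this.trans ha
  rcases le_total u.length v.length with h | h
  · exact ⟨v, (inter_eq_right.2 (key u v h hz.1 hz.2)).symm⟩
  · exact ⟨u, (inter_eq_left.2 (key v u h hz.2 hz.1)).symm⟩

theorem ball_eq_cylinder (x : Ray) (n : ℕ) : Metric.ball x (Real.exp (-(n-1:ℝ))) = cylinder (x.trunc n) := by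
  ext y
  rw [Metric.mem_ball, Ray.dist_lt_iff y x n _ (Real.exp_lt_exp.2 (by linarith)) le_rfl]
  simp [cylinder, Ray.trunc_length]

theorem borel_eq_generateFrom_cylinder : borel Ray = MeasurableSpace.generateFrom (Set.range cylinder) := by
  apply le_antisymm
  · refine MeasurableSpace.generateFrom_le fun s hs => ?_
    have : s = ⋃ u ∈ {u : Word | cylinder u ⊆ s}, cylinder u := by
      ext x
      simp only [mem_iUnion, mem_ofPred_eq, exists_prop]
      refine ⟨fun hx => ?_, fun ⟨u, hu, hx⟩ => hu hx⟩
      obtain ⟨ε, he, hb⟩ := Metric.isOpen_iff.1 (show IsOpen s from hs) x hx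
      obtain ⟨n, hn⟩ : ∃ n : ℕ, Real.exp (-(n-1:ℝ)) < ε := by
        obtain ⟨n, hn⟩ := exists_nat_gt (1 - Real.log ε)
        refine ⟨n, ?_⟩
        rw [← Real.lt_log_iff_exp_lt he]; linarith
      refine ⟨x.trunc n, ?_, by simp [cylinder, Ray.trunc_length]⟩
      rw [← ball_eq_cylinder]
      exact (Metric.ball_subset_ball hn.le).trans hb
    rw [this]
    exact MeasurableSet.biUnion (to_countable _) fun u _ => MeasurableSpace.measurableSet_generateFrom ⟨u, rfl⟩
  · refine MeasurableSpace.generateFrom_le ?_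
    rintro _ ⟨u, rfl⟩
    refine IsOpen.measurableSet (α := Ray) ?_
    by_cases h : (cylinder u).Nonempty
    · obtain ⟨x, hx⟩ := h
      have : cylinder u = cylinder (x.trunc u.length) := by rw [show x.trunc u.length = u from hx]
      rw [this, ← ball_eq_cylinder]; exact Metric.isOpen_ball
    · rw [not_nonempty_iff_eq_empty.1 h]; exact isOpen_empty

/-! ### Galton-Watson trees -/

/-- The mean of an offspring distribution. -/
noncomputable def mean (ξ : PMF ℕ) : ℝ≥0∞ := ∑' k : ℕ, (k : ℝ≥0∞) * ξ k

/-- The mean is in `(1, ∞)` and `∑ k log k ξ(k)` is finite. -/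
structure Hyp (ξ : PMF ℕ) : Prop where
  one_lt_mean : 1 < mean ξ
  mean_lt_top : mean ξ < ⊤
  log_moment : ∑' k : ℕ, ENNReal.ofReal (k * Real.log k) * ξ k < ⊤

/-- `T` is a Galton-Watson tree with offspring distribution `ξ` under `P`: the number of children of
the root has law `ξ`; and if `ξ k > 0` then, conditionally on the root having `k` children, the `k`
subtrees above these children are independent, with the same law as `T`. -/
structure IsGaltonWatson {Ω : Type*} [MeasurableSpace Ω] (ξ : PMF ℕ) (P : Measure Ω)
    (T : Ω → OrderedTree) : Prop where
  measurable : Measurable T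
  root : ∀ k : ℕ, P {ω | (T ω).numChildren [] = k} = ξ k
  subtrees_indep : ∀ k : ℕ, ξ k ≠ 0 →
    iIndepFun (fun (i : Fin k) (ω : Ω) => (T ω).shift [Nat.succPNat i])
      (P[|{ω | (T ω).numChildren [] = k}])
  subtrees_law : ∀ k : ℕ, ξ k ≠ 0 → ∀ i : Fin k,
    IdentDistrib (fun ω => (T ω).shift [Nat.succPNat i]) T
      (P[|{ω | (T ω).numChildren [] = k}]) P

/-- `W_u = limsup m^{-n} Z_n(θ_u T)`. For `u = []` this is the Kesten-Stigum limit. -/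
noncomputable def limitMass (m : ℝ≥0∞) (T : OrderedTree) (u : Word) : ℝ≥0∞ :=
  limsup (fun n : ℕ => ((T.shift u).genSize n : ℝ≥0∞) / m ^ n) atTop

/-- `μ` is a finite Borel measure that gives mass `m^{-|u|} W_u` to the sequences starting with `u`,
for every word `u`. -/
structure IsBranchingMeasure (m : ℝ≥0∞) (T : OrderedTree) (μ : Measure Ray) : Prop where
  finite : IsFiniteMeasure μ
  cylinder_eq : ∀ u : Word, μ (cylinder u) = limitMass m T u / m ^ u.length

theorem IsBranchingMeasure.unique {m : ℝ≥0∞} {T : OrderedTree} {μ ν : Measure Ray} (h : IsBranchingMeasure m T μ) (h' : IsBranchingMeasure m T ν) : μ = ν := by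
  have := h.finite
  have univ : cylinder [] = univ := by ext x; simp [cylinder, Ray.trunc]
  refine MeasureTheory.ext_of_generate_finite _ borel_eq_generateFrom_cylinder isPiSystem_cylinder ?_ ?_
  · rintro _ ⟨u, rfl⟩; rw [h.cylinder_eq, h'.cylinder_eq]
  · rw [← univ, h.cylinder_eq, h'.cylinder_eq]

open Classical in
/-- The branching measure of `T`: the only measure `μ` with `IsBranchingMeasure m T μ`, if there
is one, and zero otherwise. -/
noncomputable def branchingMeasure (m : ℝ≥0∞) (T : OrderedTree) : Measure Ray :=
  if h : ∃ μ, IsBranchingMeasure m T μ then h.choose else 0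

/-! ### The gauge function and its Hausdorff measure -/

/-- `F(x) = -log P(W > x)`, with values in `[0, ∞]`. -/
noncomputable def tailExponent {Ω : Type*} [MeasurableSpace Ω] (P : Measure Ω) (W : Ω → ℝ≥0∞)
    (x : ℝ) : EReal :=
  -ENNReal.log (P {ω | ENNReal.ofReal x < W ω})

/-- The right-continuous inverse `x ↦ inf {y ≥ 0 : F(y) > x}`. -/
noncomputable def rightInverse (F : ℝ → EReal) (x : ℝ) : ℝ :=
  sInf {y : ℝ | 0 ≤ y ∧ (x : EReal) < F y}

/-- `sup_{x ≥ 1} G(2x) / G(x)`, where `a / 0 = ∞` for `a > 0`. -/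
noncomputable def doublingSup (G : ℝ → ℝ) : ℝ≥0∞ :=
  ⨆ x : Set.Ici (1 : ℝ), ENNReal.ofReal (G (2 * x)) / ENNReal.ofReal (G x)

/-- `g(r) = r^{log m} G(log log 1/r)`, to be used for `r` in `(0, 1/e)`; moreover its value at `0`
is `0` if `m > 1`. -/
noncomputable def gauge (m : ℝ) (G : ℝ → ℝ) (r : ℝ) : ℝ :=
  r ^ Real.log m * G (Real.log (Real.log (1 / r)))

/-- The Hausdorff measure with gauge function `g`: the limit, as `ε → 0`, of the infimum of
`∑ g(diam Cₙ)` over the countable covers by sets `Cₙ` of diameter at most `ε`. -/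
noncomputable def hausdorffMeasure (g : ℝ → ℝ) : Measure Ray :=
  Measure.mkMetric fun d : ℝ≥0∞ => ENNReal.ofReal (g d.toReal)

end GW

namespace GW

/-! ### Measurability and combinatorics of trees -/

/-! Let `μ` be the law of the tree, `M_T` its branching measure and `G = F⁻¹`. The cylinder around
the `n`-th vertex of a ray has mass `m⁻ⁿ` times the limit mass `W_n` of the subtree above that
vertex, and its diameter `e⁻ⁿ` has gauge `m⁻ⁿ G(log n)`. Everything therefore reduces to the ratio
`W_n / G(log n)` (`spineRatio`) and its limsup `L` along the ray.

Under the size-biased measure `Q = μ(dT) M_T(dx)` (`spineLaw`), which need not be normalized, moving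
one step up the ray preserves `Q` and is ergodic, and the masses carried by the siblings at
successive steps are independent (`BranchingLaw.spineLaw_child` and its consequences). Since `G` is
nondecreasing, `L` does not decrease under this shift, so ergodicity makes it a constant `ℓ`. The
constant is finite by Borel–Cantelli: doubling bounds the size-biased tail of `W` beyond `a G(log
n)` by a multiple of `n⁻²`. It is at least `1/4` because the siblings at step `n` have mass at least
of order `G(log n)` with probability at least of order `1/n`, independently in `n`. The constant of
the theorem is `c = 1/ℓ`.

Passing from `L = ℓ` to the Hausdorff measure `H` uses the two density comparisons
`measure_le_mul_mkMetric` and `mul_mkMetric_le_measure`. They give `ℓ H = M` on the set where `L =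
ℓ`. The rest of the boundary is `M`-null, but it must also be shown to be `H`-null. Where `L > 1/8`,
the comparison with `M` does this. Where `L < 1/4`, all siblings along the ray are light from some
generation `k` on. By a first moment computation, the expected number of such vertices at generation
`N` is at most `m^N (k/N)^c'` with `c' > 0`, while each costs `m^{-N} G(log N)`. Doubling makes
`G(log N)` smaller than any power of `N`, so these covers have total gauge tending to zero in mean
(`BranchingLaw.ae_mkMetric_lightRays`).

Balls of general radius are still cylinders; the mismatch between their radius and the scale `e⁻ⁿ`
is absorbed by the fact that `L` takes the same value `ℓ` at a point and at its shift. If `W = 0`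
almost surely, the gauge and both measures vanish. Finally `ξ` determines `μ`
(`BranchingLaw.unique`), so the constant depends only on `ξ`. -/

theorem OrderedTree.ext' {S T : OrderedTree} (h : S.carrier = T.carrier) : S = T := by
  cases S; cases T; cases h; rfl

theorem measurableSet_mem (u : Word) : MeasurableSet {T : OrderedTree | u ∈ T.carrier} :=
  MeasurableSpace.measurableSet_generateFrom ⟨u, rfl⟩

@[simp] theorem OrderedTree.mem_shift (u v : Word) (T : OrderedTree) :
    v ∈ (T.shift u).carrier ↔ u ++ v ∈ T.carrier := Iff.rfl

@[simp] theorem OrderedTree.shift_nil (T : OrderedTree) : T.shift [] = T := OrderedTree.ext' rfl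

theorem OrderedTree.shift_shift (u v : Word) (T : OrderedTree) :
    (T.shift u).shift v = T.shift (u ++ v) :=
  OrderedTree.ext' (by ext w; simp)

theorem measurable_shift (u : Word) : Measurable (OrderedTree.shift u) := by
  refine measurable_generateFrom ?_
  rintro _ ⟨v, rfl⟩
  exact measurableSet_mem (u ++ v)

theorem OrderedTree.nil_mem_of_mem {T : OrderedTree} {u : Word} (h : u ∈ T.carrier) :
    [] ∈ T.carrier := T.prefix_mem [] u h

theorem OrderedTree.singleton_mem_of_cons_mem {T : OrderedTree} {i : ℕ+} {u : Word}
    (h : i :: u ∈ T.carrier) : [i] ∈ T.carrier := T.prefix_mem [i] u h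

theorem ncard_pnat_le (k : ℕ) : {i : ℕ+ | (i : ℕ) ≤ k}.ncard = k := by
  have : {i : ℕ+ | (i : ℕ) ≤ k} = Nat.succPNat '' (Finset.range k : Set ℕ) := by
    ext i
    simp only [mem_ofPred_eq, Finset.coe_range, mem_image, mem_Iio]
    constructor
    · intro h
      refine ⟨i.natPred, ?_, by simp⟩
      have := i.natPred_add_one
      omega
    · rintro ⟨j, hj, rfl⟩
      simpa using hj
  rw [this, ncard_image_of_injective _ Nat.succPNat_injective, ncard_coe_finset, Finset.card_range]

theorem OrderedTree.numChildren_nil_eq_iff (T : OrderedTree) (k : ℕ) :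
    T.numChildren [] = k ↔ [] ∈ T.carrier ∧ ∀ i : ℕ+, [i] ∈ T.carrier ↔ (i : ℕ) ≤ k := by
  unfold OrderedTree.numChildren
  by_cases h : [] ∈ T.carrier
  · obtain ⟨l, hl⟩ := T.children [] h
    simp only [List.nil_append] at hl ⊢
    have : {i : ℕ+ | [i] ∈ T.carrier}.ncard = l := by
      rw [← ncard_pnat_le l]; congr 1; ext i; exact hl i
    rw [if_pos h, this]
    constructor
    · intro hk
      have : l = k := by exact_mod_cast hk
      subst this
      exact ⟨h, hl⟩
    · rintro ⟨-, hk⟩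
      norm_cast
      rw [← ncard_pnat_le l, ← ncard_pnat_le k]
      congr 1; ext i; exact (hl i).symm.trans (hk i)
  · rw [if_neg h]
    constructor
    · intro h'; omega
    · rintro ⟨h', -⟩; exact absurd h' h

theorem measurableSet_numChildren (k : ℕ) :
    MeasurableSet {T : OrderedTree | T.numChildren [] = k} := by
  have : {T : OrderedTree | T.numChildren [] = k} = {T : OrderedTree | [] ∈ T.carrier} ∩
      ⋂ i : ℕ+, {T : OrderedTree | [i] ∈ T.carrier ↔ (i : ℕ) ≤ k} := by
    ext T; simp [OrderedTree.numChildren_nil_eq_iff]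
  rw [this]
  refine (measurableSet_mem _).inter (MeasurableSet.iInter fun i => ?_)
  by_cases h : (i : ℕ) ≤ k
  · simpa [h] using measurableSet_mem [i]
  · simp only [h, iff_false]
    exact (measurableSet_mem [i]).compl

theorem iUnion_numChildren :
    (⋃ k : ℕ, {T : OrderedTree | T.numChildren [] = k}) = {T : OrderedTree | [] ∈ T.carrier} := by
  ext T
  simp only [mem_iUnion, mem_ofPred_eq, OrderedTree.numChildren_nil_eq_iff]
  constructor
  · rintro ⟨k, h, -⟩; exact h
  · intro h
    obtain ⟨k, hk⟩ := T.children [] h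
    exact ⟨k, h, by simpa using hk⟩

theorem pairwise_disjoint_numChildren :
    Pairwise (Function.onFun Disjoint fun k : ℕ => {T : OrderedTree | T.numChildren [] = k}) := by
  intro k l hkl
  refine Set.disjoint_left.2 fun T h h' => hkl ?_
  have : (k : ℤ) = l := Eq.trans (Eq.symm h) h'
  exact_mod_cast this

/-- The trees that contain all the words of a finite set. -/
def containing (S : Finset Word) : Set OrderedTree := {T | ∀ u ∈ S, u ∈ T.carrier}

theorem measurableSet_containing (S : Finset Word) : MeasurableSet (containing S) := by
  have : containing S = ⋂ u ∈ S, {T : OrderedTree | u ∈ T.carrier} := by ext T; simp [containing]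
  rw [this]
  exact Finset.measurableSet_biInter _ fun u _ => measurableSet_mem u

theorem containing_union (S S' : Finset Word) :
    containing S ∩ containing S' = containing (S ∪ S') := by
  ext T
  simp only [containing, mem_inter_iff, mem_ofPred_eq, Finset.mem_union]
  constructor
  · rintro ⟨h, h'⟩ u (hu | hu)
    exacts [h u hu, h' u hu]
  · exact fun h => ⟨fun u hu => h u (Or.inl hu), fun u hu => h u (Or.inr hu)⟩

theorem isPiSystem_containing (p : Finset Word → Prop) (hp : ∀ S S', p S → p S' → p (S ∪ S')) :
    IsPiSystem (containing '' {S | p S}) := by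
  rintro _ ⟨S, hS, rfl⟩ _ ⟨S', hS', rfl⟩ -
  exact ⟨S ∪ S', hp _ _ hS hS', (containing_union S S').symm⟩

/-- The sigma-field generated by the membership of the words that satisfy `p`. -/
@[reducible] def memSigma (p : Word → Prop) : MeasurableSpace OrderedTree :=
  MeasurableSpace.generateFrom ((fun u : Word => {T : OrderedTree | u ∈ T.carrier}) '' {u | p u})

theorem memSigma_le (p : Word → Prop) :
    memSigma p ≤ (inferInstance : MeasurableSpace OrderedTree) := by
  refine MeasurableSpace.generateFrom_le ?_
  rintro _ ⟨u, -, rfl⟩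
  exact measurableSet_mem u

theorem memSigma_mono {p q : Word → Prop} (h : ∀ u, p u → q u) : memSigma p ≤ memSigma q :=
  MeasurableSpace.generateFrom_mono (image_mono fun u hu => h u hu)

theorem measurableSet_memSigma {p : Word → Prop} {u : Word} (h : p u) :
    MeasurableSet[memSigma p] {T : OrderedTree | u ∈ T.carrier} :=
  MeasurableSpace.measurableSet_generateFrom ⟨u, h, rfl⟩

/-- Single membership events are not stable under intersection; containing a finite set of words is.
This pi-system lets equalities of measures be checked on finite sets of words, also on the
sub-sigma-fields of the first generations and of the tree outside one subtree. -/
theorem memSigma_eq (p : Word → Prop) :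
    memSigma p = MeasurableSpace.generateFrom (containing '' {S | ∀ u ∈ S, p u}) := by
  apply le_antisymm
  · refine MeasurableSpace.generateFrom_le ?_
    rintro _ ⟨u, hu, rfl⟩
    refine MeasurableSpace.measurableSet_generateFrom ⟨{u}, ?_, ?_⟩
    · intro v hv
      rw [Finset.mem_singleton] at hv
      exact hv ▸ hu
    · ext T; simp [containing]
  · refine MeasurableSpace.generateFrom_le ?_
    rintro _ ⟨S, hS, rfl⟩
    have : containing S = ⋂ u ∈ S, {T : OrderedTree | u ∈ T.carrier} := by ext T; simp [containing]
    rw [this]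
    exact Finset.measurableSet_biInter _ fun u hu => measurableSet_memSigma (hS u hu)

theorem memSigma_true :
    memSigma (fun _ => True) = (inferInstance : MeasurableSpace OrderedTree) := by
  unfold memSigma
  simp only [ofPred_true, image_univ]
  rfl

theorem isPiSystem_containing_forall (p : Word → Prop) :
    IsPiSystem (containing '' {S | ∀ u ∈ S, p u}) :=
  isPiSystem_containing _ fun _ _ h h' u hu => (Finset.mem_union.1 hu).elim (h u) (h' u)

theorem containing_empty : containing ∅ = univ := by ext T; simp [containing]

/-- The words `v` such that `iv` is in `S`. -/
noncomputable def tailsAt (i : ℕ+) (S : Finset Word) : Finset Word :=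
  (S.filter fun u => u.head? = some i).image List.tail

theorem mem_tailsAt {i : ℕ+} {S : Finset Word} {v : Word} : v ∈ tailsAt i S ↔ i :: v ∈ S := by
  simp only [tailsAt, Finset.mem_image, Finset.mem_filter]
  constructor
  · rintro ⟨u, ⟨hu, hi⟩, rfl⟩
    cases u with
    | nil => simp at hi
    | cons j w => simp at hi; subst hi; simpa using hu
  · intro h
    exact ⟨i :: v, ⟨h, by simp⟩, by simp⟩

/-- The words of `S` that do not start with `i`. -/
def dropAt (i : ℕ+) (S : Finset Word) : Finset Word := S.filter fun u => u.head? ≠ some i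

/-- Splits the constraints into those outside the subtree above `i` and those inside it, the form in
which the branching property applies. It drives the inductions along words. -/
theorem containing_inter_child (i : ℕ+) (S : Finset Word) :
    {T : OrderedTree | [i] ∈ T.carrier} ∩ containing S =
      {T : OrderedTree | [i] ∈ T.carrier} ∩
        (containing (dropAt i S) ∩ OrderedTree.shift [i] ⁻¹' containing (tailsAt i S)) := by
  ext T
  simp only [mem_inter_iff, mem_ofPred_eq, containing, mem_preimage, mem_tailsAt, dropAt,
    Finset.mem_filter, OrderedTree.mem_shift, List.cons_append, List.nil_append]
  refine and_congr_right fun hi => ⟨fun h => ⟨fun u hu => h u hu.1, fun u hu => h _ hu⟩, ?_⟩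
  rintro ⟨h1, h2⟩ u hu
  by_cases h : u.head? = some i
  · cases u with
    | nil => simp at h
    | cons j w => simp at h; subst h; exact h2 w hu
  · exact h1 u ⟨hu, h⟩

/-! ### The branching property of the law -/

/-- The law of a Galton-Watson tree: the number of children of the root has law `ξ`, and the
subtrees above its `k` children are, on the event that there are `k` of them, distributed as `k`
independent trees. -/
structure BranchingLaw (ξ : PMF ℕ) (μ : Measure OrderedTree) : Prop where
  prob : IsProbabilityMeasure μ
  root : ∀ k : ℕ, μ {T | T.numChildren [] = k} = ξ k
  subtrees : ∀ k : ℕ, (μ.restrict {T | T.numChildren [] = k}).map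
    (fun T (i : Fin k) => T.shift [Nat.succPNat i]) = ξ k • Measure.pi (fun _ : Fin k => μ)

/-- Replacing conditional laws by restricted measures removes the case distinction on `ξ k`: when `ξ
k = 0` both sides vanish. It also transfers the whole problem to a measure on trees, with no
probability space left. -/
theorem IsGaltonWatson.branchingLaw {Ω : Type*} [MeasurableSpace Ω] {ξ : PMF ℕ} {P : Measure Ω}
    [IsProbabilityMeasure P] {T : Ω → OrderedTree} (h : IsGaltonWatson ξ P T) :
    BranchingLaw ξ (P.map T) := by
  have hT := h.measurable
  have hroot : ∀ k : ℕ, (P.map T) {T | T.numChildren [] = k} = ξ k := fun k => by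
    rw [Measure.map_apply hT (measurableSet_numChildren k)]; exact h.root k
  refine ⟨Measure.isProbabilityMeasure_map hT.aemeasurable, hroot, fun k => ?_⟩
  have hm : Measurable (fun (S : OrderedTree) (i : Fin k) => S.shift [Nat.succPNat i]) :=
    measurable_pi_lambda _ fun i => measurable_shift _
  by_cases hk : ξ k = 0
  · have : (P.map T).restrict {T | T.numChildren [] = k} = 0 := by
      rw [Measure.restrict_eq_zero, hroot, hk]
    rw [this, hk, Measure.map_zero, zero_smul]
  · rw [Measure.restrict_map hT (measurableSet_numChildren k), Measure.map_map hm hT]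
    set A := {ω | (T ω).numChildren [] = k} with hA
    have hAm : MeasurableSet A := hT (measurableSet_numChildren k)
    have hPA : P A = ξ k := h.root k
    have : IsProbabilityMeasure P[|A] := cond_isProbabilityMeasure (by rw [hPA]; exact hk)
    have hlaw : ∀ i : Fin k, Measure.map (fun ω => (T ω).shift [Nat.succPNat i]) P[|A]
        = P.map T := fun i => (h.subtrees_law k hk i).map_eq
    have hind : Measure.map (fun ω (i : Fin k) => (T ω).shift [Nat.succPNat i]) P[|A]
        = Measure.pi fun _ : Fin k => P.map T := by
      rw [← funext hlaw]
      exact (iIndepFun_iff_map_fun_eq_pi_map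
        (fun i => ((measurable_shift _).comp hT).aemeasurable)).1 (h.subtrees_indep k hk)
    have hres : P.restrict (T ⁻¹' {T | T.numChildren [] = k}) = ξ k • P[|A] := by
      rw [ProbabilityTheory.cond, smul_smul, hPA, ENNReal.mul_inv_cancel hk (ξ.apply_ne_top k),
        one_smul]
      rfl
    rw [hres, Measure.map_smul, ← hind]
    rfl

theorem lintegral_piUpdate {μ : Measure OrderedTree} [IsProbabilityMeasure μ] {k : ℕ} (i : Fin k)
    (E : Fin k → Set OrderedTree) (D : Set OrderedTree) :
    ∏ j, μ (Function.update E i D j) = (∏ j, μ (Function.update E i univ j)) * μ D := by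
  rw [← Finset.mul_prod_erase _ _ (Finset.mem_univ i), ← Finset.mul_prod_erase _ _ (Finset.mem_univ i)]
  simp only [Function.update_self, measure_univ, one_mul]
  rw [mul_comm]
  congr 1
  refine Finset.prod_congr rfl fun j hj => ?_
  rw [Function.update_of_ne (Finset.ne_of_mem_erase hj), Function.update_of_ne (Finset.ne_of_mem_erase hj)]

namespace BranchingLaw

variable {ξ : PMF ℕ} {μ : Measure OrderedTree}

theorem measure_pi (h : BranchingLaw ξ μ) (k : ℕ) (E : Fin k → Set OrderedTree)
    (hE : ∀ i, MeasurableSet (E i)) :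
    μ {T : OrderedTree | T.numChildren [] = (k : ℤ) ∧ ∀ i : Fin k, T.shift [Nat.succPNat i] ∈ E i}
      = ξ k * ∏ i, μ (E i) := by
  have := h.prob
  have hm : Measurable (fun (S : OrderedTree) (i : Fin k) => S.shift [Nat.succPNat i]) :=
    measurable_pi_lambda _ fun i => measurable_shift _
  have h1 := congrArg (fun ν => ν (univ.pi E)) (h.subtrees k)
  simp only [Measure.smul_apply, Measure.pi_pi, smul_eq_mul] at h1
  rw [Measure.map_apply hm (MeasurableSet.univ_pi hE),
    Measure.restrict_apply (hm (MeasurableSet.univ_pi hE))] at h1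
  rw [← h1]
  congr 1
  ext T
  simp [and_comm]

theorem ae_nil_mem (h : BranchingLaw ξ μ) : ∀ᵐ T ∂μ, [] ∈ T.carrier := by
  have := h.prob
  have h1 : μ {T : OrderedTree | [] ∈ T.carrier} = 1 := by
    rw [← iUnion_numChildren, measure_iUnion pairwise_disjoint_numChildren measurableSet_numChildren]
    simp_rw [h.root]
    exact ξ.tsum_coe
  rw [← prob_compl_eq_zero_iff (measurableSet_mem _)] at h1
  exact h1

theorem measure_eq_tsum (h : BranchingLaw ξ μ) {A : Set OrderedTree} (hA : MeasurableSet A) :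
    μ A = ∑' k : ℕ, μ ({T | T.numChildren [] = k} ∩ A) := by
  rw [← measure_iUnion]
  · rw [← iUnion_inter, iUnion_numChildren]
    refine measure_congr ?_
    filter_upwards [h.ae_nil_mem] with T hT
    exact propext ⟨fun hA => ⟨hT, hA⟩, fun hA => hA.2⟩
  · exact fun k l hkl => (pairwise_disjoint_numChildren hkl).mono inter_subset_left inter_subset_left
  · exact fun k => (measurableSet_numChildren k).inter hA

/-- The event that a finite set of words is in the tree, in terms of the subtrees. -/
theorem numChildren_inter_containing (k : ℕ) (S : Finset Word) :
    {T : OrderedTree | T.numChildren [] = k} ∩ containing S =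
      {T : OrderedTree | T.numChildren [] = (k : ℤ) ∧ (∀ i : Fin k, T.shift [Nat.succPNat i] ∈
        containing (tailsAt (Nat.succPNat i) S)) ∧ ∀ i : ℕ+, ∀ u, i :: u ∈ S → (i : ℕ) ≤ k} := by
  ext T
  simp only [mem_inter_iff, mem_ofPred_eq, containing, mem_tailsAt]
  refine and_congr_right fun hk => ?_
  rw [OrderedTree.numChildren_nil_eq_iff] at hk
  constructor
  · refine fun h => ⟨fun i u hu => h _ hu, fun i u hu => ?_⟩
    exact (hk.2 i).1 (OrderedTree.singleton_mem_of_cons_mem (h _ hu))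
  · rintro ⟨h1, h2⟩ u hu
    cases u with
    | nil => exact hk.1
    | cons i u =>
      have hi := h2 i u hu
      have e : Nat.succPNat i.natPred = i := PNat.succPNat_natPred i
      have := i.natPred_add_one
      have h3 := h1 ⟨i.natPred, by omega⟩ u (by simpa [e] using hu)
      simpa [e] using h3

/-- Given the number of children of the root, the presence of words of length at most `n + 1` is a
product event about words of length at most `n` in the subtrees. Hence the probabilities of the
generating pi-system are determined by `ξ`, by induction on the generation. -/
theorem unique {ν : Measure OrderedTree} (h : BranchingLaw ξ μ) (h' : BranchingLaw ξ ν) :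
    μ = ν := by
  have := h.prob
  have := h'.prob
  have key : ∀ n : ℕ, ∀ S : Finset Word, (∀ u ∈ S, u.length ≤ n) →
      μ (containing S) = ν (containing S) := by
    intro n
    induction n with
    | zero =>
      intro S hS
      have : ∀ T : OrderedTree, [] ∈ T.carrier → T ∈ containing S := fun T hT u hu => by
        rw [List.length_eq_zero_iff.1 (Nat.le_zero.1 (hS u hu))]; exact hT
      have e : containing S =ᵐ[μ] univ := eventuallyEq_univ.2 (h.ae_nil_mem.mono this)
      have e' : containing S =ᵐ[ν] univ := eventuallyEq_univ.2 (h'.ae_nil_mem.mono this)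
      rw [measure_congr e, measure_congr e', measure_univ, measure_univ]
    | succ n ih =>
      intro S hS
      rw [h.measure_eq_tsum (measurableSet_containing S),
        h'.measure_eq_tsum (measurableSet_containing S)]
      refine tsum_congr fun k => ?_
      rw [numChildren_inter_containing]
      by_cases hc : ∀ i : ℕ+, ∀ u, i :: u ∈ S → (i : ℕ) ≤ k
      · rw [eq_true hc]
        simp only [and_true]
        rw [h.measure_pi k _ fun i => measurableSet_containing _,
          h'.measure_pi k _ fun i => measurableSet_containing _]
        congr 1
        refine Finset.prod_congr rfl fun i _ => ih _ fun u hu => ?_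
        have := hS _ (mem_tailsAt.1 hu)
        simpa using this
      · rw [eq_false hc]
        simp
  refine ext_of_generate_finite (containing '' {S | ∀ u ∈ S, True}) ?_
    (isPiSystem_containing_forall _) ?_ (by simp)
  · rw [← memSigma_eq, memSigma_true]
  · rintro _ ⟨S, -, rfl⟩
    exact key (S.sup List.length) S fun u hu => Finset.le_sup (f := List.length) hu

end BranchingLaw

theorem tsum_ite_pnat_le (k : ℕ) (c : ℝ≥0∞) :
    ∑' i : ℕ+, (if (i : ℕ) ≤ k then c else 0) = k * c := by
  have h : (fun i : ℕ+ => if (i : ℕ) ≤ k then c else 0)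
      = {i : ℕ+ | (i : ℕ) ≤ k}.indicator fun _ => c := by
    ext i; simp [indicator]
  rw [h, ← tsum_subtype {i : ℕ+ | (i : ℕ) ≤ k} fun _ => c, ENNReal.tsum_set_const]
  have hfin : {i : ℕ+ | (i : ℕ) ≤ k}.Finite := by
    by_cases hk : k = 0
    · have : {i : ℕ+ | (i : ℕ) ≤ k} = ∅ := by
        ext i; have := i.pos; simp; omega
      rw [this]; exact finite_empty
    · exact finite_of_ncard_ne_zero (by rw [ncard_pnat_le]; exact hk)
  rw [← hfin.cast_ncard_eq, ncard_pnat_le]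
  simp

/-! ### Sizes of generations -/

theorem OrderedTree.finite_children (T : OrderedTree) : {i : ℕ+ | [i] ∈ T.carrier}.Finite := by
  by_cases h : [] ∈ T.carrier
  · obtain ⟨k, hk⟩ := T.children [] h
    refine (Set.finite_Iic (Nat.succPNat k)).subset fun i hi => ?_
    have := (hk i).1 hi
    rw [mem_Iic, ← PNat.coe_le_coe]
    simp; omega
  · convert finite_empty
    ext i
    simp only [mem_ofPred_eq, mem_empty_iff_false, iff_false]
    exact fun hi => h (OrderedTree.nil_mem_of_mem hi)

/-- The vertices at generation `n`. -/
def OrderedTree.generation (T : OrderedTree) (n : ℕ) : Set Word :=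
  {u : Word | u ∈ T.carrier ∧ u.length = n}

theorem OrderedTree.generation_succ (T : OrderedTree) (n : ℕ) :
    T.generation (n + 1) = ⋃ i ∈ {i : ℕ+ | [i] ∈ T.carrier},
      List.cons i '' (T.shift [i]).generation n := by
  ext u
  simp only [generation, mem_ofPred_eq, mem_iUnion, mem_image, mem_shift, exists_prop]
  constructor
  · rintro ⟨h, hl⟩
    cases u with
    | nil => simp at hl
    | cons i v => exact ⟨i, T.singleton_mem_of_cons_mem h, v, ⟨h, by simpa using hl⟩, rfl⟩
  · rintro ⟨i, -, v, ⟨h, hl⟩, rfl⟩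
    exact ⟨h, by simpa using hl⟩

theorem OrderedTree.finite_generation (n : ℕ) :
    ∀ T : OrderedTree, (T.generation n).Finite := by
  induction n with
  | zero =>
    intro T
    refine (finite_singleton []).subset fun u hu => ?_
    exact List.length_eq_zero_iff.1 hu.2
  | succ n ih =>
    intro T
    rw [generation_succ]
    exact T.finite_children.biUnion fun i _ => (ih _).image _

theorem OrderedTree.genSize_eq_tsum (T : OrderedTree) (n : ℕ) :
    (T.genSize n : ℝ≥0∞) = ∑' _ : T.generation n, 1 := by
  rw [ENNReal.tsum_set_one, ← (T.finite_generation n).cast_ncard_eq]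
  rfl

theorem OrderedTree.genSize_succ (T : OrderedTree) (n : ℕ) :
    (T.genSize (n + 1) : ℝ≥0∞) = ∑' i : ℕ+, ((T.shift [i]).genSize n : ℝ≥0∞) := by
  simp_rw [genSize_eq_tsum]
  rw [← ENNReal.tsum_sigma' (fun _ : (i : ℕ+) × (T.shift [i]).generation n => (1 : ℝ≥0∞))]
  refine (Equiv.tsum_eq (Equiv.ofBijective (fun p : (i : ℕ+) × (T.shift [i]).generation n =>
    (⟨p.1 :: p.2.1, p.2.2.1, by simp [p.2.2.2]⟩ : T.generation (n + 1))) ⟨?_, ?_⟩)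
    (fun _ => (1 : ℝ≥0∞))).symm
  · rintro ⟨i, u, hu⟩ ⟨j, v, hv⟩ h
    obtain ⟨rfl, rfl⟩ := List.cons.inj (congrArg Subtype.val h)
    rfl
  · rintro ⟨u, hu, hl⟩
    cases u with
    | nil => simp at hl
    | cons i v => exact ⟨⟨i, v, hu, by simpa using hl⟩, rfl⟩

theorem OrderedTree.genSize_eq_zero (T : OrderedTree) (n : ℕ) (h : [] ∉ T.carrier) :
    T.genSize n = 0 := by
  have : T.generation n = ∅ := by
    ext u
    simp only [mem_empty_iff_false, iff_false]
    exact fun hu => h (OrderedTree.nil_mem_of_mem hu.1)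
  show (T.generation n).ncard = 0
  rw [this, ncard_empty]

theorem OrderedTree.genSize_zero (T : OrderedTree) (h : [] ∈ T.carrier) : T.genSize 0 = 1 := by
  have : T.generation 0 = {[]} := by
    ext u
    simp only [generation, mem_ofPred_eq, mem_singleton_iff, List.length_eq_zero_iff]
    exact ⟨fun hu => hu.2, fun hu => ⟨hu ▸ h, hu⟩⟩
  show (T.generation 0).ncard = 1
  rw [this, ncard_singleton]

theorem measurable_genSize_memSigma (n : ℕ) :
    Measurable[memSigma fun u => u.length ≤ n] fun T : OrderedTree => (T.genSize n : ℝ≥0∞) := by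
  have : (fun T : OrderedTree => (T.genSize n : ℝ≥0∞)) = fun T => ∑' u : {u : Word // u.length = n},
      {T : OrderedTree | (u : Word) ∈ T.carrier}.indicator (fun _ => (1 : ℝ≥0∞)) T := by
    ext T
    have h2 : ∀ u : {u : Word // u.length = n},
        {T : OrderedTree | (u : Word) ∈ T.carrier}.indicator (fun _ => (1 : ℝ≥0∞)) T
        = (T.carrier).indicator (fun _ => (1 : ℝ≥0∞)) u := fun u => by
      simp [indicator]
    simp_rw [h2]
    rw [OrderedTree.genSize_eq_tsum, tsum_subtype (T.generation n) fun _ => (1 : ℝ≥0∞)]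
    have h3 := tsum_subtype {u : Word | u.length = n} ((T.carrier).indicator fun _ => (1 : ℝ≥0∞))
    refine Eq.trans ?_ h3.symm
    refine tsum_congr fun u => ?_
    rw [indicator_indicator]
    congr 1
    ext v; simp [OrderedTree.generation, and_comm]
  rw [this]
  refine @Measurable.tsum _ _ _ (memSigma fun u => u.length ≤ n) _ _ _ _ _ _ _ _ _ _ _ _ fun u => ?_
  exact (@measurable_const _ _ _ (memSigma fun u => u.length ≤ n) (1 : ℝ≥0∞)).indicator
    (measurableSet_memSigma u.2.le)

theorem measurable_genSize (n : ℕ) : Measurable fun T : OrderedTree => (T.genSize n : ℝ≥0∞) :=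
  (measurable_genSize_memSigma n).mono (memSigma_le _) le_rfl

/-! ### Independence of the subtree above a child and the rest of the tree -/

/-- The sigma-field generated by the tree outside of the subtree above `i`. -/
@[reducible] def siblingSigma (i : ℕ+) : MeasurableSpace OrderedTree :=
  memSigma fun u => u.head? ≠ some i

/-- The event that the root has a child `i`. -/
def hasChild (i : ℕ+) : Set OrderedTree := {T | [i] ∈ T.carrier}

theorem measurableSet_hasChild (i : ℕ+) : MeasurableSet (hasChild i) := measurableSet_mem [i]

theorem measurable_shift_siblingSigma {i j : ℕ+} (hij : j ≠ i) :
    @Measurable _ _ (siblingSigma i) _ (OrderedTree.shift [j]) := by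
  refine @measurable_generateFrom _ _ (siblingSigma i) _ _ ?_
  rintro _ ⟨v, rfl⟩
  exact measurableSet_memSigma (u := j :: v) (by simpa using hij)

namespace BranchingLaw

variable {ξ : PMF ℕ} {μ : Measure OrderedTree}

theorem measure_hasChild (h : BranchingLaw ξ μ) (i : ℕ+) :
    μ (hasChild i) = ∑' k : ℕ, if (i : ℕ) ≤ k then ξ k else 0 := by
  rw [h.measure_eq_tsum (measurableSet_hasChild i)]
  refine tsum_congr fun k => ?_
  split_ifs with hi
  · rw [← h.root k]
    congr 1
    ext T
    simp only [mem_inter_iff, and_iff_left_iff_imp]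
    exact fun hT => (((T.numChildren_nil_eq_iff k).1 hT).2 i).2 hi
  · convert measure_empty (μ := μ)
    ext T
    simp only [mem_inter_iff, mem_empty_iff_false, iff_false, not_and]
    exact fun hT hTi => hi ((((T.numChildren_nil_eq_iff k).1 hT).2 i).1 hTi)

theorem tsum_measure_hasChild (h : BranchingLaw ξ μ) : ∑' i : ℕ+, μ (hasChild i) = mean ξ := by
  simp_rw [h.measure_hasChild]
  rw [ENNReal.tsum_comm]
  exact tsum_congr fun k => tsum_ite_pnat_le k _

/-- On `k ≥ i` children the event is a box in the `k` independent subtrees. No word of `S` starts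
with `i`, so the `i`-th coordinate is constrained by `D` alone and `μ D` factors out, with a factor
that does not depend on `k`. -/
theorem measure_containing_inter_shift (h : BranchingLaw ξ μ) (i : ℕ+) {S : Finset Word}
    (hS : ∀ u ∈ S, u.head? ≠ some i) {D : Set OrderedTree} (hD : MeasurableSet D) :
    μ ((hasChild i ∩ OrderedTree.shift [i] ⁻¹' D) ∩ containing S)
      = μ D * μ (hasChild i ∩ containing S) := by
  have := h.prob
  classical
  have key : ∀ (k : ℕ) (D : Set OrderedTree), MeasurableSet D →
      μ ({T | T.numChildren [] = k} ∩ ((hasChild i ∩ OrderedTree.shift [i] ⁻¹' D) ∩ containing S))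
      = μ D * (if (i : ℕ) ≤ k ∧ ∀ j : ℕ+, ∀ u, j :: u ∈ S → (j : ℕ) ≤ k then
        ξ k * ∏ j : Fin k, μ (if Nat.succPNat j = i then univ
          else containing (tailsAt (Nat.succPNat j) S)) else 0) := by
    intro k D hD
    split_ifs with hc
    · obtain ⟨hik, hc⟩ := hc
      have e : Nat.succPNat i.natPred = i := PNat.succPNat_natPred i
      have hlt : i.natPred < k := by have := i.natPred_add_one; omega
      set i' : Fin k := ⟨i.natPred, hlt⟩
      have hi' : Nat.succPNat i' = i := e
      have heq : ∀ j : Fin k, Nat.succPNat j = i ↔ j = i' := fun j => by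
        constructor
        · intro hj
          exact Fin.ext (Nat.succPNat_injective (hj.trans hi'.symm))
        · rintro rfl; exact hi'
      set E : Fin k → Set OrderedTree := fun j => containing (tailsAt (Nat.succPNat j) S)
      have hset : ({T : OrderedTree | T.numChildren [] = (k : ℤ)} ∩
          ((hasChild i ∩ OrderedTree.shift [i] ⁻¹' D) ∩ containing S))
          = {T : OrderedTree | T.numChildren [] = (k : ℤ) ∧
            ∀ j : Fin k, T.shift [Nat.succPNat j] ∈ Function.update E i' D j} := by
        have h1 := numChildren_inter_containing k S
        rw [Set.ext_iff] at h1
        ext T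
        have h1 := h1 T
        simp only [mem_inter_iff, mem_ofPred_eq] at h1
        rw [inter_comm (hasChild i ∩ _), ← inter_assoc]
        simp only [mem_inter_iff, mem_ofPred_eq]
        rw [h1]
        constructor
        · rintro ⟨⟨hk, hE, -⟩, -, hTD⟩
          refine ⟨hk, fun j => ?_⟩
          by_cases hj : j = i'
          · subst hj; rw [Function.update_self, hi']; exact hTD
          · rw [Function.update_of_ne hj]; exact hE j
        · rintro ⟨hk, hE⟩
          refine ⟨⟨hk, fun j => ?_, hc⟩, ?_, ?_⟩
          · by_cases hj : j = i'
            · subst hj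
              intro u hu
              rw [hi', mem_tailsAt] at hu
              exact absurd rfl (hS _ hu)
            · have := hE j
              rwa [Function.update_of_ne hj] at this
          · exact (((T.numChildren_nil_eq_iff k).1 hk).2 i).2 hik
          · have := hE i'
            rwa [Function.update_self, hi'] at this
      rw [hset, h.measure_pi, lintegral_piUpdate, mul_comm (μ D), mul_assoc]
      · congr 2
        refine Finset.prod_congr rfl fun j _ => ?_
        by_cases hj : j = i'
        · rw [if_pos ((heq j).2 hj), hj, Function.update_self]
        · rw [if_neg (fun hh => hj ((heq j).1 hh)), Function.update_of_ne hj]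
      · intro j
        by_cases hj : j = i'
        · rw [hj, Function.update_self]; exact hD
        · rw [Function.update_of_ne hj]; exact measurableSet_containing _
    · rw [mul_zero]
      convert measure_empty (μ := μ)
      ext T
      simp only [mem_inter_iff, mem_empty_iff_false, iff_false, mem_ofPred_eq, mem_preimage]
      rintro ⟨hk, ⟨hi, -⟩, hTS⟩
      have hk' := ((T.numChildren_nil_eq_iff k).1 hk).2
      exact hc ⟨(hk' i).1 hi, fun j u hu =>
        (hk' j).1 (OrderedTree.singleton_mem_of_cons_mem (hTS _ hu))⟩
  have hD' := (measurableSet_hasChild i).inter (measurable_shift [i] hD)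
  rw [h.measure_eq_tsum (hD'.inter (measurableSet_containing S)),
    h.measure_eq_tsum ((measurableSet_hasChild i).inter (measurableSet_containing S)),
    ← ENNReal.tsum_mul_left]
  refine tsum_congr fun k => ?_
  have h2 := key k univ MeasurableSet.univ
  simp only [preimage_univ, inter_univ, measure_univ, one_mul] at h2
  rw [key k D hD, h2]

theorem measure_siblingSigma_inter_shift (h : BranchingLaw ξ μ) (i : ℕ+) {B D : Set OrderedTree}
    (hB : MeasurableSet[siblingSigma i] B) (hD : MeasurableSet D) :
    μ (hasChild i ∩ (B ∩ OrderedTree.shift [i] ⁻¹' D)) = μ (hasChild i ∩ B) * μ D := by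
  have := h.prob
  have hB' := memSigma_le _ _ hB
  have key := ext_on_measurableSpace_of_generate_finite
    (μ := μ.restrict (hasChild i ∩ OrderedTree.shift [i] ⁻¹' D))
    (ν := μ D • μ.restrict (hasChild i)) inferInstance _ ?_ (memSigma_le _)
    (memSigma_eq fun u => u.head? ≠ some i) (isPiSystem_containing_forall _) ?_ hB
  · rw [Measure.smul_apply, Measure.restrict_apply hB', Measure.restrict_apply hB'] at key
    rw [mul_comm, inter_comm _ B, ← smul_eq_mul, ← key]
    congr 1
    ext T; simp only [mem_inter_iff]; tauto
  · rintro _ ⟨S, hS, rfl⟩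
    rw [Measure.smul_apply, Measure.restrict_apply (measurableSet_containing S),
      Measure.restrict_apply (measurableSet_containing S), inter_comm,
      h.measure_containing_inter_shift i hS hD, inter_comm, smul_eq_mul]
  · have := h.measure_containing_inter_shift i (S := ∅) (by simp) hD
    simpa [containing_empty] using this

/-- The subtree above the child `i` is independent of the rest of the tree. -/
theorem lintegral_mul_shift (h : BranchingLaw ξ μ) (i : ℕ+) {H f : OrderedTree → ℝ≥0∞}
    (hH : Measurable[siblingSigma i] H) (hf : Measurable f) :
    ∫⁻ T in hasChild i, H T * f (T.shift [i]) ∂μ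
      = (∫⁻ T in hasChild i, H T ∂μ) * ∫⁻ T, f T ∂μ := by
  have := h.prob
  by_cases h0 : μ (hasChild i) = 0
  · rw [Measure.restrict_eq_zero.2 h0]; simp
  have htop : μ (hasChild i) ≠ ⊤ := measure_ne_top _ _
  have hres : μ.restrict (hasChild i) = μ (hasChild i) • μ[|hasChild i] := by
    rw [ProbabilityTheory.cond, smul_smul, ENNReal.mul_inv_cancel h0 htop, one_smul]
  have : IsProbabilityMeasure μ[|hasChild i] := cond_isProbabilityMeasure h0
  have hind : Indep (siblingSigma i) (MeasurableSpace.comap (OrderedTree.shift [i]) inferInstance)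
      μ[|hasChild i] := by
    rw [Indep_iff]
    rintro B _ hB ⟨D, hD, rfl⟩
    have hp := fun {D} hD => h.measure_siblingSigma_inter_shift i (D := D) hB hD
    have hp' := h.measure_siblingSigma_inter_shift i (B := univ) (D := D)
      (@MeasurableSet.univ _ (siblingSigma i)) hD
    rw [univ_inter, inter_univ] at hp'
    rw [cond_apply (measurableSet_hasChild i), cond_apply (measurableSet_hasChild i),
      cond_apply (measurableSet_hasChild i), hp hD, hp', ← mul_assoc,
      ← mul_assoc (μ (hasChild i))⁻¹ (μ (hasChild i)), ENNReal.inv_mul_cancel h0 htop, one_mul]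
  have hmap : ∫⁻ T, f (T.shift [i]) ∂μ[|hasChild i] = ∫⁻ T, f T ∂μ := by
    rw [← lintegral_map hf (measurable_shift [i])]
    congr 1
    ext D hD
    rw [Measure.map_apply (measurable_shift [i]) hD, cond_apply (measurableSet_hasChild i)]
    have hp' := h.measure_siblingSigma_inter_shift i (B := univ) (D := D)
      (@MeasurableSet.univ _ (siblingSigma i)) hD
    rw [univ_inter, inter_univ] at hp'
    rw [hp', ← mul_assoc, ENNReal.inv_mul_cancel h0 htop, one_mul]
  have hprod := lintegral_mul_eq_lintegral_mul_lintegral_of_independent_measurableSpace (memSigma_le _)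
      (measurable_shift [i]).comap_le hind hH
      (hf.comp (comap_measurable (OrderedTree.shift [i])))
  simp only [Function.comp_apply] at hprod
  rw [hres, lintegral_smul_measure, lintegral_smul_measure, hprod, hmap, smul_eq_mul, smul_eq_mul,
    mul_assoc]

theorem ae_shift_singleton (h : BranchingLaw ξ μ) {p : OrderedTree → Prop} (hp : ∀ᵐ T ∂μ, p T)
    (i : ℕ+) : ∀ᵐ T ∂μ, T ∈ hasChild i → p (T.shift [i]) := by
  set N := toMeasurable μ {T | ¬ p T}
  have hN : μ N = 0 := by rw [measure_toMeasurable]; exact hp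
  have hNm : MeasurableSet N := measurableSet_toMeasurable _ _
  have := h.measure_siblingSigma_inter_shift i (B := univ) (D := N)
    (@MeasurableSet.univ _ (siblingSigma i)) hNm
  rw [univ_inter, hN, mul_zero] at this
  refine measure_mono_null (fun T hT => ?_) this
  simp only [mem_compl_iff, mem_ofPred_eq, Classical.not_imp] at hT
  exact ⟨hT.1, subset_toMeasurable μ {T | ¬ p T} hT.2⟩

/-- Only words of the tree are quantified over: elsewhere the shift is the empty tree, for which an
almost sure property may fail. -/
theorem ae_shift (h : BranchingLaw ξ μ) {p : OrderedTree → Prop} (hp : ∀ᵐ T ∂μ, p T) :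
    ∀ᵐ T ∂μ, ∀ u ∈ T.carrier, p (T.shift u) := by
  rw [ae_all_iff]
  intro u
  induction u with
  | nil => filter_upwards [hp] with T hT _; simpa using hT
  | cons i u ih =>
    filter_upwards [h.ae_shift_singleton ih i] with T hT hu
    have := hT (T.singleton_mem_of_cons_mem hu) (by simpa using hu)
    rwa [OrderedTree.shift_shift] at this

theorem setLIntegral_containing_shift (h : BranchingLaw ξ μ) (i : ℕ+) (S : Finset Word)
    {f : OrderedTree → ℝ≥0∞} (hf : Measurable f) :
    ∫⁻ T in hasChild i ∩ containing S, f (T.shift [i]) ∂μ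
      = μ (hasChild i ∩ containing (dropAt i S)) * ∫⁻ T in containing (tailsAt i S), f T ∂μ := by
  have hd : MeasurableSet[siblingSigma i] (containing (dropAt i S)) := by
    have := memSigma_eq fun u : Word => u.head? ≠ some i
    unfold siblingSigma
    rw [this]
    exact MeasurableSpace.measurableSet_generateFrom
      ⟨_, fun u hu => (Finset.mem_filter.1 hu).2, rfl⟩
  have hd' := memSigma_le _ _ hd
  have ht := measurableSet_containing (tailsAt i S)
  have h1 := h.lintegral_mul_shift i (H := (containing (dropAt i S)).indicator fun _ => 1)
    (f := (containing (tailsAt i S)).indicator f)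
    ((@measurable_const _ _ _ (siblingSigma i) (1 : ℝ≥0∞)).indicator hd) (hf.indicator ht)
  rw [lintegral_indicator ht, lintegral_indicator hd', Measure.restrict_restrict hd',
    lintegral_const, one_mul, Measure.restrict_apply_univ, inter_comm] at h1
  rw [← h1]
  unfold hasChild
  rw [containing_inter_child, inter_comm, ← Measure.restrict_restrict
    (hd'.inter (measurable_shift [i] ht)), ← lintegral_indicator (hd'.inter (measurable_shift [i] ht))]
  refine lintegral_congr fun T => ?_
  by_cases h1 : T ∈ containing (dropAt i S) <;>
    by_cases h2 : T.shift [i] ∈ containing (tailsAt i S) <;> simp [h1, h2]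

theorem setLIntegral_shift_of_nil (i : ℕ+) {A : Set OrderedTree} (hA : MeasurableSet A)
    {f : OrderedTree → ℝ≥0∞} (h0 : ∀ T : OrderedTree, [] ∉ T.carrier → f T = 0) :
    ∫⁻ T in A, f (T.shift [i]) ∂μ = ∫⁻ T in hasChild i ∩ A, f (T.shift [i]) ∂μ := by
  rw [← lintegral_indicator hA, ← lintegral_indicator ((measurableSet_hasChild i).inter hA)]
  refine lintegral_congr fun T => ?_
  by_cases hT : T ∈ hasChild i
  · by_cases h2 : T ∈ A <;> simp [hT, h2]
  · have : f (T.shift [i]) = 0 := h0 _ fun hh => hT hh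
    simp [indicator, this]

/-- The martingale identity on a generating family. The induction decomposes at the first generation
rather than the last one, because independence is available only between a subtree above a child of
the root and the rest. -/
theorem setLIntegral_genSize_succ (h : BranchingLaw ξ μ) (n : ℕ) :
    ∀ S : Finset Word, (∀ u ∈ S, u.length ≤ n) →
      ∫⁻ T in containing S, (T.genSize (n + 1) : ℝ≥0∞) ∂μ
        = mean ξ * ∫⁻ T in containing S, (T.genSize n : ℝ≥0∞) ∂μ := by
  have hsucc : ∀ (n : ℕ) (S : Finset Word),
      ∫⁻ T in containing S, (T.genSize (n + 1) : ℝ≥0∞) ∂μ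
      = ∑' i : ℕ+, μ (hasChild i ∩ containing (dropAt i S)) *
        ∫⁻ T in containing (tailsAt i S), (T.genSize n : ℝ≥0∞) ∂μ := by
    intro n S
    simp_rw [OrderedTree.genSize_succ]
    rw [lintegral_tsum (f := fun (i : ℕ+) (T : OrderedTree) => ((T.shift [i]).genSize n : ℝ≥0∞))
      fun i => ((measurable_genSize n).comp (measurable_shift [i])).aemeasurable]
    refine tsum_congr fun i => ?_
    rw [← h.setLIntegral_containing_shift i S (measurable_genSize n)]
    exact setLIntegral_shift_of_nil i (measurableSet_containing S)
      (f := fun T => (T.genSize n : ℝ≥0∞)) fun T hT => by simp [T.genSize_eq_zero n hT]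
  induction n with
  | zero =>
    intro S hS
    have hS' : ∀ T : OrderedTree, [] ∈ T.carrier → T ∈ containing S := fun T hT u hu => by
      rw [List.length_eq_zero_iff.1 (Nat.le_zero.1 (hS u hu))]; exact hT
    have e : containing S =ᵐ[μ] containing ∅ := by
      rw [containing_empty]
      exact eventuallyEq_univ.2 (h.ae_nil_mem.mono hS')
    rw [setLIntegral_congr e, hsucc, setLIntegral_congr e]
    simp only [dropAt, tailsAt, Finset.filter_empty, Finset.image_empty, containing_empty,
      inter_univ, Measure.restrict_univ, ENNReal.tsum_mul_right]
    rw [h.tsum_measure_hasChild]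
  | succ n ih =>
    intro S hS
    rw [hsucc, hsucc, ← ENNReal.tsum_mul_left]
    refine tsum_congr fun i => ?_
    rw [ih]
    · ring
    · intro u hu
      have := hS _ (mem_tailsAt.1 hu)
      simpa using this

theorem lintegral_genSize (h : BranchingLaw ξ μ) (n : ℕ) :
    ∫⁻ T, (T.genSize n : ℝ≥0∞) ∂μ = mean ξ ^ n := by
  have := h.prob
  induction n with
  | zero =>
    have : ∫⁻ T, (T.genSize 0 : ℝ≥0∞) ∂μ = ∫⁻ _, 1 ∂μ := lintegral_congr_ae <| by
      filter_upwards [h.ae_nil_mem] with T hT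
      simp [T.genSize_zero hT]
    simp [this]
  | succ n ih =>
    have := h.setLIntegral_genSize_succ n ∅ (by simp)
    rw [containing_empty, Measure.restrict_univ, ih] at this
    rw [this, pow_succ, mul_comm]

end BranchingLaw

/-! ### Convergence of the normalized generation sizes -/

/-- The filtration of the first generations. -/
def generationFiltration : Filtration ℕ (inferInstance : MeasurableSpace OrderedTree) where
  seq n := memSigma fun u => u.length ≤ n
  mono' _ _ h := memSigma_mono fun _ hu => hu.trans h
  le' _ := memSigma_le _

/-- The limit `W` of the normalized generation sizes. -/
noncomputable def totalMass (m : ℝ≥0∞) (T : OrderedTree) : ℝ≥0∞ := limitMass m T []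

theorem limitMass_eq (m : ℝ≥0∞) (T : OrderedTree) (u : Word) :
    limitMass m T u = totalMass m (T.shift u) := by
  simp [totalMass, limitMass]

theorem totalMass_eq (m : ℝ≥0∞) (T : OrderedTree) :
    totalMass m T = limsup (fun n : ℕ => (T.genSize n : ℝ≥0∞) / m ^ n) atTop := by
  simp [totalMass, limitMass]

theorem totalMass_eq_zero {m : ℝ≥0∞} {T : OrderedTree} (h : [] ∉ T.carrier) :
    totalMass m T = 0 := by
  rw [totalMass_eq]
  simp [T.genSize_eq_zero _ h]

theorem measurable_totalMass (m : ℝ≥0∞) : Measurable (totalMass m) := by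
  have : totalMass m = fun T => limsup (fun n : ℕ => (T.genSize n : ℝ≥0∞) / m ^ n) atTop :=
    funext (totalMass_eq m)
  rw [this]
  exact Measurable.limsup fun n => (measurable_genSize n).div_const _

/-- The root has finitely many children, so the limit passes through the sum. This uses genuine
limits: a limsup alone would only be subadditive. -/
theorem totalMass_eq_tsum {m : ℝ≥0∞} (hm : m ≠ 0) (hm' : m ≠ ⊤) {T : OrderedTree}
    (h : Tendsto (fun n : ℕ => (T.genSize n : ℝ≥0∞) / m ^ n) atTop (𝓝 (totalMass m T)))
    (h' : ∀ i : ℕ+, Tendsto (fun n : ℕ => ((T.shift [i]).genSize n : ℝ≥0∞) / m ^ n) atTop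
      (𝓝 (totalMass m (T.shift [i])))) :
    totalMass m T = (∑' i : ℕ+, totalMass m (T.shift [i])) / m := by
  set s := T.finite_children.toFinset
  have hs : ∀ i ∉ s, [] ∉ (T.shift [i]).carrier := fun i hi => by
    simpa [s] using hi
  have h1 : Tendsto (fun n : ℕ => (T.genSize (n + 1) : ℝ≥0∞) / m ^ (n + 1)) atTop
      (𝓝 (totalMass m T)) := (tendsto_add_atTop_iff_nat 1).2 h
  refine tendsto_nhds_unique h1 ?_
  have h2 : (fun n : ℕ => (T.genSize (n + 1) : ℝ≥0∞) / m ^ (n + 1))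
      = fun n => (∑ i ∈ s, ((T.shift [i]).genSize n : ℝ≥0∞) / m ^ n) / m := by
    ext n
    rw [T.genSize_succ, tsum_eq_sum (s := s) fun i hi => by simp [(T.shift [i]).genSize_eq_zero n (hs i hi)]]
    simp_rw [div_eq_mul_inv]
    rw [← Finset.sum_mul, pow_succ, ENNReal.mul_inv (Or.inr hm') (Or.inr hm), mul_assoc]
  rw [h2, tsum_eq_sum (s := s) fun i hi => totalMass_eq_zero (hs i hi)]
  exact ENNReal.Tendsto.div_const (tendsto_finsetSum _ fun i _ => h' i) (Or.inr hm)

/-- The trees for which the masses are finite and consistent. -/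
def goodTrees (m : ℝ≥0∞) : Set OrderedTree :=
  {T | totalMass m T ≠ ⊤ ∧ ∀ u : Word,
    totalMass m (T.shift u) = (∑' i : ℕ+, totalMass m (T.shift (u ++ [i]))) / m}

theorem measurableSet_goodTrees (m : ℝ≥0∞) : MeasurableSet (goodTrees m) := by
  have hmeas := fun u : Word => (measurable_totalMass m).comp (measurable_shift u)
  have : goodTrees m = {T | totalMass m T = ⊤}ᶜ ∩ ⋂ u : Word, {T |
      totalMass m (T.shift u) = (∑' i : ℕ+, totalMass m (T.shift (u ++ [i]))) / m} := by
    ext T; simp [goodTrees]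
  rw [this]
  refine (measurable_totalMass m (measurableSet_singleton ⊤)).compl.inter
    (MeasurableSet.iInter fun u => measurableSet_eq_fun (hmeas u) ?_)
  exact (Measurable.tsum fun i => hmeas (u ++ [i])).div_const m

theorem shift_mem_goodTrees {m : ℝ≥0∞} (hm' : m ≠ ⊤) {T : OrderedTree}
    (h : T ∈ goodTrees m) (i : ℕ+) : T.shift [i] ∈ goodTrees m := by
  refine ⟨fun htop => h.1 ?_, fun u => ?_⟩
  · have := h.2 []
    simp only [OrderedTree.shift_nil, List.nil_append] at this
    have h2 : ∑' i : ℕ+, totalMass m (T.shift [i]) = ⊤ :=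
      ENNReal.tsum_eq_top_of_eq_top ⟨i, htop⟩
    rw [this, h2, ENNReal.top_div_of_ne_top hm']
  · have := h.2 (i :: u)
    simpa [OrderedTree.shift_shift] using this

namespace BranchingLaw

variable {ξ : PMF ℕ} {μ : Measure OrderedTree}

theorem setLIntegral_genSize_succ_of_measurableSet (h : BranchingLaw ξ μ)
    (hm' : mean ξ ≠ ⊤) (n : ℕ) {A : Set OrderedTree}
    (hA : MeasurableSet[memSigma fun u => u.length ≤ n] A) :
    ∫⁻ T in A, (T.genSize (n + 1) : ℝ≥0∞) ∂μ = mean ξ * ∫⁻ T in A, (T.genSize n : ℝ≥0∞) ∂μ := by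
  have hAm := memSigma_le _ _ hA
  have : IsFiniteMeasure (μ.withDensity fun T => (T.genSize (n + 1) : ℝ≥0∞)) :=
    isFiniteMeasure_withDensity (by rw [h.lintegral_genSize]; exact ENNReal.pow_ne_top hm')
  have key := ext_on_measurableSpace_of_generate_finite
    (μ := μ.withDensity fun T => (T.genSize (n + 1) : ℝ≥0∞))
    (ν := mean ξ • μ.withDensity fun T => (T.genSize n : ℝ≥0∞)) inferInstance _ ?_ (memSigma_le _)
    (memSigma_eq fun u => u.length ≤ n) (isPiSystem_containing_forall _) ?_ hA
  · rwa [Measure.smul_apply, withDensity_apply _ hAm, withDensity_apply _ hAm, smul_eq_mul] at key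
  · rintro _ ⟨S, hS, rfl⟩
    rw [Measure.smul_apply, withDensity_apply _ (measurableSet_containing S),
      withDensity_apply _ (measurableSet_containing S), smul_eq_mul]
    exact h.setLIntegral_genSize_succ n S hS
  · rw [Measure.smul_apply, withDensity_apply _ .univ, withDensity_apply _ .univ, smul_eq_mul,
      Measure.restrict_univ, h.lintegral_genSize, h.lintegral_genSize, pow_succ, mul_comm]

/-- The normalized sizes form a nonnegative martingale of mean one, hence bounded in `L¹`, and
converge almost surely to a finite limit. That the limit may vanish does no harm here. -/
theorem ae_tendsto_genSize (h : BranchingLaw ξ μ) (hm : mean ξ ≠ 0) (hm' : mean ξ ≠ ⊤) :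
    ∀ᵐ T ∂μ, ∃ c : ℝ≥0, Tendsto (fun n : ℕ => (T.genSize n : ℝ≥0∞) / mean ξ ^ n) atTop (𝓝 c) := by
  have := h.prob
  set m := mean ξ
  set f : ℕ → OrderedTree → ℝ := fun n T => ((T.genSize n : ℝ≥0∞) / m ^ n).toReal with hf
  have hpow : ∀ n, m ^ n ≠ 0 := fun n => pow_ne_zero _ hm
  have hpow' : ∀ n, m ^ n ≠ ⊤ := fun n => ENNReal.pow_ne_top hm'
  have hfin : ∀ n (T : OrderedTree), (T.genSize n : ℝ≥0∞) / m ^ n ≠ ⊤ := fun n T =>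
    ENNReal.div_ne_top (ENNReal.natCast_ne_top _) (hpow n)
  have hmeasF : ∀ n, Measurable[memSigma fun u => u.length ≤ n] (f n) := fun n =>
    ((measurable_genSize_memSigma n).div_const _).ennreal_toReal
  have hmeas : ∀ n, Measurable fun T : OrderedTree => (T.genSize n : ℝ≥0∞) / m ^ n := fun n =>
    (measurable_genSize n).div_const _
  have hint : ∀ n, ∫⁻ T, (T.genSize n : ℝ≥0∞) / m ^ n ∂μ = 1 := fun n => by
    simp_rw [div_eq_mul_inv]
    rw [lintegral_mul_const _ (measurable_genSize n), h.lintegral_genSize,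
      ENNReal.mul_inv_cancel (hpow n) (hpow' n)]
  have hmart : Martingale f generationFiltration μ := by
    refine martingale_of_setIntegral_eq_succ (fun n => (hmeasF n).stronglyMeasurable) (fun n => ?_)
      fun n A hA => ?_
    · exact integrable_toReal_of_lintegral_ne_top (hmeas n).aemeasurable (by rw [hint]; simp)
    · rw [integral_toReal (hmeas n).aemeasurable (ae_of_all _ fun T => (hfin n T).lt_top),
        integral_toReal (hmeas (n + 1)).aemeasurable (ae_of_all _ fun T => (hfin _ T).lt_top)]
      congr 1
      simp_rw [div_eq_mul_inv]
      rw [lintegral_mul_const _ (measurable_genSize _), lintegral_mul_const _ (measurable_genSize _),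
        h.setLIntegral_genSize_succ_of_measurableSet hm' n hA, pow_succ,
        ENNReal.mul_inv (Or.inr hm') (Or.inr hm), mul_comm (mean ξ), mul_assoc,
        mul_comm (m ^ n)⁻¹, ← mul_assoc (mean ξ), ENNReal.mul_inv_cancel hm hm', one_mul]
  have hbdd : ∀ n, eLpNorm (f n) 1 μ ≤ ((1 : ℝ≥0) : ℝ≥0∞) := fun n => by
    rw [eLpNorm_one_eq_lintegral_enorm, ENNReal.coe_one, ← hint n]
    refine le_of_eq (lintegral_congr fun T => ?_)
    rw [hf, Real.enorm_eq_ofReal ENNReal.toReal_nonneg, ENNReal.ofReal_toReal (hfin n T)]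
  filter_upwards [hmart.submartingale.exists_ae_tendsto_of_bdd hbdd] with T hT
  obtain ⟨c, hc⟩ := hT
  have h2 := ENNReal.tendsto_ofReal hc
  simp only [hf, ENNReal.ofReal_toReal (hfin _ T)] at h2
  exact ⟨c.toNNReal, h2⟩

theorem ae_tendsto_totalMass (h : BranchingLaw ξ μ) (hm : mean ξ ≠ 0) (hm' : mean ξ ≠ ⊤) :
    ∀ᵐ T ∂μ, totalMass (mean ξ) T ≠ ⊤ ∧ ∀ u : Word,
      Tendsto (fun n : ℕ => ((T.shift u).genSize n : ℝ≥0∞) / mean ξ ^ n) atTop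
        (𝓝 (totalMass (mean ξ) (T.shift u))) := by
  have key : ∀ T : OrderedTree,
      (∃ c : ℝ≥0, Tendsto (fun n : ℕ => (T.genSize n : ℝ≥0∞) / mean ξ ^ n) atTop (𝓝 c)) →
      totalMass (mean ξ) T ≠ ⊤ ∧ Tendsto (fun n : ℕ => (T.genSize n : ℝ≥0∞) / mean ξ ^ n) atTop
        (𝓝 (totalMass (mean ξ) T)) := by
    rintro T ⟨c, hc⟩
    have : totalMass (mean ξ) T = c := by rw [totalMass_eq]; exact hc.limsup_eq
    rw [this]
    exact ⟨ENNReal.coe_ne_top, hc⟩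
  filter_upwards [h.ae_tendsto_genSize hm hm', h.ae_shift (h.ae_tendsto_genSize hm hm')] with T hT hTu
  refine ⟨(key T hT).1, fun u => ?_⟩
  by_cases hu : u ∈ T.carrier
  · exact (key _ (hTu u hu)).2
  · have hu' : [] ∉ (T.shift u).carrier := by simpa using hu
    simp [(T.shift u).genSize_eq_zero _ hu', totalMass_eq_zero hu']

theorem ae_goodTrees (h : BranchingLaw ξ μ) (hm : mean ξ ≠ 0) (hm' : mean ξ ≠ ⊤) :
    ∀ᵐ T ∂μ, T ∈ goodTrees (mean ξ) := by
  filter_upwards [h.ae_tendsto_totalMass hm hm'] with T hT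
  refine ⟨hT.1, fun u => ?_⟩
  have := totalMass_eq_tsum hm hm' (hT.2 u) fun i => by
    simpa [OrderedTree.shift_shift] using hT.2 (u ++ [i])
  simpa only [OrderedTree.shift_shift] using this

end BranchingLaw

/-! ### Measures with given consistent masses of cylinders -/

theorem Ray.trunc_succ (x : Ray) (n : ℕ) : x.trunc (n + 1) = x.trunc n ++ [x.digit n] := by
  simp [Ray.trunc, List.range_succ]

theorem measurable_to_ray {α : Type*} [MeasurableSpace α] {f : α → Ray}
    (hf : ∀ u : Word, MeasurableSet (f ⁻¹' cylinder u)) : Measurable f := by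
  change @Measurable _ _ _ (borel Ray) f
  rw [borel_eq_generateFrom_cylinder]
  refine measurable_generateFrom ?_
  rintro _ ⟨u, rfl⟩
  exact hf u

theorem cylinder_nil : cylinder [] = univ := by ext x; simp [cylinder, Ray.trunc]

theorem measurableSet_cylinder (u : Word) : MeasurableSet (cylinder u) := by
  change MeasurableSet[borel Ray] (cylinder u)
  rw [borel_eq_generateFrom_cylinder]
  exact MeasurableSpace.measurableSet_generateFrom ⟨u, rfl⟩

/-- The vertex at generation `n` on the ray that takes the child `c u` at each word `u`. -/
def followChoice (c : Word → ℕ+) : ℕ → Word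
  | 0 => []
  | n + 1 => followChoice c n ++ [c (followChoice c n)]

/-- The ray that takes the child `c u` at each word `u`. -/
def choiceRay (c : Word → ℕ+) : Ray := ⟨fun n => c (followChoice c n)⟩

theorem choiceRay_trunc (c : Word → ℕ+) (n : ℕ) : (choiceRay c).trunc n = followChoice c n := by
  induction n with
  | zero => rfl
  | succ n ih => rw [Ray.trunc_succ, ih]; rfl

theorem choiceRay_mem_cylinder_append (c : Word → ℕ+) (u : Word) (i : ℕ+) :
    choiceRay c ∈ cylinder (u ++ [i]) ↔ choiceRay c ∈ cylinder u ∧ c u = i := by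
  simp only [cylinder, mem_ofPred_eq, choiceRay_trunc, List.length_append, List.length_singleton,
    followChoice]
  constructor
  · intro h
    obtain ⟨h1, h2⟩ := List.append_inj' h rfl
    refine ⟨h1, ?_⟩
    rw [h1] at h2
    simpa using h2
  · rintro ⟨h1, h2⟩
    rw [h1, h2]

/-- Choose independently, at every word `u`, a child `i` with probability `v (u ++ [i]) / v u`. The
law of the resulting ray, multiplied by `v []`, is the measure: a ray lies in a cylinder exactly
when the choices at finitely many prefixes are prescribed, so its probability is a telescoping
product. -/
theorem exists_measure_cylinder_eq (v : Word → ℝ≥0∞) (h0 : v [] ≠ ⊤)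
    (hv : ∀ u, v u = ∑' i : ℕ+, v (u ++ [i])) :
    ∃ μ : Measure Ray, IsFiniteMeasure μ ∧ ∀ u, μ (cylinder u) = v u := by
  classical
  let _ : MeasurableSpace ℕ+ := ⊤
  have hle : ∀ u i, v (u ++ [i]) ≤ v u := fun u i => by rw [hv u]; exact ENNReal.le_tsum i
  have hfin : ∀ u, v u ≠ ⊤ := fun u => by
    induction u using List.reverseRecOn with
    | nil => exact h0
    | append_singleton u i ih => exact ne_top_of_le_ne_top ih (hle u i)
  have hp : ∀ u, ∃ p : PMF ℕ+, ∀ i, v u * p i = v (u ++ [i]) := fun u => by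
    by_cases h : v u = 0
    -- A word without mass is reached with probability zero, so any law of the choice will do.
    · refine ⟨PMF.pure 1, fun i => ?_⟩
      rw [h, zero_mul, eq_comm, ← nonpos_iff_eq_zero, ← h]
      exact hle u i
    · refine ⟨PMF.normalize (fun i => v (u ++ [i])) (by rwa [← hv]) (by rw [← hv]; exact hfin u),
        fun i => ?_⟩
      rw [PMF.normalize_apply, ← hv, mul_comm, mul_assoc, ENNReal.inv_mul_cancel h (hfin u), mul_one]
  choose p hp using hp
  set P : Measure (Word → ℕ+) := Measure.infinitePi fun u => (p u).toMeasure with hP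
  -- The strict bound on lengths makes `u` a new coordinate when the cylinder is extended by one
  -- letter, so that the extension contributes one independent factor.
  have key : ∀ u : Word, ∃ (F : Finset Word) (t : Word → Set ℕ+), (∀ w ∈ F, w.length < u.length) ∧
      choiceRay ⁻¹' cylinder u = (F : Set Word).pi t ∧
      v [] * ∏ w ∈ F, (p w).toMeasure (t w) = v u := by
    intro u
    induction u using List.reverseRecOn with
    | nil => exact ⟨∅, fun _ => ∅, by simp, by simp [cylinder_nil], by simp⟩
    | append_singleton u i ih =>
      obtain ⟨F, t, hF, hE, hprod⟩ := ih
      have hu : u ∉ F := fun h => lt_irrefl _ (hF u h)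
      have hne : ∀ w ∈ F, w ≠ u := fun w hw h => hu (h ▸ hw)
      refine ⟨insert u F, Function.update t u {i}, ?_, ?_, ?_⟩
      · intro w hw
        rw [List.length_append, List.length_singleton, Nat.lt_succ_iff]
        rcases Finset.mem_insert.1 hw with rfl | hw
        exacts [le_rfl, (hF w hw).le]
      · ext c
        have hc : c ∈ choiceRay ⁻¹' cylinder u ↔ c ∈ (F : Set Word).pi t := by rw [hE]
        rw [mem_preimage, choiceRay_mem_cylinder_append, ← mem_preimage, hc, Finset.coe_insert]
        simp only [Set.mem_pi, Set.mem_insert_iff, forall_eq_or_imp, Function.update_self,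
          mem_singleton_iff, Finset.mem_coe]
        rw [and_comm]
        refine and_congr_right fun _ => forall₂_congr fun w hw => ?_
        rw [Function.update_of_ne (hne w hw)]
      · rw [Finset.prod_insert hu, Function.update_self,
          PMF.toMeasure_apply_singleton _ _ (MeasurableSet.singleton i),
          Finset.prod_congr rfl fun w hw => by rw [Function.update_of_ne (hne w hw)],
          mul_comm (p u i), ← mul_assoc, hprod, hp]
  have hm : Measurable choiceRay := measurable_to_ray fun u => by
    obtain ⟨F, t, -, hE, -⟩ := key u
    rw [hE]
    exact MeasurableSet.pi F.countable_toSet fun w _ => MeasurableSpace.measurableSet_top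
  refine ⟨v [] • P.map choiceRay, ?_, fun u => ?_⟩
  · have : IsProbabilityMeasure (P.map choiceRay) := Measure.isProbabilityMeasure_map hm.aemeasurable
    exact ⟨by simpa using h0.lt_top⟩
  · obtain ⟨F, t, -, hE, hprod⟩ := key u
    rw [Measure.smul_apply, Measure.map_apply hm (measurableSet_cylinder u), hE, hP,
      Measure.infinitePi_pi _ fun w _ => MeasurableSpace.measurableSet_top, smul_eq_mul, hprod]

theorem exists_isBranchingMeasure {m : ℝ≥0∞} (hm : m ≠ 0) (hm' : m ≠ ⊤) {T : OrderedTree}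
    (h : T ∈ goodTrees m) : ∃ μ, IsBranchingMeasure m T μ := by
  obtain ⟨μ, hfin, hμ⟩ := exists_measure_cylinder_eq (fun u => totalMass m (T.shift u) / m ^ u.length)
    (by simpa using h.1) fun u => by
      rw [h.2 u]
      simp_rw [List.length_append, List.length_singleton, div_eq_mul_inv]
      rw [ENNReal.tsum_mul_right, pow_succ, ENNReal.mul_inv (Or.inr hm') (Or.inr hm),
        mul_comm (m ^ u.length)⁻¹, mul_assoc]
  exact ⟨μ, hfin, fun u => by rw [limitMass_eq]; exact hμ u⟩

theorem isBranchingMeasure_branchingMeasure {m : ℝ≥0∞} (hm : m ≠ 0) (hm' : m ≠ ⊤) {T : OrderedTree}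
    (h : T ∈ goodTrees m) : IsBranchingMeasure m T (branchingMeasure m T) := by
  have := exists_isBranchingMeasure hm hm' h
  rw [branchingMeasure, dif_pos this]
  exact this.choose_spec

/-! ### The branching measure as a measurable function of the tree -/

/-- The infinite sequence without its first term. -/
def Ray.tail (x : Ray) : Ray := ⟨fun n => x.digit (n + 1)⟩

theorem Ray.trunc_succ' (x : Ray) (n : ℕ) : x.trunc (n + 1) = x.digit 0 :: x.tail.trunc n := by
  induction n with
  | zero => rfl
  | succ n ih => rw [Ray.trunc_succ, ih, Ray.trunc_succ]; rfl

theorem mem_cylinder_cons {x : Ray} {i : ℕ+} {u : Word} :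
    x ∈ cylinder (i :: u) ↔ x.digit 0 = i ∧ x.tail ∈ cylinder u := by
  simp [cylinder, Ray.trunc_succ']

theorem mem_cylinder_singleton {x : Ray} {i : ℕ+} : x ∈ cylinder [i] ↔ x.digit 0 = i := by
  simp [mem_cylinder_cons, cylinder_nil]

theorem measurable_tail : Measurable Ray.tail := measurable_to_ray fun u => by
  have : Ray.tail ⁻¹' cylinder u = ⋃ i : ℕ+, cylinder (i :: u) := by
    ext x; simp [mem_cylinder_cons]
  rw [this]
  exact MeasurableSet.iUnion fun i => measurableSet_cylinder _

theorem ray_measure_ext {μ ν : Measure Ray} [IsFiniteMeasure μ]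
    (h : ∀ u, μ (cylinder u) = ν (cylinder u)) : μ = ν := by
  refine ext_of_generate_finite _ borel_eq_generateFrom_cylinder isPiSystem_cylinder ?_ ?_
  · rintro _ ⟨u, rfl⟩; exact h u
  · rw [← cylinder_nil]; exact h []

instance isFiniteMeasure_branchingMeasure (m : ℝ≥0∞) (T : OrderedTree) :
    IsFiniteMeasure (branchingMeasure m T) := by
  unfold branchingMeasure
  split_ifs with h
  · exact h.choose_spec.finite
  · infer_instance

open Classical in
/-- The branching measure of a good tree, and zero otherwise. -/
noncomputable def rayMeasure (m : ℝ≥0∞) (T : OrderedTree) : Measure Ray :=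
  if T ∈ goodTrees m then branchingMeasure m T else 0

instance isFiniteMeasure_rayMeasure (m : ℝ≥0∞) (T : OrderedTree) :
    IsFiniteMeasure (rayMeasure m T) := by
  unfold rayMeasure
  split_ifs <;> infer_instance

theorem rayMeasure_of_mem {m : ℝ≥0∞} {T : OrderedTree} (h : T ∈ goodTrees m) :
    rayMeasure m T = branchingMeasure m T := if_pos h

theorem rayMeasure_cylinder {m : ℝ≥0∞} (hm : m ≠ 0) (hm' : m ≠ ⊤) {T : OrderedTree}
    (h : T ∈ goodTrees m) (u : Word) :
    rayMeasure m T (cylinder u) = totalMass m (T.shift u) / m ^ u.length := by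
  rw [rayMeasure_of_mem h, (isBranchingMeasure_branchingMeasure hm hm' h).cylinder_eq, limitMass_eq]

theorem measurable_rayMeasure {m : ℝ≥0∞} (hm : m ≠ 0) (hm' : m ≠ ⊤) :
    Measurable (rayMeasure m) := by
  have key : ∀ u, Measurable fun T => rayMeasure m T (cylinder u) := fun u => by
    have : (fun T => rayMeasure m T (cylinder u)) =
        (goodTrees m).indicator fun T => totalMass m (T.shift u) / m ^ u.length := by
      ext T
      by_cases h : T ∈ goodTrees m
      · rw [indicator_of_mem h, rayMeasure_cylinder hm hm' h]
      · rw [indicator_of_notMem h, rayMeasure, if_neg h]; rfl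
    rw [this]
    exact (((measurable_totalMass m).comp (measurable_shift u)).div_const _).indicator
      (measurableSet_goodTrees m)
  refine Measurable.measure_of_isPiSystem borel_eq_generateFrom_cylinder isPiSystem_cylinder ?_ ?_
  · rintro _ ⟨u, rfl⟩; exact key u
  · rw [← cylinder_nil]; exact key []

theorem rayMeasure_eq_zero {m : ℝ≥0∞} (hm : m ≠ 0) (hm' : m ≠ ⊤) {T : OrderedTree}
    (h : [] ∉ T.carrier) : rayMeasure m T = 0 := by
  by_cases hT : T ∈ goodTrees m
  · rw [← Measure.measure_univ_eq_zero, ← cylinder_nil, rayMeasure_cylinder hm hm' hT,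
      OrderedTree.shift_nil, totalMass_eq_zero h, ENNReal.zero_div]
  · rw [rayMeasure, if_neg hT]

theorem rayMeasure_cylinder_eq_zero {m : ℝ≥0∞} (hm : m ≠ 0) (hm' : m ≠ ⊤) {T : OrderedTree}
    {u : Word} (h : u ∉ T.carrier) : rayMeasure m T (cylinder u) = 0 := by
  by_cases hT : T ∈ goodTrees m
  · rw [rayMeasure_cylinder hm hm' hT, totalMass_eq_zero (by simpa using h), ENNReal.zero_div]
  · rw [rayMeasure, if_neg hT]; rfl

/-- Self-similarity of the branching measure: inside the first-generation cylinder it is a copy of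
the measure of the subtree, scaled by `m⁻¹`. -/
theorem rayMeasure_child {m : ℝ≥0∞} (hm : m ≠ 0) (hm' : m ≠ ⊤) {T : OrderedTree}
    (h : T ∈ goodTrees m) (i : ℕ+) {D : Set Ray} (hD : MeasurableSet D) :
    rayMeasure m T (cylinder [i] ∩ Ray.tail ⁻¹' D) = m⁻¹ * rayMeasure m (T.shift [i]) D := by
  have : ((rayMeasure m T).restrict (cylinder [i])).map Ray.tail
      = m⁻¹ • rayMeasure m (T.shift [i]) := by
    refine ray_measure_ext fun u => ?_
    rw [Measure.map_apply measurable_tail (measurableSet_cylinder u),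
      Measure.restrict_apply (measurable_tail (measurableSet_cylinder u)), Measure.smul_apply,
      rayMeasure_cylinder hm hm' (shift_mem_goodTrees hm' h i)]
    have : Ray.tail ⁻¹' cylinder u ∩ cylinder [i] = cylinder (i :: u) := by
      ext x
      rw [mem_inter_iff, mem_cylinder_singleton, mem_cylinder_cons, and_comm, mem_preimage]
    rw [this, rayMeasure_cylinder hm hm' h, OrderedTree.shift_shift, List.length_cons, smul_eq_mul,
      pow_succ, div_eq_mul_inv, div_eq_mul_inv, ENNReal.mul_inv (Or.inr hm') (Or.inr hm)]
    simp only [List.cons_append, List.nil_append]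
    ring
  rw [← smul_eq_mul, ← Measure.smul_apply, ← this, Measure.map_apply measurable_tail hD,
    Measure.restrict_apply (measurable_tail hD), inter_comm]

/-! ### The size-biased law of a tree with a ray -/

/-- The measure `μ(dT) M_T(dx)` on trees with a ray. -/
noncomputable def spineLaw (m : ℝ≥0∞) (μ : Measure OrderedTree) : Measure (OrderedTree × Ray) :=
  μ.bind fun T => (rayMeasure m T).map (Prod.mk T)

theorem measurable_map_rayMeasure {m : ℝ≥0∞} (hm : m ≠ 0) (hm' : m ≠ ⊤) :
    Measurable fun T => (rayMeasure m T).map (Prod.mk T) := by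
  have : ∀ T, IsFiniteMeasure ((rayMeasure m T).map (Prod.mk T)) := fun T => inferInstance
  have key : ∀ A : Set OrderedTree, MeasurableSet A → ∀ D : Set Ray, MeasurableSet D →
      Measurable fun T => (rayMeasure m T).map (Prod.mk T) (A ×ˢ D) := by
    intro A hA D hD
    have : (fun T => (rayMeasure m T).map (Prod.mk T) (A ×ˢ D)) =
        A.indicator fun T => rayMeasure m T D := by
      ext T
      rw [Measure.map_apply measurable_prodMk_left (hA.prod hD)]
      by_cases h : T ∈ A
      · rw [indicator_of_mem h]; congr 1; ext x; simp [h]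
      · rw [indicator_of_notMem h]; convert measure_empty (μ := rayMeasure m T); ext x; simp [h]
    rw [this]
    exact (((Measure.measurable_coe hD).comp (measurable_rayMeasure hm hm')).indicator hA)
  refine Measurable.measure_of_isPiSystem generateFrom_prod.symm isPiSystem_prod ?_ ?_
  · rintro _ ⟨A, hA, D, hD, rfl⟩
    exact key A hA D hD
  · rw [← univ_prod_univ]
    exact key univ .univ univ .univ

theorem spineLaw_apply {m : ℝ≥0∞} (hm : m ≠ 0) (hm' : m ≠ ⊤) (μ : Measure OrderedTree)
    {A : Set (OrderedTree × Ray)} (hA : MeasurableSet A) :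
    spineLaw m μ A = ∫⁻ T, rayMeasure m T {x | (T, x) ∈ A} ∂μ := by
  rw [spineLaw, Measure.bind_apply hA (measurable_map_rayMeasure hm hm').aemeasurable]
  refine lintegral_congr fun T => ?_
  rw [Measure.map_apply measurable_prodMk_left hA]
  rfl

theorem measurable_rayMeasure_section {m : ℝ≥0∞} (hm : m ≠ 0) (hm' : m ≠ ⊤)
    {A : Set (OrderedTree × Ray)} (hA : MeasurableSet A) :
    Measurable fun T => rayMeasure m T {x | (T, x) ∈ A} := by
  have := (Measure.measurable_coe hA).comp (measurable_map_rayMeasure hm hm')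
  have e : (fun T => rayMeasure m T {x | (T, x) ∈ A})
      = (fun μ : Measure (OrderedTree × Ray) => μ A) ∘ fun T => (rayMeasure m T).map (Prod.mk T) := by
    ext T
    rw [Function.comp_apply, Measure.map_apply measurable_prodMk_left hA]
    rfl
  rwa [e]

theorem ae_ae_of_ae_spineLaw {m : ℝ≥0∞} (hm : m ≠ 0) (hm' : m ≠ ⊤) {μ : Measure OrderedTree}
    {p : OrderedTree × Ray → Prop} (hp : ∀ᵐ z ∂(spineLaw m μ), p z) :
    ∀ᵐ T ∂μ, ∀ᵐ x ∂(rayMeasure m T), p (T, x) := by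
  set N := toMeasurable (spineLaw m μ) {z | ¬ p z}
  have hN : spineLaw m μ N = 0 := by rw [measure_toMeasurable]; exact hp
  have hNm : MeasurableSet N := measurableSet_toMeasurable _ _
  rw [spineLaw_apply hm hm' μ hNm,
    lintegral_eq_zero_iff (measurable_rayMeasure_section hm hm' hNm)] at hN
  filter_upwards [hN] with T hT
  exact measure_mono_null (fun x hx => subset_toMeasurable (spineLaw m μ) {z | ¬ p z} hx) hT

/-- The shift that moves one step up along the ray. -/
def spineShift (z : OrderedTree × Ray) : OrderedTree × Ray :=
  (z.1.shift [z.2.digit 0], z.2.tail)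

theorem measurable_spineShift : Measurable spineShift := by
  refine Measurable.prodMk ?_ (measurable_tail.comp measurable_snd)
  intro A hA
  have : (fun z : OrderedTree × Ray => z.1.shift [z.2.digit 0]) ⁻¹' A
      = ⋃ i : ℕ+, (OrderedTree.shift [i] ⁻¹' A) ×ˢ cylinder [i] := by
    ext z
    simp only [mem_preimage, mem_iUnion, mem_prod, mem_cylinder_singleton]
    exact ⟨fun h => ⟨_, h, rfl⟩, fun ⟨i, h, hi⟩ => hi ▸ h⟩
  rw [this]
  exact MeasurableSet.iUnion fun i => (measurable_shift _ hA).prod (measurableSet_cylinder _)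

theorem cylinder_inter_of_length_le {u v : Word} (h : u.length ≤ v.length)
    (hne : (cylinder u ∩ cylinder v).Nonempty) : cylinder u ∩ cylinder v = cylinder v := by
  obtain ⟨z, hu, hv⟩ := hne
  refine inter_eq_right.2 fun x hx => ?_
  have h1 : x.trunc v.length = z.trunc v.length := Eq.trans hx (Eq.symm hv)
  rw [Ray.trunc_eq_iff] at h1
  exact ((Ray.trunc_eq_iff x z _).2 fun k hk => h1 k (hk.trans_le h)).trans hu

/-- The products of a cylinder by the trees that contain given words, not longer than the word
of the cylinder. -/
def spineRectangles : Set (Set (OrderedTree × Ray)) :=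
  {B | ∃ (S : Finset Word) (u : Word), (∀ v ∈ S, v.length ≤ u.length) ∧
    B = containing S ×ˢ cylinder u}

/-- Two cylinders that meet are nested, so their intersection is the longer one and the bound on the
length of the words survives. -/
theorem isPiSystem_spineRectangles : IsPiSystem spineRectangles := by
  rintro _ ⟨S, u, hS, rfl⟩ _ ⟨S', v, hS', rfl⟩ hne
  rw [prod_inter_prod] at hne ⊢
  rw [containing_union]
  rcases le_total u.length v.length with h | h
  · refine ⟨S ∪ S', v, fun w hw => ?_, ?_⟩
    · exact (Finset.mem_union.1 hw).elim (fun hw => (hS w hw).trans h) (hS' w)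
    · rw [cylinder_inter_of_length_le h hne.snd]
  · refine ⟨S ∪ S', u, fun w hw => ?_, ?_⟩
    · exact (Finset.mem_union.1 hw).elim (hS w) fun hw => (hS' w hw).trans h
    · have := hne.snd
      rw [inter_comm] at this ⊢
      rw [cylinder_inter_of_length_le h this]

theorem generateFrom_spineRectangles :
    (inferInstance : MeasurableSpace (OrderedTree × Ray))
      = MeasurableSpace.generateFrom spineRectangles := by
  apply le_antisymm
  · refine sup_le ?_ ?_
    · rw [← measurable_iff_comap_le]
      refine @measurable_generateFrom _ _ (MeasurableSpace.generateFrom spineRectangles) _ _ ?_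
      rintro _ ⟨v, rfl⟩
      have : (Prod.fst ⁻¹' {T : OrderedTree | v ∈ T.carrier} : Set (OrderedTree × Ray))
          = ⋃ u : {u : Word // v.length ≤ u.length}, containing {v} ×ˢ cylinder u := by
        ext z
        simp only [mem_preimage, mem_ofPred_eq, mem_iUnion, mem_prod, containing,
          Finset.mem_singleton, forall_eq]
        refine ⟨fun h => ⟨⟨z.2.trunc v.length, by simp [Ray.trunc_length]⟩, h, ?_⟩, fun ⟨_, h, _⟩ => h⟩
        simp [cylinder, Ray.trunc_length]
      rw [this]
      exact MeasurableSet.iUnion fun u => MeasurableSpace.measurableSet_generateFrom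
        ⟨{v}, u, by simpa using u.2, rfl⟩
    · rw [← measurable_iff_comap_le]
      refine @measurable_to_ray _ (MeasurableSpace.generateFrom spineRectangles) _ fun u => ?_
      refine MeasurableSpace.measurableSet_generateFrom ⟨∅, u, by simp, ?_⟩
      rw [containing_empty]; ext z; simp
  · refine MeasurableSpace.generateFrom_le ?_
    rintro _ ⟨S, u, -, rfl⟩
    exact (measurableSet_containing S).prod (measurableSet_cylinder u)

/-- The mass carried by the children of the root other than `i`. -/
noncomputable def siblingMass (m : ℝ≥0∞) (i : ℕ+) (T : OrderedTree) : ℝ≥0∞ :=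
  ∑' j : ℕ+, if j = i then 0 else totalMass m (T.shift [j])

theorem measurable_siblingMass_siblingSigma (m : ℝ≥0∞) (i : ℕ+) :
    Measurable[siblingSigma i] (siblingMass m i) := by
  refine @Measurable.tsum _ _ _ (siblingSigma i) _ _ _ _ _ _ _ _ _ _ _ _ fun j => ?_
  by_cases hj : j = i
  · simp only [hj, if_true]
    exact @measurable_const _ _ _ (siblingSigma i) _
  · simp only [hj, if_false]
    exact (measurable_totalMass m).comp (measurable_shift_siblingSigma hj)

theorem measurable_siblingMass (m : ℝ≥0∞) (i : ℕ+) : Measurable (siblingMass m i) :=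
  (measurable_siblingMass_siblingSigma m i).mono (memSigma_le _) le_rfl

theorem totalMass_add_siblingMass {m : ℝ≥0∞} {T : OrderedTree} (h : T ∈ goodTrees m) (i : ℕ+) :
    totalMass m T = (totalMass m (T.shift [i]) + siblingMass m i T) / m := by
  have h1 := h.2 []
  simp only [OrderedTree.shift_nil, List.nil_append] at h1
  rw [h1, siblingMass, ENNReal.tsum_eq_add_tsum_ite i]
  congr!

/-- The mass carried by the siblings of the first vertex of the ray. -/
noncomputable def spineSiblingMass (m : ℝ≥0∞) (z : OrderedTree × Ray) : ℝ≥0∞ :=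
  siblingMass m (z.2.digit 0) z.1

theorem measurableSet_spineSiblingMass_le (m y : ℝ≥0∞) :
    MeasurableSet {z : OrderedTree × Ray | spineSiblingMass m z ≤ y} := by
  have : {z : OrderedTree × Ray | spineSiblingMass m z ≤ y}
      = ⋃ i : ℕ+, {T | siblingMass m i T ≤ y} ×ˢ cylinder [i] := by
    ext z
    simp only [mem_ofPred_eq, mem_iUnion, mem_prod, mem_cylinder_singleton, spineSiblingMass]
    exact ⟨fun h => ⟨_, h, rfl⟩, fun ⟨i, h, hi⟩ => hi ▸ h⟩
  rw [this]
  exact MeasurableSet.iUnion fun i =>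
    (measurableSet_le (measurable_siblingMass m i) measurable_const).prod (measurableSet_cylinder _)

/-- The probability that the siblings of the first vertex of the size-biased ray have mass at
most `y`. -/
noncomputable def siblingProb (m : ℝ≥0∞) (μ : Measure OrderedTree) (y : ℝ≥0∞) : ℝ≥0∞ :=
  m⁻¹ * ∑' i : ℕ+, μ (hasChild i ∩ {T | siblingMass m i T ≤ y})

namespace BranchingLaw

variable {ξ : PMF ℕ} {μ : Measure OrderedTree}

theorem spineLaw_univ (h : BranchingLaw ξ μ) (hm : mean ξ ≠ 0) (hm' : mean ξ ≠ ⊤) :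
    spineLaw (mean ξ) μ univ = ∫⁻ T, totalMass (mean ξ) T ∂μ := by
  rw [spineLaw_apply hm hm' μ .univ]
  refine lintegral_congr_ae ?_
  filter_upwards [h.ae_goodTrees hm hm'] with T hT
  have := rayMeasure_cylinder hm hm' hT []
  rw [cylinder_nil] at this
  simpa using this

theorem lintegral_totalMass_le (h : BranchingLaw ξ μ) (hm : mean ξ ≠ 0) (hm' : mean ξ ≠ ⊤) :
    ∫⁻ T, totalMass (mean ξ) T ∂μ ≤ 1 := by
  calc ∫⁻ T, totalMass (mean ξ) T ∂μ
      = ∫⁻ T, liminf (fun n : ℕ => (T.genSize n : ℝ≥0∞) / mean ξ ^ n) atTop ∂μ := by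
        refine lintegral_congr_ae ?_
        filter_upwards [h.ae_tendsto_totalMass hm hm'] with T hT
        have := hT.2 []
        rw [OrderedTree.shift_nil] at this
        exact this.liminf_eq.symm
    _ ≤ liminf (fun n : ℕ => ∫⁻ T, (T.genSize n : ℝ≥0∞) / mean ξ ^ n ∂μ) atTop :=
        lintegral_liminf_le fun n => (measurable_genSize n).div_const _
    _ = liminf (fun _ : ℕ => (1 : ℝ≥0∞)) atTop := by
        congr 1
        ext n
        simp_rw [div_eq_mul_inv]
        rw [lintegral_mul_const _ (measurable_genSize n), h.lintegral_genSize,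
          ENNReal.mul_inv_cancel (pow_ne_zero _ hm) (ENNReal.pow_ne_top hm')]
    _ = 1 := by simp

theorem isFiniteMeasure_spineLaw (h : BranchingLaw ξ μ) (hm : mean ξ ≠ 0) (hm' : mean ξ ≠ ⊤) :
    IsFiniteMeasure (spineLaw (mean ξ) μ) :=
  ⟨by rw [h.spineLaw_univ hm hm']; exact (h.lintegral_totalMass_le hm hm').trans_lt ENNReal.one_lt_top⟩

/-- The spine decomposition: what is seen at the first step, namely the index `i` and the tree
outside the subtree above it, is independent under `Q` of the pair shifted along the ray, which
again has law `Q`. It combines self-similarity of the branching measure with independence of the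
subtree above `i`. Invariance, ergodicity and independence of the sibling masses all follow. -/
theorem spineLaw_child (h : BranchingLaw ξ μ) (hm : mean ξ ≠ 0) (hm' : mean ξ ≠ ⊤) (i : ℕ+)
    {B : Set OrderedTree} (hB : MeasurableSet[siblingSigma i] B) {A : Set (OrderedTree × Ray)}
    (hA : MeasurableSet A) :
    spineLaw (mean ξ) μ (B ×ˢ cylinder [i] ∩ spineShift ⁻¹' A)
      = (mean ξ)⁻¹ * μ (hasChild i ∩ B) * spineLaw (mean ξ) μ A := by
  have hB' : MeasurableSet B := memSigma_le _ _ hB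
  rw [spineLaw_apply hm hm' μ ((hB'.prod (measurableSet_cylinder _)).inter
    (measurable_spineShift hA)), spineLaw_apply hm hm' μ hA]
  have h1 := h.lintegral_mul_shift i (H := B.indicator fun _ => 1)
    ((@measurable_const _ _ _ (siblingSigma i) (1 : ℝ≥0∞)).indicator hB)
    (measurable_rayMeasure_section hm hm' hA)
  rw [lintegral_indicator hB', Measure.restrict_restrict hB', lintegral_const, one_mul,
    Measure.restrict_apply_univ, inter_comm] at h1
  rw [mul_assoc, ← h1, ← lintegral_const_mul' _ _ (ENNReal.inv_ne_top.2 hm),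
    ← lintegral_indicator (measurableSet_hasChild i)]
  refine lintegral_congr_ae ?_
  filter_upwards [h.ae_goodTrees hm hm'] with T hT
  have h2 : {x | (T, x) ∈ B ×ˢ cylinder [i] ∩ spineShift ⁻¹' A}
      = {x | T ∈ B ∧ x ∈ cylinder [i] ∩ Ray.tail ⁻¹' {x | (T.shift [i], x) ∈ A}} := by
    ext x
    simp only [mem_ofPred_eq, mem_inter_iff, mem_prod, mem_preimage, mem_cylinder_singleton,
      spineShift, and_assoc]
    refine and_congr_right fun _ => and_congr_right fun hi => by rw [hi]
  rw [h2]
  have hD : MeasurableSet {x | (T.shift [i], x) ∈ A} := measurable_prodMk_left hA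
  by_cases hTB : T ∈ B
  · have h3 := rayMeasure_child hm hm' hT i hD
    simp only [hTB, true_and, ofPred_mem_eq] at h3 ⊢
    rw [h3]
    by_cases hc : T ∈ hasChild i
    · simp [hc, hTB]
    · rw [indicator_of_notMem hc, rayMeasure_eq_zero hm hm' fun hh => hc hh]
      simp
  · simp [hTB, indicator]

theorem spineLaw_eq_tsum (A : Set (OrderedTree × Ray)) (hA : MeasurableSet A) (m : ℝ≥0∞) :
    spineLaw m μ A = ∑' i : ℕ+, spineLaw m μ (univ ×ˢ cylinder [i] ∩ A) := by
  rw [← measure_iUnion]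
  · congr 1
    ext z
    simp only [mem_iUnion, mem_inter_iff, mem_prod, mem_univ, true_and, mem_cylinder_singleton]
    exact ⟨fun h => ⟨_, rfl, h⟩, fun ⟨_, _, h⟩ => h⟩
  · intro i j hij
    refine Set.disjoint_left.2 fun z hz hz' => hij ?_
    have h1 := mem_cylinder_singleton.1 hz.1.2
    have h2 := mem_cylinder_singleton.1 hz'.1.2
    exact h1.symm.trans h2
  · exact fun i => (MeasurableSet.univ.prod (measurableSet_cylinder _)).inter hA

/-- Summing the spine decomposition over `i` gives the factor `m⁻¹ ∑ μ (hasChild i)`, which is one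
because the mean number of children is `m`. -/
theorem measurePreserving_spineShift (h : BranchingLaw ξ μ) (hm : mean ξ ≠ 0)
    (hm' : mean ξ ≠ ⊤) :
    MeasurePreserving spineShift (spineLaw (mean ξ) μ) (spineLaw (mean ξ) μ) := by
  refine ⟨measurable_spineShift, ?_⟩
  ext A hA
  rw [Measure.map_apply measurable_spineShift hA,
    spineLaw_eq_tsum _ (measurable_spineShift hA)]
  simp_rw [h.spineLaw_child hm hm' _ (@MeasurableSet.univ _ (siblingSigma _)) hA, inter_univ]
  rw [ENNReal.tsum_mul_right, ENNReal.tsum_mul_left, h.tsum_measure_hasChild,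
    ENNReal.inv_mul_cancel hm hm', one_mul]

theorem spineLaw_siblingMass_inter (h : BranchingLaw ξ μ) (hm : mean ξ ≠ 0) (hm' : mean ξ ≠ ⊤)
    (y : ℝ≥0∞) {A : Set (OrderedTree × Ray)} (hA : MeasurableSet A) :
    spineLaw (mean ξ) μ ({z | spineSiblingMass (mean ξ) z ≤ y} ∩ spineShift ⁻¹' A)
      = siblingProb (mean ξ) μ y * spineLaw (mean ξ) μ A := by
  rw [spineLaw_eq_tsum _ ((measurableSet_spineSiblingMass_le _ y).inter (measurable_spineShift hA)),
    siblingProb, ← ENNReal.tsum_mul_left, ← ENNReal.tsum_mul_right]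
  refine tsum_congr fun i => ?_
  rw [← h.spineLaw_child hm hm' i (B := {T | siblingMass (mean ξ) i T ≤ y})
    (measurable_siblingMass_siblingSigma _ i measurableSet_Iic) hA]
  congr 1
  ext z
  simp only [mem_inter_iff, mem_prod, mem_univ, true_and, mem_cylinder_singleton, mem_ofPred_eq,
    spineSiblingMass]
  constructor
  · rintro ⟨rfl, h1, h2⟩; exact ⟨⟨h1, rfl⟩, h2⟩
  · rintro ⟨⟨h1, rfl⟩, h2⟩; exact ⟨rfl, h1, h2⟩

/-- Independence of the sibling masses along the ray, in the only form that is needed. The total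
mass of `Q` appears because `Q` is not normalized. -/
theorem spineLaw_forall_siblingMass_le (h : BranchingLaw ξ μ) (hm : mean ξ ≠ 0)
    (hm' : mean ξ ≠ ⊤) (N : ℕ) : ∀ y : ℕ → ℝ≥0∞,
    spineLaw (mean ξ) μ {z | ∀ j < N, spineSiblingMass (mean ξ) (spineShift^[j] z) ≤ y j}
      = (∏ j ∈ Finset.range N, siblingProb (mean ξ) μ (y j)) * spineLaw (mean ξ) μ univ := by
  induction N with
  | zero => intro y; simp
  | succ N ih =>
    intro y
    have hset : {z | ∀ j < N + 1, spineSiblingMass (mean ξ) (spineShift^[j] z) ≤ y j}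
        = {z | spineSiblingMass (mean ξ) z ≤ y 0} ∩ spineShift ⁻¹'
          {z | ∀ j < N, spineSiblingMass (mean ξ) (spineShift^[j] z) ≤ y (j + 1)} := by
      ext z
      simp only [mem_ofPred_eq, mem_inter_iff, mem_preimage]
      constructor
      · exact fun hz => ⟨hz 0 (Nat.succ_pos _), fun j hj => hz (j + 1) (by omega)⟩
      · rintro ⟨h0, hz⟩ j hj
        cases j with
        | zero => exact h0
        | succ j => exact hz j (by omega)
    have hmeas : MeasurableSet
        {z | ∀ j < N, spineSiblingMass (mean ξ) (spineShift^[j] z) ≤ y (j + 1)} := by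
      have : {z | ∀ j < N, spineSiblingMass (mean ξ) (spineShift^[j] z) ≤ y (j + 1)}
          = ⋂ j ∈ Finset.range N, spineShift^[j] ⁻¹' {z | spineSiblingMass (mean ξ) z ≤ y (j + 1)} := by
        ext z; simp
      rw [this]
      exact Finset.measurableSet_biInter _ fun j _ =>
        measurable_spineShift.iterate j (measurableSet_spineSiblingMass_le _ _)
    rw [hset, h.spineLaw_siblingMass_inter hm hm' _ hmeas, ih fun j => y (j + 1),
      Finset.prod_range_succ', mul_comm (∏ j ∈ Finset.range N, _) (siblingProb _ _ (y 0)), mul_assoc]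

/-- An invariant set is independent of every spine rectangle: peeling off the first letter reduces
both sides to a shorter cylinder by the same factor. As the rectangles generate, the set is
independent of itself. -/
theorem ergodic_spineShift (h : BranchingLaw ξ μ) (hm : mean ξ ≠ 0) (hm' : mean ξ ≠ ⊤) :
    Ergodic spineShift (spineLaw (mean ξ) μ) := by
  have := h.isFiniteMeasure_spineLaw hm hm'
  set Q := spineLaw (mean ξ) μ with hQ
  refine ⟨h.measurePreserving_spineShift hm hm', ⟨fun A hA hinv => ?_⟩⟩
  have key : ∀ (u : Word) (S : Finset Word), (∀ v ∈ S, v.length ≤ u.length) →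
      Q univ * Q (containing S ×ˢ cylinder u ∩ A) = Q A * Q (containing S ×ˢ cylinder u) := by
    intro u
    induction u with
    | nil =>
      intro S hS
      -- The length bound in the rectangles leaves at most the empty word in `S`, so at the end of
      -- the induction the rectangle is almost everything.
      have hS' : ∀ T : OrderedTree, [] ∈ T.carrier → T ∈ containing S := fun T hT u hu => by
        rw [List.length_eq_zero_iff.1 (Nat.le_zero.1 (hS u hu))]; exact hT
      have e : (containing S ×ˢ cylinder [] : Set (OrderedTree × Ray)) =ᵐ[Q] univ := by
        refine eventuallyEq_univ.2 ?_
        have hms : MeasurableSet (containing S ×ˢ cylinder [] : Set (OrderedTree × Ray)) :=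
          (measurableSet_containing S).prod (measurableSet_cylinder _)
        rw [mem_ae_iff, hQ, spineLaw_apply hm hm' μ hms.compl, lintegral_eq_zero_iff
          (measurable_rayMeasure_section hm hm' hms.compl)]
        filter_upwards [h.ae_nil_mem] with T hT
        simp [cylinder_nil, hS' T hT]
      rw [measure_congr e, measure_congr (e.inter (ae_eq_refl A)), univ_inter, mul_comm]
    | cons i u ih =>
      intro S hS
      have hd : MeasurableSet[siblingSigma i] (containing (dropAt i S)) := by
        unfold siblingSigma
        rw [memSigma_eq]
        exact MeasurableSpace.measurableSet_generateFrom
          ⟨_, fun u hu => (Finset.mem_filter.1 hu).2, rfl⟩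
      have ht : ∀ v ∈ tailsAt i S, v.length ≤ u.length := fun v hv => by
        simpa using hS _ (mem_tailsAt.1 hv)
      have hbox : MeasurableSet (containing (tailsAt i S) ×ˢ cylinder u : Set (OrderedTree × Ray)) :=
        (measurableSet_containing _).prod (measurableSet_cylinder u)
      have hQz : ∀ D : Set (OrderedTree × Ray), MeasurableSet D →
          Q (containing S ×ˢ cylinder (i :: u) ∩ spineShift ⁻¹' D)
          = (mean ξ)⁻¹ * μ (hasChild i ∩ containing (dropAt i S)) *
            Q (containing (tailsAt i S) ×ˢ cylinder u ∩ D) := by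
        intro D hD
        rw [← h.spineLaw_child hm hm' i hd (hbox.inter hD)]
        -- The splitting of the constraints is valid only when `i` is a child; rays outside the tree
        -- carry no mass, so this can be assumed.
        have hnull : Q ((hasChild i)ᶜ ×ˢ cylinder [i]) = 0 := by
          have hms := (measurableSet_hasChild i).compl.prod (measurableSet_cylinder [i])
          rw [hQ, spineLaw_apply hm hm' μ hms,
            lintegral_eq_zero_iff (measurable_rayMeasure_section hm hm' hms)]
          refine ae_of_all _ fun T => ?_
          by_cases hc : T ∈ hasChild i
          · simp [hc]
          · refine measure_mono_null (fun x hx => hx.2) (rayMeasure_cylinder_eq_zero hm hm' hc)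
        refine measure_congr ?_
        filter_upwards [measure_eq_zero_iff_ae_notMem.1 hnull] with z hz
        apply propext
        change z ∈ containing S ×ˢ cylinder (i :: u) ∩ spineShift ⁻¹' D ↔
          z ∈ containing (dropAt i S) ×ˢ cylinder [i] ∩
            spineShift ⁻¹' (containing (tailsAt i S) ×ˢ cylinder u ∩ D)
        simp only [mem_inter_iff, mem_prod, mem_preimage, mem_cylinder_cons, cylinder_nil, mem_univ,
          and_true]
        by_cases hi : z.2.digit 0 = i
        · have hc : z.1 ∈ hasChild i := by
            by_contra hc
            exact hz ⟨hc, mem_cylinder_singleton.2 hi⟩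
          have h2 := Set.ext_iff.1 (containing_inter_child i S) z.1
          simp only [mem_inter_iff, mem_preimage] at h2
          have hc' : z.1 ∈ {T : OrderedTree | [i] ∈ T.carrier} := hc
          simp only [hc', true_and] at h2
          rw [h2]
          simp only [spineShift, hi]
          tauto
        · simp [hi]
      have h1 := hQz A hA
      have h2 := hQz univ .univ
      rw [hinv] at h1
      rw [preimage_univ, inter_univ, inter_univ] at h2
      rw [h1, h2, mul_left_comm, ih _ ht]
      ring
  have hAA : Q univ * Q (A ∩ A) = Q A * Q A := by
    have : IsFiniteMeasure (Q univ • Q.restrict A) := Measure.smul_finite _ (measure_ne_top _ _)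
    have e : Q univ • Q.restrict A = Q A • Q := by
      refine ext_of_generate_finite spineRectangles generateFrom_spineRectangles
        isPiSystem_spineRectangles ?_ ?_
      · rintro _ ⟨S, u, hS, rfl⟩
        rw [Measure.smul_apply, Measure.smul_apply, Measure.restrict_apply
          ((measurableSet_containing S).prod (measurableSet_cylinder u))]
        exact key u S hS
      · simp [mul_comm]
    have := congrArg (fun ν => ν A) e
    simpa [Measure.restrict_apply hA] using this
  rw [inter_self] at hAA
  rw [eventuallyConst_set']
  by_cases h0 : Q A = 0
  · exact Or.inl (measure_eq_zero_iff_ae_notMem.1 h0 |>.mono fun z hz => by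
      apply propext; exact iff_false_intro hz)
  · right
    have : Q A = Q univ := ((ENNReal.mul_left_inj h0 (measure_ne_top _ _)).1 hAA).symm
    exact ae_eq_univ.2 (by rw [measure_compl hA (measure_ne_top _ _), this, tsub_self])

end BranchingLaw

/-! ### The inverse of the tail exponent -/

section Tail

variable {Ω : Type*} [MeasurableSpace Ω] {P : Measure Ω} {W : Ω → ℝ≥0∞}

theorem coe_lt_tailExponent_iff (x y : ℝ) :
    (x : EReal) < tailExponent P W y ↔
      P {ω | ENNReal.ofReal y < W ω} < ENNReal.ofReal (Real.exp (-x)) := by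
  rw [tailExponent, EReal.lt_neg_comm, ← EReal.coe_neg, ← EReal.exp_coe, ← ENNReal.log_lt_log_iff,
    EReal.log_exp]

theorem tail_anti {y z : ℝ} (h : y ≤ z) :
    P {ω | ENNReal.ofReal z < W ω} ≤ P {ω | ENNReal.ofReal y < W ω} :=
  measure_mono fun _ hω => (ENNReal.ofReal_le_ofReal h).trans_lt hω

theorem bddBelow_tail (x : ℝ) : BddBelow {y : ℝ | 0 ≤ y ∧ (x : EReal) < tailExponent P W y} :=
  ⟨0, fun _ h => h.1⟩

theorem rightInverse_nonneg (x : ℝ) : 0 ≤ rightInverse (tailExponent P W) x :=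
  Real.sInf_nonneg fun _ h => h.1

theorem nonempty_tail [IsFiniteMeasure P] (hW : Measurable W) (hfin : ∀ᵐ ω ∂P, W ω ≠ ⊤) (x : ℝ) :
    {y : ℝ | 0 ≤ y ∧ (x : EReal) < tailExponent P W y}.Nonempty := by
  have hlim : Tendsto (fun n : ℕ => P {ω | ENNReal.ofReal n < W ω}) atTop (𝓝 0) := by
    have h0 : P (⋂ n : ℕ, {ω | ENNReal.ofReal n < W ω}) = 0 := by
      refine measure_mono_null (fun ω hω => ?_) hfin
      simp only [mem_compl_iff, mem_ofPred_eq, not_not]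
      refine ENNReal.eq_top_of_forall_nnreal_le fun r => ?_
      obtain ⟨n, hn⟩ := exists_nat_ge r
      have h1 := mem_iInter.1 hω n
      simp only [mem_ofPred_eq, ENNReal.ofReal_natCast] at h1
      exact le_trans (by exact_mod_cast hn) h1.le
    rw [← h0]
    refine tendsto_measure_iInter_atTop
      (fun n => (measurableSet_lt measurable_const hW).nullMeasurableSet) ?_
      ⟨0, measure_ne_top _ _⟩
    intro m n hmn ω hω
    have hmn' : (m : ℝ) ≤ n := by exact_mod_cast hmn
    exact (ENNReal.ofReal_le_ofReal hmn').trans_lt hω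
  have hpos : (0 : ℝ≥0∞) < ENNReal.ofReal (Real.exp (-x)) := by positivity
  obtain ⟨n, hn⟩ := ((tendsto_order.1 hlim).2 _ hpos).exists
  exact ⟨n, Nat.cast_nonneg n, (coe_lt_tailExponent_iff x n).2 hn⟩

theorem le_tail_of_lt_rightInverse {x z : ℝ} (hz : 0 ≤ z)
    (h : z < rightInverse (tailExponent P W) x) :
    ENNReal.ofReal (Real.exp (-x)) ≤ P {ω | ENNReal.ofReal z < W ω} := by
  have := notMem_of_lt_csInf h (bddBelow_tail x)
  simp only [mem_ofPred_eq, not_and, coe_lt_tailExponent_iff, not_lt] at this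
  exact this hz

theorem tail_lt_of_rightInverse_lt [IsFiniteMeasure P] (hW : Measurable W)
    (hfin : ∀ᵐ ω ∂P, W ω ≠ ⊤) {x z : ℝ} (h : rightInverse (tailExponent P W) x < z) :
    P {ω | ENNReal.ofReal z < W ω} < ENNReal.ofReal (Real.exp (-x)) := by
  obtain ⟨y, ⟨-, hy⟩, hyz⟩ := exists_lt_of_csInf_lt (nonempty_tail hW hfin x) h
  exact (tail_anti hyz.le).trans_lt ((coe_lt_tailExponent_iff x y).1 hy)

/-- The bound holds at every point beyond the infimum, and extends to the infimum itself because `y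
↦ P(W > y)` is right-continuous. -/
theorem tail_rightInverse_le [IsFiniteMeasure P] (hW : Measurable W)
    (hfin : ∀ᵐ ω ∂P, W ω ≠ ⊤) (x : ℝ) :
    P {ω | ENNReal.ofReal (rightInverse (tailExponent P W) x) < W ω}
      ≤ ENNReal.ofReal (Real.exp (-x)) := by
  set G := rightInverse (tailExponent P W) x
  have hunion : {ω | ENNReal.ofReal G < W ω}
      = ⋃ n : ℕ, {ω | ENNReal.ofReal (G + 1 / ((n : ℝ) + 1)) < W ω} := by
    ext ω
    simp only [mem_ofPred_eq, mem_iUnion]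
    constructor
    · intro h
      have hlim : Tendsto (fun n : ℕ => ENNReal.ofReal (G + 1 / ((n : ℝ) + 1))) atTop
          (𝓝 (ENNReal.ofReal G)) := by
        refine ENNReal.tendsto_ofReal ?_
        simpa using (tendsto_const_nhds (x := G)).add (tendsto_one_div_add_atTop_nhds_zero_nat (𝕜 := ℝ))
      exact ((tendsto_order.1 hlim).2 _ h).exists
    · rintro ⟨n, hn⟩
      refine (ENNReal.ofReal_le_ofReal ?_).trans_lt hn
      have : (0 : ℝ) ≤ 1 / ((n : ℝ) + 1) := by positivity
      linarith
  have hmono : Monotone fun n : ℕ => {ω | ENNReal.ofReal (G + 1 / ((n : ℝ) + 1)) < W ω} := by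
    intro m n hmn ω hω
    refine (ENNReal.ofReal_le_ofReal ?_).trans_lt hω
    have := Nat.one_div_le_one_div (α := ℝ) hmn
    linarith
  rw [hunion, hmono.measure_iUnion]
  refine iSup_le fun n => (tail_lt_of_rightInverse_lt hW hfin ?_).le
  have : (0 : ℝ) < 1 / ((n : ℝ) + 1) := by positivity
  show G < _
  linarith

theorem rightInverse_mono [IsFiniteMeasure P] (hW : Measurable W) (hfin : ∀ᵐ ω ∂P, W ω ≠ ⊤) :
    Monotone (rightInverse (tailExponent P W)) := by
  intro x y hxy
  refine csInf_le_csInf (bddBelow_tail x) (nonempty_tail hW hfin y) fun z hz => ⟨hz.1, ?_⟩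
  exact (EReal.coe_le_coe_iff.2 hxy).trans_lt hz.2

theorem rightInverse_eq_zero (h : ∀ᵐ ω ∂P, W ω = 0) (x : ℝ) :
    rightInverse (tailExponent P W) x = 0 := by
  refine le_antisymm (csInf_le (bddBelow_tail x) ⟨le_rfl, ?_⟩) (rightInverse_nonneg x)
  rw [coe_lt_tailExponent_iff]
  have : P {ω | ENNReal.ofReal 0 < W ω} = 0 := by
    refine measure_mono_null (fun ω hω => ?_) h
    simp only [ENNReal.ofReal_zero, mem_ofPred_eq] at hω
    exact hω.ne'
  rw [this]
  positivity

theorem exists_doubling_const {G : ℝ → ℝ} (h : doublingSup G < ⊤) :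
    ∃ C : ℝ, 1 ≤ C ∧ ∀ x, 1 ≤ x → 0 ≤ G x → G (2 * x) ≤ C * G x := by
  refine ⟨max 1 (doublingSup G).toReal, le_max_left _ _, fun x hx hG => ?_⟩
  have h1 : ENNReal.ofReal (G (2 * x)) / ENNReal.ofReal (G x) ≤ doublingSup G :=
    le_iSup (fun x : Ici (1 : ℝ) => ENNReal.ofReal (G (2 * x)) / ENNReal.ofReal (G x)) ⟨x, hx⟩
  have h2 : ENNReal.ofReal (G (2 * x)) ≤ doublingSup G * ENNReal.ofReal (G x) := by
    refine (ENNReal.div_le_iff_le_mul (Or.inr h.ne) (Or.inl ENNReal.ofReal_ne_top)).1 h1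
  rw [← ENNReal.ofReal_toReal h.ne, ← ENNReal.ofReal_mul ENNReal.toReal_nonneg,
    ENNReal.ofReal_le_ofReal_iff (mul_nonneg ENNReal.toReal_nonneg hG)] at h2
  exact h2.trans (mul_le_mul_of_nonneg_right (le_max_right _ _) hG)

theorem doubling_iterate {G : ℝ → ℝ} {C : ℝ} (hC : ∀ x, 1 ≤ x → G (2 * x) ≤ C * G x) (hC1 : 1 ≤ C) (k : ℕ) {x : ℝ} (hx : 1 ≤ x) :
    G (2 ^ k * x) ≤ C ^ k * G x := by
  induction k with
  | zero => simp
  | succ k ih =>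
    have h2 : (1 : ℝ) ≤ 2 ^ k := one_le_pow₀ (by norm_num)
    calc G (2 ^ (k + 1) * x) = G (2 * (2 ^ k * x)) := by ring_nf
      _ ≤ C * G (2 ^ k * x) := hC _ (by nlinarith)
      _ ≤ C * (C ^ k * G x) := by gcongr
      _ = C ^ (k + 1) * G x := by ring

/-- If `G` vanished at `1`, doubling would make it vanish at all `2^k`, giving `P(W > 0) ≤
exp(-2^k)` for every `k`, hence `W = 0` almost surely. -/
theorem rightInverse_pos [IsFiniteMeasure P] (hW : Measurable W) (hfin : ∀ᵐ ω ∂P, W ω ≠ ⊤)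
    (h0 : ¬ ∀ᵐ ω ∂P, W ω = 0) (hd : doublingSup (rightInverse (tailExponent P W)) < ⊤) {x : ℝ}
    (hx : 1 ≤ x) : 0 < rightInverse (tailExponent P W) x := by
  set G := rightInverse (tailExponent P W) with hGdef
  obtain ⟨C, hC1, hC⟩ := exists_doubling_const hd
  have hG : ∀ x, 0 ≤ G x := rightInverse_nonneg
  refine lt_of_lt_of_le ?_ (rightInverse_mono hW hfin hx)
  rcases (hG 1).lt_or_eq with h | h
  · exact h
  refine absurd ?_ h0
  have hz : ∀ k : ℕ, G (2 ^ k) = 0 := fun k => by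
    have := doubling_iterate (fun x hx => hC x hx (hG x)) hC1 k le_rfl
    rw [← h, mul_zero, mul_one] at this
    exact le_antisymm this (hG _)
  have htail : ∀ k : ℕ, P {ω | ENNReal.ofReal 0 < W ω} ≤ ENNReal.ofReal (Real.exp (-(2 ^ k))) :=
    fun k => by
      have := tail_rightInverse_le hW hfin (2 ^ k)
      rwa [← hGdef, hz k] at this
  have hlim : Tendsto (fun k : ℕ => ENNReal.ofReal (Real.exp (-(2 ^ k)))) atTop (𝓝 0) := by
    rw [← ENNReal.ofReal_zero]
    refine ENNReal.tendsto_ofReal (Real.tendsto_exp_atBot.comp ?_)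
    exact tendsto_neg_atTop_atBot.comp (tendsto_pow_atTop_atTop_of_one_lt (by norm_num))
  have : P {ω | ENNReal.ofReal 0 < W ω} = 0 :=
    le_antisymm (ge_of_tendsto' hlim htail) zero_le
  filter_upwards [measure_eq_zero_iff_ae_notMem.1 this] with ω hω
  simpa using hω

theorem summable_pow_mul_exp_neg_two_pow (D : ℝ) (hD : 0 ≤ D) :
    Summable fun j : ℕ => D ^ j * Real.exp (-(2 ^ j)) := by
  -- With `2D < 2^q`, the power `(2D)^j` is at most `(2^j)^q`, which `exp(2^j)` dominates up to the
  -- factor `q!`; the spare `2^j` leaves a geometric series.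
  obtain ⟨q, hq⟩ := pow_unbounded_of_one_lt (2 * D) (by norm_num : (1 : ℝ) < 2)
  have hbound : ∀ j : ℕ, D ^ j * Real.exp (-(2 ^ j)) ≤ q.factorial * (1 / 2) ^ j := by
    intro j
    have h1 := Real.pow_div_factorial_le_exp ((2 : ℝ) ^ j) (by positivity) q
    have h2 : (0 : ℝ) < q.factorial := by exact_mod_cast q.factorial_pos
    rw [div_le_iff₀ h2] at h1
    have h3 : (2 * D) ^ j ≤ (2 ^ j) ^ q := by
      rw [← pow_mul, mul_comm j q, pow_mul]; exact pow_le_pow_left₀ (by positivity) hq.le j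
    rw [Real.exp_neg, ← div_eq_mul_inv, div_le_iff₀ (Real.exp_pos _)]
    have h4 : (1 / 2 : ℝ) ^ j * (2 * D) ^ j = D ^ j := by rw [← mul_pow]; congr 1; ring
    calc D ^ j = (1 / 2 : ℝ) ^ j * (2 * D) ^ j := h4.symm
      _ ≤ (1 / 2 : ℝ) ^ j * (Real.exp (2 ^ j) * q.factorial) := by gcongr; exact h3.trans h1
      _ = q.factorial * (1 / 2) ^ j * Real.exp (2 ^ j) := by ring
  exact Summable.of_nonneg_of_le (fun j => by positivity) hbound
    ((summable_geometric_of_lt_one (by norm_num) (by norm_num)).mul_left _)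

/-- Doubling implies that all moments are finite. Between `G(2^j)` and `G(2^(j+1))` the variable is
at most a constant times `C^j`, and it exceeds `G(2^j)` with probability at most `exp(-2^j)`. -/
theorem lintegral_pow_lt_top [IsProbabilityMeasure P] (hW : Measurable W)
    (hfin : ∀ᵐ ω ∂P, W ω ≠ ⊤) (hd : doublingSup (rightInverse (tailExponent P W)) < ⊤) (p : ℕ) :
    ∫⁻ ω, W ω ^ p ∂P < ⊤ := by
  set G := rightInverse (tailExponent P W) with hGdef
  obtain ⟨C, hC1, hC⟩ := exists_doubling_const hd
  have hG : ∀ x, 0 ≤ G x := rightInverse_nonneg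
  have hdbl := fun k => doubling_iterate (fun x hx => hC x hx (hG x)) hC1 k (x := 1) le_rfl
  have htail : ∀ j : ℕ, P {ω | ENNReal.ofReal (G (2 ^ j)) < W ω}
      ≤ ENNReal.ofReal (Real.exp (-(2 ^ j))) := fun j => tail_rightInverse_le hW hfin (2 ^ j)
  have hlim : Tendsto (fun k : ℕ => ENNReal.ofReal (Real.exp (-(2 ^ k)))) atTop (𝓝 0) := by
    rw [← ENNReal.ofReal_zero]
    refine ENNReal.tendsto_ofReal (Real.tendsto_exp_atBot.comp ?_)
    exact tendsto_neg_atTop_atBot.comp (tendsto_pow_atTop_atTop_of_one_lt (by norm_num))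
  have hex : ∀ᵐ ω ∂P, ∃ j : ℕ, W ω ≤ ENNReal.ofReal (G (2 ^ j)) := by
    have h0 : P {ω | ∀ j : ℕ, ENNReal.ofReal (G (2 ^ j)) < W ω} = 0 :=
      le_antisymm (ge_of_tendsto' hlim fun j => (measure_mono
        fun ω (hω : ∀ j : ℕ, ENNReal.ofReal (G (2 ^ j)) < W ω) => hω j).trans (htail j))
        zero_le
    filter_upwards [measure_eq_zero_iff_ae_notMem.1 h0] with ω hω
    simpa using hω
  have hpt : ∀ᵐ ω ∂P, W ω ^ p ≤ ENNReal.ofReal (G 1) ^ p + ∑' j : ℕ,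
      {ω | ENNReal.ofReal (G (2 ^ j)) < W ω}.indicator
        (fun _ => ENNReal.ofReal (G (2 ^ (j + 1))) ^ p) ω := by
    filter_upwards [hex] with ω hω
    classical
    have hspec := Nat.find_spec hω
    have hmin := fun j => Nat.find_min hω (m := j)
    set j := Nat.find hω
    rcases hj : j with _ | i
    · rw [hj, pow_zero] at hspec
      exact (pow_le_pow_left₀ zero_le hspec p).trans le_self_add
    · have hi : ω ∈ {ω | ENNReal.ofReal (G (2 ^ i)) < W ω} := not_le.1 (hmin i (by omega))
      rw [hj] at hspec
      refine le_trans ?_ le_add_self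
      refine le_trans ?_ (ENNReal.le_tsum i)
      rw [indicator_of_mem hi]
      exact pow_le_pow_left₀ zero_le hspec p
  have hmeas : ∀ j : ℕ, MeasurableSet {ω | ENNReal.ofReal (G (2 ^ j)) < W ω} := fun j =>
    measurableSet_lt measurable_const hW
  refine (lintegral_mono_ae hpt).trans_lt ?_
  rw [lintegral_add_left measurable_const, lintegral_const, measure_univ, mul_one,
    lintegral_tsum fun j => (measurable_const.indicator (hmeas j)).aemeasurable]
  refine ENNReal.add_lt_top.2 ⟨ENNReal.pow_lt_top ENNReal.ofReal_lt_top, ?_⟩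
  have hterm : ∀ j : ℕ, ∫⁻ ω, {ω | ENNReal.ofReal (G (2 ^ j)) < W ω}.indicator
      (fun _ => ENNReal.ofReal (G (2 ^ (j + 1))) ^ p) ω ∂P
      ≤ ENNReal.ofReal ((C * G 1) ^ p * ((C ^ p) ^ j * Real.exp (-(2 ^ j)))) := by
    intro j
    rw [lintegral_indicator (hmeas j), lintegral_const, Measure.restrict_apply_univ]
    refine (mul_le_mul' le_rfl (htail j)).trans ?_
    rw [← ENNReal.ofReal_pow (hG _), ← ENNReal.ofReal_mul (pow_nonneg (hG _) p)]
    refine ENNReal.ofReal_le_ofReal ?_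
    have h1 := hdbl (j + 1)
    rw [mul_one] at h1
    have h2 : G (2 ^ (j + 1)) ^ p ≤ (C ^ (j + 1) * G 1) ^ p := pow_le_pow_left₀ (hG _) h1 p
    calc G (2 ^ (j + 1)) ^ p * Real.exp (-(2 ^ j))
        ≤ (C ^ (j + 1) * G 1) ^ p * Real.exp (-(2 ^ j)) := by gcongr
      _ = _ := by ring
  refine (ENNReal.tsum_le_tsum hterm).trans_lt ?_
  have hsum := (summable_pow_mul_exp_neg_two_pow (C ^ p) (by positivity)).mul_left ((C * G 1) ^ p)
  exact lt_top_iff_ne_top.2 hsum.tsum_ofReal_ne_top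

/-- The size-biased tail of `W` beyond a multiple of the gauge. -/
theorem exists_setLIntegral_le [IsProbabilityMeasure P] (hW : Measurable W)
    (hfin : ∀ᵐ ω ∂P, W ω ≠ ⊤) (hd : doublingSup (rightInverse (tailExponent P W)) < ⊤) :
    ∃ a K : ℝ≥0, ∀ x : ℝ, 1 ≤ x →
      ∫⁻ ω in {ω | a * ENNReal.ofReal (rightInverse (tailExponent P W) x) < W ω}, W ω ∂P
        ≤ K * ENNReal.ofReal (Real.exp (-(2 * x))) := by
  set G := rightInverse (tailExponent P W) with hGdef
  obtain ⟨C, hC1, hC⟩ := exists_doubling_const hd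
  have hG : ∀ x, 0 ≤ G x := rightInverse_nonneg
  have hK := lintegral_pow_lt_top hW hfin hd 2
  -- Two doublings: beyond `C² G(x)` the variable is beyond `G(4x)`, which has probability at most
  -- `e^{-4x}`. The excess over the required rate `e^{-2x}` pays for the size bias.
  refine ⟨(C ^ 2).toNNReal, (∫⁻ ω, W ω ^ 2 ∂P).toNNReal + 1, fun x hx => ?_⟩
  set A := {ω | ((C ^ 2).toNNReal : ℝ≥0∞) * ENNReal.ofReal (G x) < W ω}
  have hA : MeasurableSet A := measurableSet_lt measurable_const hW
  have hAP : P A ≤ ENNReal.ofReal (Real.exp (-(4 * x))) := by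
    refine le_trans (measure_mono fun ω hω => ?_) (tail_rightInverse_le hW hfin (4 * x))
    refine lt_of_le_of_lt ?_ (mem_ofPred.1 hω)
    have h1 := doubling_iterate (fun x hx => hC x hx (hG x)) hC1 2 hx
    have h2 : ((C ^ 2).toNNReal : ℝ≥0∞) * ENNReal.ofReal (G x) = ENNReal.ofReal (C ^ 2 * G x) := by
      rw [ENNReal.ofReal_mul (by positivity)]; rfl
    rw [h2]
    refine ENNReal.ofReal_le_ofReal ?_
    norm_num at h1
    exact h1
  set ε : ℝ≥0∞ := ENNReal.ofReal (Real.exp (-(2 * x))) with hε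
  have hε0 : ε ≠ 0 := by rw [hε]; positivity
  have hεt : ε ≠ ⊤ := ENNReal.ofReal_ne_top
  -- Takes the place of Hölder's inequality: with `ε = e^{-2x}`, the first term contributes `ε
  -- E[W²]` and the second `ε⁻¹ e^{-4x} = ε`.
  have hpt : ∀ ω, W ω ≤ ε * W ω ^ 2 + ε⁻¹ := by
    intro ω
    rcases le_total (W ω) ε⁻¹ with h | h
    · exact h.trans le_add_self
    · refine le_trans ?_ le_self_add
      rw [pow_two, ← mul_assoc]
      refine le_mul_of_one_le_left zero_le ?_
      rwa [ENNReal.inv_le_iff_le_mul (fun _ => hε0) (fun hh => absurd hh hεt)] at h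
  calc ∫⁻ ω in A, W ω ∂P ≤ ∫⁻ ω in A, (ε * W ω ^ 2 + ε⁻¹) ∂P := lintegral_mono fun ω => hpt ω
    _ = ∫⁻ ω in A, ε * W ω ^ 2 ∂P + ε⁻¹ * P A := by
        rw [lintegral_add_right _ measurable_const, lintegral_const, Measure.restrict_apply_univ]
    _ ≤ ε * ∫⁻ ω, W ω ^ 2 ∂P + ε⁻¹ * ENNReal.ofReal (Real.exp (-(4 * x))) := by
        refine add_le_add ?_ (mul_le_mul' le_rfl hAP)
        rw [← lintegral_const_mul _ (hW.pow_const 2)]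
        exact setLIntegral_le_lintegral _ _
    _ = ε * ∫⁻ ω, W ω ^ 2 ∂P + ε := by
        congr 1
        have : Real.exp (-(4 * x)) = Real.exp (-(2 * x)) * Real.exp (-(2 * x)) := by
          rw [← Real.exp_add]; congr 1; ring
        rw [this, ENNReal.ofReal_mul (Real.exp_pos _).le, ← hε, ← mul_assoc,
          ENNReal.inv_mul_cancel hε0 hεt, one_mul]
    _ = _ := by
        rw [ENNReal.coe_add, ENNReal.coe_toNNReal hK.ne, ENNReal.coe_one]
        ring

/-- The inverse of the tail exponent at `log n` grows slower than any power of `n`. -/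
theorem tendsto_rpow_mul_rightInverse_log [IsProbabilityMeasure P] (hW : Measurable W)
    (hfin : ∀ᵐ ω ∂P, W ω ≠ ⊤) (hd : doublingSup (rightInverse (tailExponent P W)) < ⊤) {c : ℝ}
    (hc : 0 < c) :
    Tendsto (fun n : ℕ => (n : ℝ) ^ (-c) * rightInverse (tailExponent P W) (Real.log n)) atTop
      (𝓝 0) := by
  set G := rightInverse (tailExponent P W) with hGdef
  have hG : ∀ x, 0 ≤ G x := rightInverse_nonneg
  -- Markov's inequality for the `p`-th moment gives growth at most `n^{1/p}` up to a constant, and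
  -- `1/p < c/2` leaves a spare power of `n`.
  obtain ⟨p, hp⟩ := exists_nat_gt (2 / c)
  have hp0 : (0 : ℝ) < p := lt_trans (by positivity) hp
  have hpN : p ≠ 0 := by rintro rfl; simp at hp0
  have hK := lintegral_pow_lt_top hW hfin hd p
  set K := (∫⁻ ω, W ω ^ p ∂P).toReal with hKdef
  have hbound : ∀ n : ℕ, 1 ≤ n → G (Real.log n) ≤ (K * n) ^ (1 / (p : ℝ)) := by
    intro n hn
    have hn0 : (0 : ℝ) < n := by exact_mod_cast hn
    refine le_of_forall_lt_imp_le_of_dense fun z hz => ?_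
    rcases lt_or_ge z 0 with hz0 | hz0
    · exact hz0.le.trans (Real.rpow_nonneg (by positivity) _)
    have h1 := le_tail_of_lt_rightInverse hz0 hz
    rw [Real.exp_neg, Real.exp_log hn0] at h1
    have h2 : ENNReal.ofReal z ^ p * P {ω | ENNReal.ofReal z < W ω} ≤ ∫⁻ ω, W ω ^ p ∂P := by
      refine le_trans ?_ (mul_meas_ge_le_lintegral (hW.pow_const p) (ENNReal.ofReal z ^ p))
      refine mul_le_mul' le_rfl (measure_mono fun ω hω => ?_)
      exact pow_le_pow_left₀ zero_le (le_of_lt (mem_ofPred.1 hω)) p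
    have h3 := (mul_le_mul' (le_refl (ENNReal.ofReal z ^ p)) h1).trans h2
    rw [← ENNReal.ofReal_pow hz0, ← ENNReal.ofReal_mul (by positivity),
      ENNReal.ofReal_le_iff_le_toReal hK.ne, ← hKdef, ← div_eq_mul_inv, div_le_iff₀ hn0] at h3
    calc z = (z ^ p) ^ (1 / (p : ℝ)) := by
          rw [← Real.rpow_natCast, ← Real.rpow_mul hz0, mul_one_div_cancel hp0.ne', Real.rpow_one]
      _ ≤ _ := Real.rpow_le_rpow (by positivity) h3 (by positivity)
  have hlim : Tendsto (fun n : ℕ => K ^ (1 / (p : ℝ)) * (n : ℝ) ^ (-(c / 2))) atTop (𝓝 0) := by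
    have := ((tendsto_rpow_neg_atTop (half_pos hc)).comp tendsto_natCast_atTop_atTop).const_mul
      (K ^ (1 / (p : ℝ)))
    simpa using this
  refine squeeze_zero' (Eventually.of_forall fun n =>
    mul_nonneg (Real.rpow_nonneg (Nat.cast_nonneg n) _) (hG _)) ?_ hlim
  filter_upwards [eventually_ge_atTop 1] with n hn
  have hn1 : (1 : ℝ) ≤ n := by exact_mod_cast hn
  have hn0 : (0 : ℝ) < n := by linarith
  have hK0 : 0 ≤ K := ENNReal.toReal_nonneg
  calc (n : ℝ) ^ (-c) * G (Real.log n) ≤ (n : ℝ) ^ (-c) * (K * n) ^ (1 / (p : ℝ)) := by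
        gcongr; exact hbound n hn
    _ = K ^ (1 / (p : ℝ)) * (n : ℝ) ^ (-c + 1 / p) := by
        rw [Real.mul_rpow hK0 hn0.le, Real.rpow_add hn0]; ring
    _ ≤ K ^ (1 / (p : ℝ)) * (n : ℝ) ^ (-(c / 2)) := by
        refine mul_le_mul_of_nonneg_left (Real.rpow_le_rpow_of_exponent_le hn1 ?_) (by positivity)
        · have : 1 / (p : ℝ) < c / 2 := by
            rw [div_lt_iff₀ hc] at hp
            rw [div_lt_div_iff₀ hp0 (by norm_num)]
            linarith
          linarith

end Tail

/-! ### Zero-one law and bounds for the upper density along the size-biased ray -/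

/-- The gauge exponent `F⁻¹` of the total mass under the law `μ`. -/
noncomputable def massInverse (m : ℝ≥0∞) (μ : Measure OrderedTree) : ℝ → ℝ :=
  rightInverse (tailExponent μ (totalMass m))

/-- The ratio of the mass above the `n`-th vertex of a ray to `F⁻¹ (log n)`. -/
noncomputable def spineRatio (m : ℝ≥0∞) (μ : Measure OrderedTree) (n : ℕ)
    (z : OrderedTree × Ray) : ℝ≥0∞ :=
  totalMass m (spineShift^[n] z).1 / ENNReal.ofReal (massInverse m μ (Real.log n))

theorem fst_spineShift_iterate (n : ℕ) (z : OrderedTree × Ray) :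
    (spineShift^[n] z).1 = z.1.shift (z.2.trunc n) := by
  induction n generalizing z with
  | zero => simp [Ray.trunc]
  | succ n ih =>
    rw [Function.iterate_succ_apply, ih, Ray.trunc_succ']
    simp [spineShift, OrderedTree.shift_shift]

theorem measurable_spineRatio (m : ℝ≥0∞) (μ : Measure OrderedTree) (n : ℕ) :
    Measurable (spineRatio m μ n) :=
  ((measurable_totalMass m).comp (measurable_fst.comp (measurable_spineShift.iterate n))).div_const _

/-- Turns the factors `1 - c/n` of the independence bound into a product that telescopes. The
quantity `e^{-c/n}` lies between the two sides. -/
theorem one_sub_div_le_rpow {c : ℝ} (hc : 0 ≤ c) {n : ℕ} (hn : 0 < n) :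
    1 - c / n ≤ ((n : ℝ) / (n + 1)) ^ c := by
  have hn0 : (0 : ℝ) < n := by exact_mod_cast hn
  have h1 : 1 - c / n ≤ Real.exp (-(c / n)) := by
    have := Real.add_one_le_exp (-(c / n)); linarith
  have h2 : Real.exp (-(1 / (n : ℝ))) ≤ (n : ℝ) / (n + 1) := by
    have h3 := Real.add_one_le_exp (1 / (n : ℝ))
    rw [Real.exp_neg, inv_le_comm₀ (Real.exp_pos _) (by positivity), inv_div]
    refine le_trans (le_of_eq ?_) h3
    field_simp
    ring
  refine h1.trans ?_
  have h4 : Real.exp (-(c / n)) = Real.exp (-(1 / (n : ℝ))) ^ c := by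
    rw [← Real.exp_mul]; congr 1; ring
  rw [h4]
  exact Real.rpow_le_rpow (Real.exp_pos _).le h2 hc

/-- The levels for the mass of the siblings, infinite before `k`. -/
noncomputable def siblingLevel (m : ℝ≥0∞) (μ : Measure OrderedTree) (k j : ℕ) : ℝ≥0∞ :=
  if j < k then ⊤ else m * (ENNReal.ofReal (massInverse m μ (Real.log j) / 2) / 2)

namespace BranchingLaw

variable {ξ : PMF ℕ} {μ : Measure OrderedTree}

theorem pmf_one_lt_one (h1 : 1 < mean ξ) : ξ 1 < 1 := by
  refine lt_of_le_of_ne (ξ.coe_le_one 1) fun h => ?_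
  have h0 : ∀ k, k ≠ 1 → ξ k = 0 := fun k hk => by
    have := (PMF.apply_eq_one_iff ξ 1).1 h
    rw [PMF.apply_eq_zero_iff, this]
    simpa using hk
  refine absurd h1 (not_lt.2 ?_)
  rw [mean, tsum_eq_single 1 fun k hk => by rw [h0 k hk, mul_zero], h]
  simp

/-- A large total mass forces large siblings of some child, unless the root has one child. With at
least two children, the mass of child `1` is among the siblings of child `2`; so if the siblings of
`1` and those of `2` both had mass at most `y`, the total would be at most `2y/m ≤ z`. With exactly
one child, `W = W₁/m ≤ W₁`, so this case has probability at most `ξ 1 * P(W > z)`. -/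
theorem le_tsum_siblingMass (h : BranchingLaw ξ μ) (h1 : 1 < mean ξ) (hm' : mean ξ ≠ ⊤)
    {y z : ℝ≥0∞} (hyz : y + y ≤ z * mean ξ) :
    (1 - ξ 1) * μ {T | z < totalMass (mean ξ) T}
      ≤ ∑' i : ℕ+, μ (hasChild i ∩ {T | y < siblingMass (mean ξ) i T}) := by
  have := h.prob
  have hm : mean ξ ≠ 0 := (zero_lt_one.trans h1).ne'
  set m := mean ξ with hmdef
  set E := {T | z < totalMass m T} with hE
  have hEm : MeasurableSet E := measurableSet_lt measurable_const (measurable_totalMass m)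
  set O := {T : OrderedTree | T.numChildren [] = ((1 : ℕ) : ℤ)} with hO
  have hOm : MeasurableSet O := measurableSet_numChildren 1
  have hEO : μ (E ∩ O) ≤ ξ 1 * μ E := by
    have h2 := h.measure_pi 1 (fun _ => E) fun _ => hEm
    rw [Finset.prod_const, Finset.card_univ, Fintype.card_fin, pow_one] at h2
    rw [← h2]
    refine measure_mono_ae ?_
    filter_upwards [h.ae_goodTrees hm hm'] with T hT
    rintro ⟨hTE, hTO⟩
    refine ⟨hTO, fun i => ?_⟩
    have hi : Nat.succPNat (i : ℕ) = 1 := by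
      have := Fin.val_eq_zero i
      rw [this]; rfl
    rw [hi]
    have hW := hT.2 []
    simp only [OrderedTree.shift_nil, List.nil_append] at hW
    have hch := ((T.numChildren_nil_eq_iff 1).1 hTO).2
    rw [tsum_eq_single 1] at hW
    · refine mem_ofPred.2 (lt_of_lt_of_le (mem_ofPred.1 hTE) ?_)
      rw [hW]
      exact ENNReal.div_le_of_le_mul (le_mul_of_one_le_right zero_le h1.le)
    · intro j hj
      refine totalMass_eq_zero fun hh => hj ?_
      have h3 := (hch j).1 (by simpa using hh)
      exact PNat.coe_eq_one_iff.1 (le_antisymm h3 j.pos)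
  have hdiff : μ (E \ O) ≤ ∑' i : ℕ+, μ (hasChild i ∩ {T | y < siblingMass m i T}) := by
    refine le_trans (measure_mono_ae ?_) (measure_iUnion_le _)
    filter_upwards [h.ae_goodTrees hm hm', h.ae_nil_mem] with T hT hnil
    rintro ⟨hTE, hTO⟩
    have hW := fun i => totalMass_add_siblingMass hT i
    obtain ⟨k, hk⟩ := T.children [] hnil
    have hTE' : z < totalMass m T := hTE
    have hk1 : k ≠ 1 := by
      rintro rfl
      exact hTO ((T.numChildren_nil_eq_iff 1).2 ⟨hnil, by simpa using hk⟩)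
    have hk0 : k ≠ 0 := by
      rintro rfl
      have hz : ∀ i : ℕ+, totalMass m (T.shift [i]) = 0 := fun i => totalMass_eq_zero fun hh => by
        have := (hk i).1 (by simpa using hh)
        have := i.pos
        omega
      have hW0 : totalMass m (T.shift []) = (∑' i : ℕ+, totalMass m (T.shift ([] ++ [i]))) / m :=
        hT.2 []
      rw [OrderedTree.shift_nil] at hW0
      simp only [List.nil_append, hz, tsum_zero, ENNReal.zero_div] at hW0
      rw [hW0] at hTE'
      exact not_lt_zero hTE'
    have hc1 : T ∈ hasChild 1 := (hk 1).2 (by simp; omega)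
    have hc2 : T ∈ hasChild 2 := (hk 2).2 (by show 2 ≤ k; omega)
    have h12 : (1 : ℕ+) ≠ 2 := by decide
    by_cases hs1 : y < siblingMass m 1 T
    · exact mem_iUnion.2 ⟨1, hc1, hs1⟩
    by_cases hs2 : y < siblingMass m 2 T
    · exact mem_iUnion.2 ⟨2, hc2, hs2⟩
    exfalso
    have hle : totalMass m (T.shift [1]) ≤ siblingMass m 2 T := by
      refine le_trans ?_ (ENNReal.le_tsum (1 : ℕ+))
      rw [if_neg h12]
    refine absurd hTE' (not_lt.2 ?_)
    rw [hW 1]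
    refine ENNReal.div_le_of_le_mul (le_trans ?_ hyz)
    exact add_le_add (hle.trans (not_lt.1 hs2)) (not_lt.1 hs1)
  refine le_trans ?_ hdiff
  rw [ENNReal.sub_mul fun _ _ => measure_ne_top _ _, one_mul, tsub_le_iff_right,
    ← measure_inter_add_sdiff E hOm, add_comm]
  refine add_le_add le_rfl ?_
  rwa [add_comm, measure_inter_add_sdiff E hOm]

theorem siblingProb_add (h : BranchingLaw ξ μ) (hm : mean ξ ≠ 0) (hm' : mean ξ ≠ ⊤) (y : ℝ≥0∞) :
    siblingProb (mean ξ) μ y +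
      (mean ξ)⁻¹ * ∑' i : ℕ+, μ (hasChild i ∩ {T | y < siblingMass (mean ξ) i T}) = 1 := by
  rw [siblingProb, ← mul_add, ← ENNReal.tsum_add]
  have : ∀ i : ℕ+, μ (hasChild i ∩ {T | siblingMass (mean ξ) i T ≤ y}) +
      μ (hasChild i ∩ {T | y < siblingMass (mean ξ) i T}) = μ (hasChild i) := fun i => by
    rw [← measure_inter_add_sdiff (hasChild i)
      (measurableSet_le (measurable_siblingMass (mean ξ) i) (measurable_const (a := y)))]
    congr 2
    ext T; simp
  simp_rw [this]
  rw [h.tsum_measure_hasChild, ENNReal.inv_mul_cancel hm hm']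

theorem siblingProb_le_one (h : BranchingLaw ξ μ) (hm : mean ξ ≠ 0) (hm' : mean ξ ≠ ⊤) (y : ℝ≥0∞) :
    siblingProb (mean ξ) μ y ≤ 1 := by
  rw [← h.siblingProb_add hm hm' y]; exact le_self_add

/-- The exponent of the decay of the number of vertices whose siblings have small mass. -/
noncomputable def decayExponent (ξ : PMF ℕ) : ℝ := ((mean ξ)⁻¹ * (1 - ξ 1)).toReal

theorem decayExponent_pos (h1 : 1 < mean ξ) (hm' : mean ξ ≠ ⊤) : 0 < decayExponent ξ := by
  have hm : mean ξ ≠ 0 := (zero_lt_one.trans h1).ne'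
  refine ENNReal.toReal_pos (mul_ne_zero (ENNReal.inv_ne_zero.2 hm')
    (tsub_pos_of_lt (pmf_one_lt_one h1)).ne') (ENNReal.mul_ne_top (ENNReal.inv_ne_top.2 hm)
    (ne_top_of_le_ne_top ENNReal.one_ne_top tsub_le_self))

theorem ae_totalMass_ne_top (h : BranchingLaw ξ μ) (hm : mean ξ ≠ 0) (hm' : mean ξ ≠ ⊤) :
    ∀ᵐ T ∂μ, totalMass (mean ξ) T ≠ ⊤ :=
  (h.ae_goodTrees hm hm').mono fun _ hT => hT.1

theorem massInverse_mono (h : BranchingLaw ξ μ) (hm : mean ξ ≠ 0) (hm' : mean ξ ≠ ⊤) :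
    Monotone (massInverse (mean ξ) μ) := by
  have := h.prob
  exact rightInverse_mono (measurable_totalMass _) (h.ae_totalMass_ne_top hm hm')

theorem massInverse_log_pos (h : BranchingLaw ξ μ) (hm : mean ξ ≠ 0) (hm' : mean ξ ≠ ⊤)
    (h0 : ¬ ∀ᵐ T ∂μ, totalMass (mean ξ) T = 0) (hd : doublingSup (massInverse (mean ξ) μ) < ⊤)
    {n : ℕ} (hn : 3 ≤ n) : 0 < massInverse (mean ξ) μ (Real.log n) := by
  have := h.prob
  refine rightInverse_pos (measurable_totalMass _) (h.ae_totalMass_ne_top hm hm') h0 hd ?_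
  rw [Real.le_log_iff_exp_le (by positivity)]
  have h3 : (3 : ℝ) ≤ n := by exact_mod_cast hn
  linarith [Real.exp_one_lt_d9]

/-- The siblings at step `n` exceed their level with probability at least `c/n`, since `W` exceeds
`G(log n)/2` with probability at least `e^{-log n} = 1/n`. -/
theorem siblingProb_siblingLevel_le (h : BranchingLaw ξ μ) (h1 : 1 < mean ξ) (hm' : mean ξ ≠ ⊤)
    (h0 : ¬ ∀ᵐ T ∂μ, totalMass (mean ξ) T = 0) (hd : doublingSup (massInverse (mean ξ) μ) < ⊤)
    {k n : ℕ} (hk : 3 ≤ k) (hn : k ≤ n) :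
    siblingProb (mean ξ) μ (siblingLevel (mean ξ) μ k n)
      ≤ ENNReal.ofReal (((n : ℝ) / (n + 1)) ^ decayExponent ξ) := by
  have := h.prob
  have hm : mean ξ ≠ 0 := (zero_lt_one.trans h1).ne'
  have hn0 : (0 : ℝ) < n := by
    have : 0 < n := by omega
    exact_mod_cast this
  have hc := decayExponent_pos h1 hm'
  have hG := h.massInverse_log_pos hm hm' h0 hd (hk.trans hn)
  set G := massInverse (mean ξ) μ (Real.log n) with hGdef
  set y := siblingLevel (mean ξ) μ k n with hy
  have hy' : y = mean ξ * (ENNReal.ofReal (G / 2) / 2) := by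
    rw [hy, siblingLevel, if_neg (not_lt.2 hn)]
  have hyy : y + y ≤ ENNReal.ofReal (G / 2) * mean ξ := by
    rw [hy', ← mul_add, ENNReal.add_halves, mul_comm]
  -- Halving puts the level strictly below the infimum that defines `G`, where the tail is bounded
  -- below; this needs `G(log n) > 0`, hence `n ≥ 3`, for which `log n ≥ 1`.
  have htail : ENNReal.ofReal (1 / n) ≤ μ {T | ENNReal.ofReal (G / 2) < totalMass (mean ξ) T} := by
    have h2 := le_tail_of_lt_rightInverse (P := μ) (W := totalMass (mean ξ)) (x := Real.log n)
      (z := G / 2) (by positivity) (show G / 2 < G by linarith)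
    rwa [Real.exp_neg, Real.exp_log hn0, ← one_div] at h2
  have hlow : ENNReal.ofReal (decayExponent ξ / n)
      ≤ (mean ξ)⁻¹ * ∑' i : ℕ+, μ (hasChild i ∩ {T | y < siblingMass (mean ξ) i T}) := by
    refine le_trans ?_ (mul_le_mul' le_rfl (h.le_tsum_siblingMass h1 hm' hyy))
    rw [← mul_assoc]
    refine le_trans ?_ (mul_le_mul' le_rfl htail)
    rw [← ENNReal.ofReal_toReal (a := (mean ξ)⁻¹ * (1 - ξ 1)), ← ENNReal.ofReal_mul ENNReal.toReal_nonneg]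
    · apply ENNReal.ofReal_le_ofReal
      show decayExponent ξ / n ≤ decayExponent ξ * (1 / n)
      rw [mul_one_div]
    · exact ENNReal.mul_ne_top (ENNReal.inv_ne_top.2 hm)
        (ne_top_of_le_ne_top ENNReal.one_ne_top tsub_le_self)
  have hadd := h.siblingProb_add hm hm' y
  have h3 : siblingProb (mean ξ) μ y ≤ 1 - ENNReal.ofReal (decayExponent ξ / n) := by
    refine ENNReal.le_sub_of_add_le_right ENNReal.ofReal_ne_top ?_
    rw [← hadd]
    gcongr
  refine h3.trans ?_
  rw [← ENNReal.ofReal_one, ← ENNReal.ofReal_sub _ (by positivity)]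
  exact ENNReal.ofReal_le_ofReal (one_sub_div_le_rpow hc.le (by omega))

theorem prod_siblingProb_le (h : BranchingLaw ξ μ) (h1 : 1 < mean ξ) (hm' : mean ξ ≠ ⊤)
    (h0 : ¬ ∀ᵐ T ∂μ, totalMass (mean ξ) T = 0) (hd : doublingSup (massInverse (mean ξ) μ) < ⊤)
    {k : ℕ} (hk : 3 ≤ k) (N : ℕ) (hN : k ≤ N) :
    ∏ j ∈ Finset.range N, siblingProb (mean ξ) μ (siblingLevel (mean ξ) μ k j)
      ≤ ENNReal.ofReal (((k : ℝ) / N) ^ decayExponent ξ) := by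
  have hm : mean ξ ≠ 0 := (zero_lt_one.trans h1).ne'
  have hk0 : (0 : ℝ) < k := by
    have : 0 < k := by omega
    exact_mod_cast this
  induction N, hN using Nat.le_induction with
  | base =>
    rw [div_self hk0.ne', Real.one_rpow, ENNReal.ofReal_one]
    exact Finset.prod_le_one (fun _ _ => zero_le) fun j _ => h.siblingProb_le_one hm hm' _
  | succ N hN ih =>
    have hN0 : (0 : ℝ) < N := lt_of_lt_of_le hk0 (by exact_mod_cast hN)
    rw [Finset.prod_range_succ]
    refine (mul_le_mul' ih (h.siblingProb_siblingLevel_le h1 hm' h0 hd hk hN)).trans ?_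
    rw [← ENNReal.ofReal_mul (by positivity), ← Real.mul_rpow (by positivity) (by positivity)]
    refine le_of_eq ?_
    congr 2
    push_cast
    field_simp

theorem tendsto_decay {c : ℝ} (hc : 0 < c) (k : ℕ) :
    Tendsto (fun N : ℕ => ((k : ℝ) / N) ^ c) atTop (𝓝 0) := by
  have h1 : Tendsto (fun N : ℕ => (k : ℝ) / N) atTop (𝓝 0) := tendsto_const_div_atTop_nhds_zero_nat _
  have h2 := (Real.continuousAt_rpow_const 0 c (Or.inr hc.le)).tendsto.comp h1
  simpa [Function.comp_def, Real.zero_rpow hc.ne'] using h2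

theorem ae_spineLaw_goodTrees (h : BranchingLaw ξ μ) (hm : mean ξ ≠ 0) (hm' : mean ξ ≠ ⊤) :
    ∀ᵐ z ∂(spineLaw (mean ξ) μ), z.1 ∈ goodTrees (mean ξ) := by
  have hms : MeasurableSet {z : OrderedTree × Ray | z.1 ∉ goodTrees (mean ξ)} :=
    (measurable_fst (measurableSet_goodTrees _)).compl
  have : spineLaw (mean ξ) μ {z : OrderedTree × Ray | z.1 ∉ goodTrees (mean ξ)} = 0 := by
    rw [spineLaw_apply hm hm' μ hms,
      lintegral_eq_zero_iff (measurable_rayMeasure_section hm hm' hms)]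
    filter_upwards [h.ae_goodTrees hm hm'] with T hT
    simp [hT]
  exact this

theorem fst_iterate_mem_goodTrees {m : ℝ≥0∞} (hm' : m ≠ ⊤) {z : OrderedTree × Ray}
    (hz : z.1 ∈ goodTrees m) (n : ℕ) : (spineShift^[n] z).1 ∈ goodTrees m := by
  induction n generalizing z with
  | zero => exact hz
  | succ n ih => exact ih (z := spineShift z) (shift_mem_goodTrees hm' hz _)

/-- The second Borel–Cantelli argument, made quantitative: the probability that all sibling masses
from `k` to `N` are light is at most a multiple of `(k/N)^c`, which tends to zero. The first `k`
levels are infinite, so a level that is exceeded has index at least `k`. -/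
theorem ae_frequently_siblingMass (h : BranchingLaw ξ μ) (h1 : 1 < mean ξ) (hm' : mean ξ ≠ ⊤)
    (h0 : ¬ ∀ᵐ T ∂μ, totalMass (mean ξ) T = 0) (hd : doublingSup (massInverse (mean ξ) μ) < ⊤) :
    ∀ᵐ z ∂(spineLaw (mean ξ) μ), ∀ k : ℕ, 3 ≤ k → ∃ j,
      siblingLevel (mean ξ) μ k j < spineSiblingMass (mean ξ) (spineShift^[j] z) := by
  have hm : mean ξ ≠ 0 := (zero_lt_one.trans h1).ne'
  have := h.isFiniteMeasure_spineLaw hm hm'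
  rw [ae_all_iff]
  intro k
  by_cases hk : 3 ≤ k
  swap
  · exact ae_of_all _ fun _ hk' => absurd hk' hk
  have hlim : Tendsto (fun N : ℕ => ENNReal.ofReal (((k : ℝ) / N) ^ decayExponent ξ) *
      spineLaw (mean ξ) μ univ) atTop (𝓝 0) := by
    have h2 := ENNReal.tendsto_ofReal (tendsto_decay (decayExponent_pos h1 hm') k)
    rw [ENNReal.ofReal_zero] at h2
    simpa using ENNReal.Tendsto.mul_const h2 (Or.inr (measure_ne_top (spineLaw (mean ξ) μ) univ))
  have hzero : spineLaw (mean ξ) μ {z | ∀ j, spineSiblingMass (mean ξ) (spineShift^[j] z)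
      ≤ siblingLevel (mean ξ) μ k j} = 0 := by
    refine le_antisymm (ge_of_tendsto hlim ?_) zero_le
    filter_upwards [eventually_ge_atTop k] with N hN
    refine le_trans (measure_mono fun z hz => ?_) ((h.spineLaw_forall_siblingMass_le hm hm' N
      (siblingLevel (mean ξ) μ k)).le.trans
      (mul_le_mul' (h.prod_siblingProb_le h1 hm' h0 hd hk N hN) le_rfl))
    exact fun j _ => (mem_ofPred.1 hz) j
  filter_upwards [measure_eq_zero_iff_ae_notMem.1 hzero] with z hz _
  simpa using hz

/-- The mass at a vertex is at least `m⁻¹` times that of the siblings one step further, so every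
exceeded level yields a ratio of at least `1/4`. -/
theorem ae_le_limsup_spineRatio (h : BranchingLaw ξ μ) (h1 : 1 < mean ξ) (hm' : mean ξ ≠ ⊤)
    (h0 : ¬ ∀ᵐ T ∂μ, totalMass (mean ξ) T = 0) (hd : doublingSup (massInverse (mean ξ) μ) < ⊤) :
    ∀ᵐ z ∂(spineLaw (mean ξ) μ), 1 / 4 ≤ limsup (fun n => spineRatio (mean ξ) μ n z) atTop := by
  have hm : mean ξ ≠ 0 := (zero_lt_one.trans h1).ne'
  filter_upwards [h.ae_frequently_siblingMass h1 hm' h0 hd, h.ae_spineLaw_goodTrees hm hm']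
    with z hz hgood
  refine le_limsup_of_frequently_le ?_
  rw [frequently_atTop]
  intro k
  obtain ⟨j, hj⟩ := hz (max 3 k) (le_max_left _ _)
  have hkj : max 3 k ≤ j := by
    by_contra hc
    rw [siblingLevel, if_pos (not_le.1 hc)] at hj
    exact not_top_lt hj
  rw [siblingLevel, if_neg (not_lt.2 hkj)] at hj
  refine ⟨j, (le_max_right _ _).trans hkj, ?_⟩
  have hG := h.massInverse_log_pos hm hm' h0 hd ((le_max_left 3 k).trans hkj)
  set G := massInverse (mean ξ) μ (Real.log j) with hGdef
  rw [spineRatio, ← hGdef, ENNReal.le_div_iff_mul_le (Or.inl (by simpa using hG))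
    (Or.inl ENNReal.ofReal_ne_top)]
  have hmem := fst_iterate_mem_goodTrees hm' hgood j
  rw [totalMass_add_siblingMass hmem ((spineShift^[j] z).2.digit 0),
    ENNReal.le_div_iff_mul_le (Or.inl hm) (Or.inl hm')]
  refine le_trans ?_ (hj.le.trans le_add_self)
  rw [mul_comm]
  refine mul_le_mul' le_rfl ?_
  have e1 : (1 / 4 : ℝ≥0∞) = ENNReal.ofReal (1 / 4) := by
    rw [ENNReal.ofReal_div_of_pos (by norm_num)]; norm_num
  have e2 : (2 : ℝ≥0∞) = ENNReal.ofReal 2 := by norm_num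
  rw [e1, e2, ← ENNReal.ofReal_mul (by norm_num), ← ENNReal.ofReal_div_of_pos (by norm_num)]
  exact ENNReal.ofReal_le_ofReal (by linarith)

/-- Invariance of `Q` removes `n`: at every step of the ray the mass has the size-biased law of `W`.
-/
theorem spineLaw_totalMass_gt (h : BranchingLaw ξ μ) (hm : mean ξ ≠ 0) (hm' : mean ξ ≠ ⊤)
    (t : ℝ≥0∞) (n : ℕ) :
    spineLaw (mean ξ) μ {z | t < totalMass (mean ξ) (spineShift^[n] z).1}
      = ∫⁻ T in {T | t < totalMass (mean ξ) T}, totalMass (mean ξ) T ∂μ := by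
  have hA : MeasurableSet {T | t < totalMass (mean ξ) T} :=
    measurableSet_lt measurable_const (measurable_totalMass _)
  have hB : MeasurableSet {z : OrderedTree × Ray | t < totalMass (mean ξ) z.1} := measurable_fst hA
  have h2 := ((h.measurePreserving_spineShift hm hm').iterate n).measure_preimage
    hB.nullMeasurableSet
  refine Eq.trans h2 ?_
  rw [spineLaw_apply hm hm' μ hB, ← lintegral_indicator hA]
  refine lintegral_congr_ae ?_
  filter_upwards [h.ae_goodTrees hm hm'] with T hT
  by_cases hTA : t < totalMass (mean ξ) T
  · have := rayMeasure_cylinder hm hm' hT []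
    rw [cylinder_nil] at this
    simpa [hTA] using this
  · simp [hTA]

/-- First Borel–Cantelli lemma: at `x = log n` the size-biased tail bound `e^{-2x}` is `n⁻²`. -/
theorem exists_ae_limsup_spineRatio_le (h : BranchingLaw ξ μ) (h1 : 1 < mean ξ) (hm' : mean ξ ≠ ⊤)
    (hd : doublingSup (massInverse (mean ξ) μ) < ⊤) :
    ∃ a : ℝ≥0, ∀ᵐ z ∂(spineLaw (mean ξ) μ), limsup (fun n => spineRatio (mean ξ) μ n z) atTop ≤ a := by
  have := h.prob
  have hm : mean ξ ≠ 0 := (zero_lt_one.trans h1).ne'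
  obtain ⟨a, K, haK⟩ := exists_setLIntegral_le (measurable_totalMass (mean ξ))
    (h.ae_totalMass_ne_top hm hm') hd
  refine ⟨a, ?_⟩
  set A : ℕ → Set (OrderedTree × Ray) := fun n =>
    {z | a * ENNReal.ofReal (massInverse (mean ξ) μ (Real.log n)) <
      totalMass (mean ξ) (spineShift^[n] z).1} with hA
  have hbound : ∀ n : ℕ, spineLaw (mean ξ) μ (A (n + 3))
      ≤ K * ENNReal.ofReal (1 / ((n + 3 : ℕ) : ℝ) ^ 2) := by
    intro n
    rw [hA, h.spineLaw_totalMass_gt hm hm']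
    have hn0 : (0 : ℝ) < ((n + 3 : ℕ) : ℝ) := by positivity
    have hlog : 1 ≤ Real.log ((n + 3 : ℕ) : ℝ) := by
      rw [Real.le_log_iff_exp_le hn0]
      push_cast
      have : (0 : ℝ) ≤ n := Nat.cast_nonneg n
      linarith [Real.exp_one_lt_d9]
    refine (haK _ hlog).trans (le_of_eq ?_)
    congr 2
    rw [Real.exp_neg, two_mul, Real.exp_add, Real.exp_log hn0, one_div, pow_two]
  have hsum : ∑' n, spineLaw (mean ξ) μ (A (n + 3)) ≠ ⊤ := by
    refine ne_top_of_le_ne_top ?_ (ENNReal.tsum_le_tsum hbound)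
    rw [ENNReal.tsum_mul_left]
    refine ENNReal.mul_ne_top ENNReal.coe_ne_top ?_
    have : Summable fun n : ℕ => 1 / ((n + 3 : ℕ) : ℝ) ^ 2 :=
      (summable_nat_add_iff 3).2 (Real.summable_one_div_nat_pow.2 (by norm_num))
    exact this.tsum_ofReal_ne_top
  filter_upwards [ae_eventually_notMem hsum] with z hz
  refine limsup_le_of_le (by isBoundedDefault) ?_
  have hz' : ∀ᶠ n in atTop, z ∉ A n := by
    obtain ⟨N, hN⟩ := eventually_atTop.1 hz
    filter_upwards [eventually_ge_atTop (N + 3)] with n hn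
    have := hN (n - 3) (by omega)
    rwa [Nat.sub_add_cancel (by omega)] at this
  filter_upwards [hz'] with n hn
  exact ENNReal.div_le_of_le_mul (not_lt.1 hn)

/-- The shift compares the same mass with `G(log n)` in place of `G(log (n+1))`. Equality need not
hold for a given ray, but sub-invariance is all that the ergodic argument requires. -/
theorem limsup_spineRatio_le_shift (h : BranchingLaw ξ μ) (hm : mean ξ ≠ 0) (hm' : mean ξ ≠ ⊤)
    (z : OrderedTree × Ray) :
    limsup (fun n => spineRatio (mean ξ) μ n z) atTop
      ≤ limsup (fun n => spineRatio (mean ξ) μ n (spineShift z)) atTop := by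
  rw [← limsup_nat_add (fun n => spineRatio (mean ξ) μ n z) 1]
  refine limsup_le_limsup ?_ (by isBoundedDefault) (by isBoundedDefault)
  filter_upwards [eventually_ge_atTop 1] with n hn
  rw [spineRatio, spineRatio, Function.iterate_succ_apply]
  refine ENNReal.div_le_div_left (ENNReal.ofReal_le_ofReal (h.massInverse_mono hm hm' ?_)) _
  have hn0 : (0 : ℝ) < n := by exact_mod_cast hn
  exact Real.log_le_log hn0 (by push_cast; linarith)

/-- The upper density of the branching measure is almost surely constant along the ray. -/
theorem exists_limsup_spineRatio_eq (h : BranchingLaw ξ μ) (h1 : 1 < mean ξ) (hm' : mean ξ ≠ ⊤)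
    (h0 : ¬ ∀ᵐ T ∂μ, totalMass (mean ξ) T = 0) (hd : doublingSup (massInverse (mean ξ) μ) < ⊤) :
    ∃ ℓ : ℝ≥0, 0 < ℓ ∧ ∀ᵐ z ∂(spineLaw (mean ξ) μ),
      limsup (fun n => spineRatio (mean ξ) μ n z) atTop = ℓ ∧
      limsup (fun n => spineRatio (mean ξ) μ n (spineShift z)) atTop = ℓ := by
  have hm : mean ξ ≠ 0 := (zero_lt_one.trans h1).ne'
  have := h.isFiniteMeasure_spineLaw hm hm'
  set Q := spineLaw (mean ξ) μ with hQ
  have herg := h.ergodic_spineShift hm hm'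
  set L : OrderedTree × Ray → ℝ≥0∞ := fun z => limsup (fun n => spineRatio (mean ξ) μ n z) atTop
    with hL
  have hLm : Measurable L := Measurable.limsup fun n => measurable_spineRatio _ _ n
  have hQ0 : Q ≠ 0 := by
    intro hQ0
    apply h0
    have h2 := h.spineLaw_univ hm hm'
    rw [← hQ, hQ0, Measure.coe_zero, Pi.zero_apply, eq_comm,
      lintegral_eq_zero_iff (measurable_totalMass _)] at h2
    exact h2
  have : NeZero Q := ⟨hQ0⟩
  -- Each set `{a < L}` is contained in its preimage under the shift, hence is null or full by
  -- ergodicity, and countably many of these sets separate values.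
  obtain ⟨ℓ, hℓ⟩ : ∃ ℓ, L =ᵐ[Q] Function.const _ ℓ := by
    have hsep : HasCountableSeparatingOn ℝ≥0∞ (fun U => U ∈ range Ioi) univ :=
      HasCountableSeparatingOn.range_Ioi
    refine exists_eventuallyEq_const_of_forall_separating (fun U => U ∈ range Ioi) ?_
    rintro _ ⟨a, rfl⟩
    have hs : MeasurableSet {z | a < L z} := measurableSet_lt measurable_const hLm
    have hle : {z | a < L z} ≤ᵐ[Q] spineShift ⁻¹' {z | a < L z} :=
      ae_of_all _ fun z hz => lt_of_lt_of_le hz (h.limsup_spineRatio_le_shift hm hm' z)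
    rcases herg.ae_empty_or_univ_of_ae_le_preimage hs.nullMeasurableSet hle with he | he
    · right
      filter_upwards [he] with z hz hz'
      exact (Set.mem_empty_iff_false z).1 ((iff_of_eq hz).1 hz')
    · left
      filter_upwards [he] with z hz
      exact (iff_of_eq hz).2 trivial
  have hℓ' : ∀ᵐ z ∂Q, L (spineShift z) = ℓ :=
    herg.toMeasurePreserving.quasiMeasurePreserving.ae hℓ
  obtain ⟨a, ha⟩ := h.exists_ae_limsup_spineRatio_le h1 hm' hd
  have hlow := h.ae_le_limsup_spineRatio h1 hm' h0 hd
  obtain ⟨z, hz1, hz2, hz3⟩ := (hℓ.and (ha.and hlow)).exists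
  have hz1' : L z = ℓ := hz1
  have hz2' : L z ≤ a := hz2
  have hz3' : 1 / 4 ≤ L z := hz3
  rw [hz1'] at hz2' hz3'
  have htop : ℓ ≠ ⊤ := ne_top_of_le_ne_top ENNReal.coe_ne_top hz2'
  refine ⟨ℓ.toNNReal, ENNReal.toNNReal_pos ?_ htop, ?_⟩
  · rintro rfl
    simp at hz3'
  · rw [ENNReal.coe_toNNReal htop]
    filter_upwards [hℓ, hℓ'] with z hz hz'
    exact ⟨hz, hz'⟩

end BranchingLaw

/-! ### Diameters and densities in the space of rays -/

theorem dist_eq_exp {x y : Ray} (h : x ≠ y) : ∃ n : ℕ, dist x y = Real.exp (-n) :=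
  ⟨_, if_neg h⟩

theorem dist_le_exp_iff (x y : Ray) (n : ℕ) :
    dist x y ≤ Real.exp (-n) ↔ x.trunc n = y.trunc n := by
  rw [← Ray.dist_lt_iff x y n _ (Real.exp_lt_exp.2 (by linarith)) le_rfl]
  constructor
  · exact fun h => h.trans_lt (Real.exp_lt_exp.2 (by linarith))
  · intro h
    by_cases hxy : x = y
    · rw [hxy, dist_self]; exact (Real.exp_pos _).le
    · obtain ⟨k, hk⟩ := dist_eq_exp hxy
      rw [hk, Real.exp_lt_exp] at h
      rw [hk, Real.exp_le_exp]
      have h1 : (n : ℝ) < k + 1 := by linarith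
      have h2 : n < k + 1 := by exact_mod_cast h1
      have h3 : (n : ℝ) ≤ k := by exact_mod_cast Nat.lt_succ_iff.1 h2
      linarith

theorem mem_cylinder_trunc (x : Ray) (n : ℕ) : x ∈ cylinder (x.trunc n) := by
  simp [cylinder, Ray.trunc_length]

theorem mem_cylinder_trunc_iff (x y : Ray) (n : ℕ) :
    y ∈ cylinder (x.trunc n) ↔ y.trunc n = x.trunc n := by
  simp [cylinder, Ray.trunc_length]

theorem trunc_of_mem_cylinder {x : Ray} {u : Word} (h : x ∈ cylinder u) : x.trunc u.length = u := h

theorem trunc_take (x : Ray) {k n : ℕ} (h : k ≤ n) : (x.trunc n).take k = x.trunc k := by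
  simp [Ray.trunc, ← List.map_take, List.take_range, min_eq_left h]

theorem ediam_le_exp {A : Set Ray} {n : ℕ} (h : ∀ x ∈ A, ∀ y ∈ A, x.trunc n = y.trunc n) :
    Metric.ediam A ≤ ENNReal.ofReal (Real.exp (-n)) := by
  refine Metric.ediam_le fun x hx y hy => ?_
  rw [edist_dist]
  exact ENNReal.ofReal_le_ofReal ((dist_le_exp_iff x y n).2 (h x hx y hy))

theorem exists_mem_cylinder_append (u : Word) (i : ℕ+) : ∃ x : Ray, x ∈ cylinder (u ++ [i]) := by
  refine ⟨⟨fun n => (u ++ [i]).getD n 1⟩, ?_⟩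
  rw [cylinder, mem_ofPred_eq]
  refine List.ext_getElem (by simp [Ray.trunc]) fun n h1 h2 => ?_
  simp only [Ray.trunc, List.getElem_map, List.getElem_range, List.getD_eq_getElem?_getD,
    List.getElem?_eq_getElem h2, Option.getD_some]

/-- The diameter is attained exactly because cylinders are taken in the space of all rays, where
`u1` and `u2` both extend `u`, whatever the tree is. -/
theorem ediam_cylinder (u : Word) :
    Metric.ediam (cylinder u) = ENNReal.ofReal (Real.exp (-u.length)) := by
  refine le_antisymm (ediam_le_exp fun x hx y hy => ?_) ?_
  · exact (trunc_of_mem_cylinder hx).trans (trunc_of_mem_cylinder hy).symm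
  · obtain ⟨x, hx⟩ := exists_mem_cylinder_append u 1
    obtain ⟨y, hy⟩ := exists_mem_cylinder_append u 2
    have hxu := (trunc_of_mem_cylinder hx)
    have hyu := (trunc_of_mem_cylinder hy)
    rw [List.length_append, List.length_singleton, Ray.trunc_succ] at hxu hyu
    obtain ⟨hx1, hx2⟩ := List.append_inj' hxu rfl
    obtain ⟨hy1, hy2⟩ := List.append_inj' hyu rfl
    refine le_trans ?_ (Metric.edist_le_ediam_of_mem (s := cylinder u) hx1 hy1)
    rw [edist_dist]
    refine ENNReal.ofReal_le_ofReal ?_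
    by_contra hc
    have hd : x.digit u.length ≠ y.digit u.length := by
      have e1 : x.digit u.length = 1 := by simpa using hx2
      have e2 : y.digit u.length = 2 := by simpa using hy2
      rw [e1, e2]; decide
    have h1 := (Ray.dist_lt_iff x y (u.length + 1) _ (Real.exp_lt_exp.2 (by push_cast; linarith))
      (le_of_eq (by push_cast; ring_nf))).1 (not_le.1 hc)
    rw [Ray.trunc_eq_iff] at h1
    exact hd (h1 _ (Nat.lt_succ_self _))

/-- A set with at least two points has diameter `exp (-n)` for some `n`, and is in a cylinder
of length `n`. -/
theorem exists_subset_cylinder {A : Set Ray} (hA : A.Nontrivial) :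
    ∃ n : ℕ, Metric.ediam A = ENNReal.ofReal (Real.exp (-n)) ∧
      ∀ x ∈ A, A ⊆ cylinder (x.trunc n) := by
  classical
  have hex : ∃ n : ℕ, ∃ x ∈ A, ∃ y ∈ A, dist x y = Real.exp (-n) := by
    obtain ⟨x, hx, y, hy, hxy⟩ := hA
    obtain ⟨n, hn⟩ := dist_eq_exp hxy
    exact ⟨n, x, hx, y, hy, hn⟩
  set n := Nat.find hex
  obtain ⟨x₀, hx₀, y₀, hy₀, hd⟩ := Nat.find_spec hex
  have hle : ∀ x ∈ A, ∀ y ∈ A, dist x y ≤ Real.exp (-n) := by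
    intro x hx y hy
    by_cases hxy : x = y
    · rw [hxy, dist_self]; exact (Real.exp_pos _).le
    · obtain ⟨k, hk⟩ := dist_eq_exp hxy
      rw [hk, Real.exp_le_exp, neg_le_neg_iff]
      have h2 : n ≤ k := Nat.find_min' hex ⟨x, hx, y, hy, hk⟩
      exact_mod_cast h2
  refine ⟨n, le_antisymm ?_ ?_, fun x hx y hy => ?_⟩
  · exact ediam_le_exp fun x hx y hy => (dist_le_exp_iff x y n).1 (hle x hx y hy)
  · refine le_trans (le_of_eq ?_) (Metric.edist_le_ediam_of_mem hx₀ hy₀)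
    rw [edist_dist, hd]
  · exact (mem_cylinder_trunc_iff x y n).2 ((dist_le_exp_iff y x n).1 (hle y hy x hx))

theorem measurable_measure_cylinder_trunc (M : Measure Ray) (n : ℕ) :
    Measurable fun x : Ray => M (cylinder (x.trunc n)) := by
  intro B _
  have : (fun x : Ray => M (cylinder (x.trunc n))) ⁻¹' B
      = ⋃ u : {u : Word // u.length = n ∧ M (cylinder u) ∈ B}, cylinder u := by
    ext x
    simp only [mem_preimage, mem_iUnion, Subtype.exists, exists_prop]
    constructor
    · exact fun h => ⟨x.trunc n, ⟨x.trunc_length n, h⟩, mem_cylinder_trunc x n⟩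
    · rintro ⟨u, ⟨rfl, hB⟩, hx⟩
      rwa [trunc_of_mem_cylinder hx]
  rw [this]
  exact MeasurableSet.iUnion fun u => measurableSet_cylinder _

section Density

variable {M : Measure Ray} {m₀ : ℝ≥0∞ → ℝ≥0∞} {γ : ℕ → ℝ≥0∞}

/-- If the upper density is at most `b` on `A`, the Hausdorff measure is at least `M / b` on `A`. -/
theorem measure_le_mul_mkMetric (hγ : ∀ n : ℕ, m₀ (ENNReal.ofReal (Real.exp (-n))) = γ n)
    (hγ0 : Tendsto γ atTop (𝓝 0)) {b : ℝ≥0∞} (hb0 : b ≠ 0) (hb : b ≠ ⊤) {A : Set Ray}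
    (hA : ∀ x ∈ A, ∀ᶠ n in atTop, M (cylinder (x.trunc n)) ≤ b * γ n) :
    M A ≤ b * Measure.mkMetric m₀ A := by
  set B : ℕ → Set Ray := fun k => {x | ∀ n ≥ k, M (cylinder (x.trunc n)) ≤ b * γ n} with hB
  have hBm : ∀ k, MeasurableSet (B k) := fun k => by
    have : B k = ⋂ n : ℕ, ⋂ _ : n ≥ k, {x | M (cylinder (x.trunc n)) ≤ b * γ n} := by
      ext x; simp [hB]
    rw [this]
    exact MeasurableSet.iInter fun n => MeasurableSet.iInter fun _ =>
      measurableSet_le (measurable_measure_cylinder_trunc M n) measurable_const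
  have hbγ : Tendsto (fun n => b * γ n) atTop (𝓝 0) := by
    simpa using ENNReal.Tendsto.const_mul hγ0 (Or.inr hb)
  have hle : ∀ k, b⁻¹ • M.restrict (B k) ≤ Measure.mkMetric m₀ := by
    intro k
    refine Measure.le_mkMetric m₀ _ (ENNReal.ofReal (Real.exp (-k))) (by positivity) fun s hs => ?_
    rw [Measure.smul_apply, Measure.restrict_apply' (hBm k), smul_eq_mul]
    rcases (s ∩ B k).eq_empty_or_nonempty with he | ⟨x, hxs, hxB⟩
    · rw [he]; simp
    rcases s.subsingleton_or_nontrivial with hsub | hnt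
    · have h0 : M (s ∩ B k) = 0 := by
        refine le_antisymm (ge_of_tendsto hbγ ?_) zero_le
        filter_upwards [eventually_ge_atTop k] with n hn
        refine le_trans (measure_mono fun y hy => ?_) (hxB n hn)
        rw [hsub hy.1 hxs]
        exact mem_cylinder_trunc x n
      rw [h0]; simp
    · obtain ⟨n, hdiam, hsubset⟩ := exists_subset_cylinder hnt
      rw [hdiam, hγ]
      have hkn : k ≤ n := by
        rw [hdiam, ENNReal.ofReal_le_ofReal_iff (Real.exp_pos _).le, Real.exp_le_exp,
          neg_le_neg_iff] at hs
        exact_mod_cast hs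
      calc b⁻¹ * M (s ∩ B k) ≤ b⁻¹ * (b * γ n) := by
            gcongr
            exact (measure_mono (inter_subset_left.trans (hsubset x hxs))).trans (hxB n hkn)
        _ = γ n := by rw [← mul_assoc, ENNReal.inv_mul_cancel hb0 hb, one_mul]
  have hmono : Monotone fun k => A ∩ B k := fun k l hkl x hx =>
    ⟨hx.1, fun n hn => hx.2 n (hkl.trans hn)⟩
  have hAU : A = ⋃ k, A ∩ B k := by
    ext x
    simp only [mem_iUnion, mem_inter_iff]
    refine ⟨fun hx => ?_, fun ⟨_, hx, _⟩ => hx⟩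
    obtain ⟨k, hk⟩ := eventually_atTop.1 (hA x hx)
    exact ⟨k, hx, hk⟩
  have h1 : M A = ⨆ k, M (A ∩ B k) := by rw [← hmono.measure_iUnion, ← hAU]
  rw [h1]
  refine iSup_le fun k => ?_
  have h2 := hle k A
  rw [Measure.smul_apply, Measure.restrict_apply' (hBm k), smul_eq_mul] at h2
  calc M (A ∩ B k) = b * (b⁻¹ * M (A ∩ B k)) := by
        rw [← mul_assoc, ENNReal.mul_inv_cancel hb0 hb, one_mul]
    _ ≤ _ := by gcongr

theorem cylinder_eq_of_mem {u v : Word} {x : Ray} (hu : x ∈ cylinder u) (hv : x ∈ cylinder v)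
    (h : u.length ≤ v.length) : u = v.take u.length := by
  rw [← trunc_of_mem_cylinder hv, trunc_take x h, trunc_of_mem_cylinder hu]

theorem exists_cylinder_subset {U : Set Ray} (hU : IsOpen U) {x : Ray} (hx : x ∈ U) :
    ∀ᶠ n : ℕ in atTop, cylinder (x.trunc n) ⊆ U := by
  obtain ⟨ε, hε, hb⟩ := Metric.isOpen_iff.1 hU x hx
  obtain ⟨N, hN⟩ := exists_nat_gt (1 - Real.log ε)
  filter_upwards [eventually_ge_atTop N] with n hn
  rw [← ball_eq_cylinder]
  refine (Metric.ball_subset_ball ?_).trans hb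
  have hn' : (N : ℝ) ≤ n := by exact_mod_cast hn
  rw [← Real.le_log_iff_exp_le hε]
  linarith

/-- If the upper density is at least `a` on `A`, the Hausdorff measure is at most `M / a` on `A`. -/
theorem mul_mkMetric_le_measure [IsFiniteMeasure M] (hγ : ∀ n : ℕ, m₀ (ENNReal.ofReal (Real.exp (-n))) = γ n)
    {a : ℝ≥0∞} (ha0 : a ≠ 0) (ha : a ≠ ⊤) {A : Set Ray}
    (hA : ∀ x ∈ A, ∃ᶠ n in atTop, a * γ n ≤ M (cylinder (x.trunc n))) :
    a * Measure.mkMetric m₀ A ≤ M A := by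
  have key : ∀ U, A ⊆ U → IsOpen U → Measure.mkMetric m₀ A ≤ a⁻¹ * M U := by
    intro U hAU hU
    set p : ℕ → Word → Prop := fun N u =>
      N ≤ u.length ∧ cylinder u ⊆ U ∧ a * γ u.length ≤ M (cylinder u) with hp
    -- Keeping only the words with no strict prefix of the same kind makes the cylinders disjoint,
    -- so that no covering lemma is needed.
    set V : ℕ → Set Word := fun N => {u | p N u ∧ ∀ k < u.length, ¬ p N (u.take k)} with hV
    have hcover : ∀ N, A ⊆ ⋃ u : V N, cylinder u := by
      classical
      intro N x hx
      have hex : ∃ n, p N (x.trunc n) := by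
        obtain ⟨n, h1, h2, h3⟩ := ((hA x hx).and_eventually
          ((exists_cylinder_subset hU (hAU hx)).and (eventually_ge_atTop N))).exists
        exact ⟨n, by rwa [x.trunc_length], h2, by rwa [x.trunc_length]⟩
      refine mem_iUnion.2 ⟨⟨x.trunc (Nat.find hex), Nat.find_spec hex, fun k hk => ?_⟩,
        mem_cylinder_trunc x _⟩
      rw [x.trunc_length] at hk
      rw [trunc_take x hk.le]
      exact Nat.find_min hex hk
    have hdisj : ∀ N, Pairwise (Function.onFun Disjoint fun u : V N => cylinder (u : Word)) := by
      intro N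
      have hlt : ∀ u v : V N, (u : Word).length ≤ (v : Word).length →
          ¬ Disjoint (cylinder (u : Word)) (cylinder (v : Word)) → u = v := by
        intro u v hle hnd
        obtain ⟨x, hxu, hxv⟩ := Set.not_disjoint_iff.1 hnd
        have he := cylinder_eq_of_mem hxu hxv hle
        rcases hle.lt_or_eq with hl | hl
        · have := v.2.2 _ hl
          rw [← he] at this
          exact absurd u.2.1 this
        · refine Subtype.ext ?_
          rw [he, hl, List.take_length]
      intro u v huv
      by_contra hnd
      rcases le_total (u : Word).length (v : Word).length with hle | hle
      · exact huv (hlt u v hle hnd)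
      · exact huv (hlt v u hle fun h => hnd h.symm).symm
    have hr : Tendsto (fun N : ℕ => ENNReal.ofReal (Real.exp (-N))) atTop (𝓝 0) := by
      rw [← ENNReal.ofReal_zero]
      exact ENNReal.tendsto_ofReal (Real.tendsto_exp_atBot.comp
        (tendsto_neg_atTop_atBot.comp tendsto_natCast_atTop_atTop))
    refine (Measure.mkMetric_le_liminf_tsum A _ hr (fun N (u : V N) => cylinder (u : Word))
      (Eventually.of_forall fun N u => ?_) (Eventually.of_forall hcover) m₀).trans ?_
    · rw [ediam_cylinder]
      refine ENNReal.ofReal_le_ofReal (Real.exp_le_exp.2 (neg_le_neg ?_))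
      exact_mod_cast u.2.1.1
    · refine (liminf_le_liminf (v := fun _ : ℕ => a⁻¹ * M U) (Eventually.of_forall fun N => ?_)
        (by isBoundedDefault) (by isBoundedDefault)).trans (le_of_eq (by simp))
      calc ∑' u : V N, m₀ (Metric.ediam (cylinder (u : Word)))
          ≤ ∑' u : V N, a⁻¹ * M (cylinder (u : Word)) := by
            refine ENNReal.tsum_le_tsum fun u => ?_
            rw [ediam_cylinder, hγ]
            calc γ (u : Word).length = a⁻¹ * (a * γ (u : Word).length) := by
                  rw [← mul_assoc, ENNReal.inv_mul_cancel ha0 ha, one_mul]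
              _ ≤ _ := by gcongr; exact u.2.1.2.2
        _ = a⁻¹ * M (⋃ u : V N, cylinder (u : Word)) := by
            rw [ENNReal.tsum_mul_left, measure_iUnion (hdisj N) fun u => measurableSet_cylinder _]
        _ ≤ a⁻¹ * M U := by
            gcongr
            exact iUnion_subset fun u => u.2.1.2.1
  have h2 : Measure.mkMetric m₀ A ≤ a⁻¹ * M A := by
    refine ENNReal.le_of_forall_pos_le_add fun ε hε _ => ?_
    obtain ⟨U, hAU, hU, hMU⟩ := A.exists_isOpen_le_add M (ε := a * ε)
      (mul_ne_zero ha0 (by exact_mod_cast hε.ne'))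
    refine (key U hAU hU).trans ((mul_le_mul' le_rfl hMU).trans (le_of_eq ?_))
    rw [mul_add, ← mul_assoc a⁻¹ a, ENNReal.inv_mul_cancel ha0 ha, one_mul]
  calc a * Measure.mkMetric m₀ A ≤ a * (a⁻¹ * M A) := by gcongr
    _ = M A := by rw [← mul_assoc, ENNReal.mul_inv_cancel ha0 ha, one_mul]

end Density

/-! ### Vertices whose ancestors all have light siblings -/

/-- The number of the vertices `u` of generation `n` such that the siblings of the ancestor of `u`
at generation `j + 1` have mass at most `y j`, for `j < n`. -/
noncomputable def thinCount (m : ℝ≥0∞) : ℕ → (ℕ → ℝ≥0∞) → OrderedTree → ℝ≥0∞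
  | 0, _, _ => 1
  | n + 1, y, T => ∑' i : ℕ+, (hasChild i ∩ {T | siblingMass m i T ≤ y 0}).indicator
      (fun T => thinCount m n (fun j => y (j + 1)) (T.shift [i])) T

theorem measurable_thinCount (m : ℝ≥0∞) (n : ℕ) (y : ℕ → ℝ≥0∞) :
    Measurable (thinCount m n y) := by
  induction n generalizing y with
  | zero => exact measurable_const
  | succ n ih =>
    exact Measurable.tsum fun i => ((ih _).comp (measurable_shift [i])).indicator
      ((measurableSet_hasChild i).inter
        (measurableSet_le (measurable_siblingMass m i) measurable_const))

/-- A many-to-one formula: the mean over vertices of generation `n` is `mⁿ` times the probability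
along the size-biased ray, so the decay estimate for the spine applies to this count too. -/
theorem BranchingLaw.lintegral_thinCount {ξ : PMF ℕ} {μ : Measure OrderedTree}
    (h : BranchingLaw ξ μ) (hm : mean ξ ≠ 0) (hm' : mean ξ ≠ ⊤) (n : ℕ) (y : ℕ → ℝ≥0∞) :
    ∫⁻ T, thinCount (mean ξ) n y T ∂μ
      = mean ξ ^ n * ∏ j ∈ Finset.range n, siblingProb (mean ξ) μ (y j) := by
  have := h.prob
  induction n generalizing y with
  | zero => simp [thinCount]
  | succ n ih =>
    have hB : ∀ i : ℕ+, MeasurableSet[siblingSigma i] {T | siblingMass (mean ξ) i T ≤ y 0} :=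
      fun i => measurable_siblingMass_siblingSigma _ i measurableSet_Iic
    have hB' : ∀ i : ℕ+, MeasurableSet {T | siblingMass (mean ξ) i T ≤ y 0} :=
      fun i => memSigma_le _ _ (hB i)
    have hmeas : ∀ i : ℕ+, Measurable ((hasChild i ∩ {T | siblingMass (mean ξ) i T ≤ y 0}).indicator
        fun T => thinCount (mean ξ) n (fun j => y (j + 1)) (T.shift [i])) := fun i =>
      ((measurable_thinCount (mean ξ) n _).comp (measurable_shift [i])).indicator
        ((measurableSet_hasChild i).inter (hB' i))
    simp only [thinCount]
    rw [lintegral_tsum fun i => (hmeas i).aemeasurable]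
    have key : ∀ i : ℕ+, ∫⁻ T, (hasChild i ∩ {T | siblingMass (mean ξ) i T ≤ y 0}).indicator
        (fun T => thinCount (mean ξ) n (fun j => y (j + 1)) (T.shift [i])) T ∂μ
        = μ (hasChild i ∩ {T | siblingMass (mean ξ) i T ≤ y 0}) *
          ∫⁻ T, thinCount (mean ξ) n (fun j => y (j + 1)) T ∂μ := by
      intro i
      have h1 := h.lintegral_mul_shift i
        (H := {T | siblingMass (mean ξ) i T ≤ y 0}.indicator fun _ => 1)
        ((@measurable_const _ _ _ (siblingSigma i) (1 : ℝ≥0∞)).indicator (hB i))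
        (measurable_thinCount (mean ξ) n fun j => y (j + 1))
      rw [lintegral_indicator (hB' i), Measure.restrict_restrict (hB' i), lintegral_const, one_mul,
        Measure.restrict_apply_univ, inter_comm] at h1
      rw [← h1, ← lintegral_indicator (measurableSet_hasChild i)]
      refine lintegral_congr fun T => ?_
      by_cases h2 : T ∈ hasChild i <;>
        by_cases h3 : T ∈ {T | siblingMass (mean ξ) i T ≤ y 0} <;>
        simp_all [indicator]
    simp_rw [key]
    rw [ENNReal.tsum_mul_right, ih, Finset.prod_range_succ', siblingProb]
    have : mean ξ * (mean ξ)⁻¹ = 1 := ENNReal.mul_inv_cancel hm hm'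
    rw [pow_succ]
    calc _ = (mean ξ * (mean ξ)⁻¹) * _ := by rw [this, one_mul]
      _ = _ := by ring

/-- The vertices counted by `thinCount` are a section of the rays along which siblings are light. -/
theorem exists_thin_section (m : ℝ≥0∞) (n : ℕ) (y : ℕ → ℝ≥0∞) (T : OrderedTree) :
    ∃ V : Set Word, (∀ u ∈ V, u.length = n) ∧ ∑' _ : V, 1 ≤ thinCount m n y T ∧
      ∀ x : Ray, x ∈ T.boundary → (∀ j < n, spineSiblingMass m (spineShift^[j] (T, x)) ≤ y j) →
        x.trunc n ∈ V := by
  classical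
  induction n generalizing y T with
  | zero => exact ⟨{[]}, by simp, by simp [thinCount], fun x _ _ => by simp [Ray.trunc]⟩
  | succ n ih =>
    choose V hlen hcard hmem using fun i : ℕ+ => ih (fun j => y (j + 1)) (T.shift [i])
    refine ⟨⋃ i : ℕ+, if T ∈ hasChild i ∩ {T | siblingMass m i T ≤ y 0} then
      List.cons i '' V i else ∅, ?_, ?_, ?_⟩
    · intro u hu
      obtain ⟨i, hi⟩ := mem_iUnion.1 hu
      split_ifs at hi
      · obtain ⟨v, hv, rfl⟩ := hi
        simp [hlen i v hv]
      · exact absurd hi (notMem_empty _)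
    · refine (ENNReal.tsum_iUnion_le_tsum (fun _ => 1) _).trans ?_
      rw [thinCount]
      refine ENNReal.tsum_le_tsum fun i => ?_
      by_cases hi : T ∈ hasChild i ∩ {T | siblingMass m i T ≤ y 0}
      · rw [if_pos hi, indicator_of_mem hi,
          tsum_image (fun _ => (1 : ℝ≥0∞)) (List.cons_injective.injOn)]
        exact hcard i
      · rw [if_neg hi]; simp
    · intro x hx hy
      refine mem_iUnion.2 ⟨x.digit 0, ?_⟩
      have h1 : T ∈ hasChild (x.digit 0) ∩ {T | siblingMass m (x.digit 0) T ≤ y 0} :=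
        ⟨by simpa [Ray.trunc, hasChild] using hx 1, hy 0 (Nat.succ_pos n)⟩
      rw [if_pos h1, Ray.trunc_succ']
      refine ⟨_, hmem _ x.tail (fun k => ?_) fun j hj => ?_, rfl⟩
      · have := hx (k + 1)
        rwa [Ray.trunc_succ'] at this
      · exact hy (j + 1) (Nat.succ_lt_succ hj)

/-! ### The gauge along the scale of cylinders -/

/-- The gauge of a cylinder of length `n`. -/
noncomputable def cylinderGauge (m : ℝ) (G : ℝ → ℝ) (n : ℕ) : ℝ≥0∞ :=
  ENNReal.ofReal (G (Real.log n)) / ENNReal.ofReal m ^ n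

theorem gauge_exp_neg {m : ℝ} (G : ℝ → ℝ) (s : ℝ) :
    gauge m G (Real.exp (-s)) = Real.exp (-(s * Real.log m)) * G (Real.log s) := by
  rw [gauge, one_div, ← Real.exp_neg, neg_neg, Real.log_exp, ← Real.exp_mul, neg_mul]

theorem ofReal_gauge_exp_neg {m : ℝ} (hm : 0 < m) (G : ℝ → ℝ) (n : ℕ) :
    ENNReal.ofReal (gauge m G (ENNReal.ofReal (Real.exp (-n))).toReal) = cylinderGauge m G n := by
  rw [ENNReal.toReal_ofReal (Real.exp_pos _).le, gauge_exp_neg, Real.exp_neg, mul_comm (n : ℝ),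
    Real.exp_mul, Real.exp_log hm, Real.rpow_natCast, mul_comm, ← div_eq_mul_inv,
    ENNReal.ofReal_div_of_pos (by positivity), ENNReal.ofReal_pow hm.le, cylinderGauge]

/-- The rays of `T` along which the masses stay small from generation `k` on. -/
def lightRays (m : ℝ≥0∞) (μ : Measure OrderedTree) (k : ℕ) (T : OrderedTree) : Set Ray :=
  {x | x ∈ T.boundary ∧ ∀ n ≥ k,
    totalMass m (T.shift (x.trunc n)) ≤ ENNReal.ofReal (massInverse m μ (Real.log n) / 2) / 2}

namespace BranchingLaw

variable {ξ : PMF ℕ} {μ : Measure OrderedTree}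

theorem tendsto_cylinderGauge (h : BranchingLaw ξ μ) (h1 : 1 < mean ξ) (hm' : mean ξ ≠ ⊤)
    (hd : doublingSup (massInverse (mean ξ) μ) < ⊤) :
    Tendsto (cylinderGauge (mean ξ).toReal (massInverse (mean ξ) μ)) atTop (𝓝 0) := by
  have h1r : 1 < (mean ξ).toReal := by
    rw [← ENNReal.toReal_one]; exact (ENNReal.toReal_lt_toReal ENNReal.one_ne_top hm').2 h1
  have := h.prob
  have hm : mean ξ ≠ 0 := (zero_lt_one.trans h1).ne'
  have h2 := (tendsto_rpow_mul_rightInverse_log (P := μ) (W := totalMass (mean ξ))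
    (measurable_totalMass _) (h.ae_totalMass_ne_top hm hm') hd one_pos).mul
    (tendsto_self_mul_const_pow_of_lt_one (inv_nonneg.2 (zero_lt_one.trans h1r).le)
      (inv_lt_one_of_one_lt₀ h1r))
  rw [mul_zero] at h2
  have h3 := ENNReal.tendsto_ofReal h2
  rw [ENNReal.ofReal_zero] at h3
  refine h3.congr' ?_
  filter_upwards [eventually_ge_atTop 1] with n hn
  have hn' : (0 : ℝ) < n := by exact_mod_cast hn
  rw [cylinderGauge, ← ENNReal.ofReal_pow (zero_lt_one.trans h1r).le,
    ← ENNReal.ofReal_div_of_pos (by positivity), Real.rpow_neg_one, massInverse, inv_pow]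
  congr 1
  field_simp

/-- Rays with light masses have light siblings, so the vertices counted by `thinCount` give covers
at every generation `N ≥ k`. Their total gauge has mean at most `k^c N^{-c} G(log N)`, which tends
to zero; Fatou's lemma then gives covers of vanishing gauge along a subsequence, almost surely. -/
theorem ae_mkMetric_lightRays (h : BranchingLaw ξ μ) (h1 : 1 < mean ξ) (hm' : mean ξ ≠ ⊤)
    (h0 : ¬ ∀ᵐ T ∂μ, totalMass (mean ξ) T = 0) (hd : doublingSup (massInverse (mean ξ) μ) < ⊤)
    {m₀ : ℝ≥0∞ → ℝ≥0∞} (hm₀ : ∀ n : ℕ, m₀ (ENNReal.ofReal (Real.exp (-n)))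
      = cylinderGauge (mean ξ).toReal (massInverse (mean ξ) μ) n) {k : ℕ} (hk : 3 ≤ k) :
    ∀ᵐ T ∂μ, Measure.mkMetric m₀ (lightRays (mean ξ) μ k T) = 0 := by
  have hm : mean ξ ≠ 0 := (zero_lt_one.trans h1).ne'
  set γ := cylinderGauge (mean ξ).toReal (massInverse (mean ξ) μ) with hγ
  set y := siblingLevel (mean ξ) μ k with hy
  have hmeas : ∀ N, Measurable fun T => thinCount (mean ξ) N y T * γ N :=
    fun N => (measurable_thinCount _ N y).mul_const _
  have hint : ∀ N ≥ k, ∫⁻ T, thinCount (mean ξ) N y T * γ N ∂μ ≤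
      ENNReal.ofReal ((k : ℝ) ^ decayExponent ξ *
        ((N : ℝ) ^ (-decayExponent ξ) * massInverse (mean ξ) μ (Real.log N))) := by
    intro N hN
    rw [lintegral_mul_const _ (measurable_thinCount _ N y), h.lintegral_thinCount hm hm', hγ,
      cylinderGauge, ENNReal.ofReal_toReal hm', div_eq_mul_inv]
    calc _ = (mean ξ ^ N * (mean ξ ^ N)⁻¹)
          * (∏ j ∈ Finset.range N, siblingProb (mean ξ) μ (y j))
          * ENNReal.ofReal (massInverse (mean ξ) μ (Real.log N)) := by ring
      _ ≤ 1 * ENNReal.ofReal (((k : ℝ) / N) ^ decayExponent ξ)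
          * ENNReal.ofReal (massInverse (mean ξ) μ (Real.log N)) := by
        gcongr
        · exact ENNReal.mul_inv_le_one _
        · exact h.prod_siblingProb_le h1 hm' h0 hd hk N hN
      _ = _ := by
        rw [one_mul, ← ENNReal.ofReal_mul (by positivity),
          Real.div_rpow (Nat.cast_nonneg _) (Nat.cast_nonneg _), Real.rpow_neg (Nat.cast_nonneg _),
          div_eq_mul_inv, mul_assoc]
  have hlim : Tendsto (fun N : ℕ => ENNReal.ofReal ((k : ℝ) ^ decayExponent ξ *
        ((N : ℝ) ^ (-decayExponent ξ) * massInverse (mean ξ) μ (Real.log N)))) atTop (𝓝 0) := by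
    have := h.prob
    have := (tendsto_rpow_mul_rightInverse_log (P := μ) (W := totalMass (mean ξ))
      (measurable_totalMass _) (h.ae_totalMass_ne_top hm hm') hd
      (decayExponent_pos h1 hm')).const_mul ((k : ℝ) ^ decayExponent ξ)
    rw [mul_zero] at this
    simpa [massInverse] using ENNReal.tendsto_ofReal this
  have hnull : ∫⁻ T, liminf (fun N => thinCount (mean ξ) N y T * γ N) atTop ∂μ = 0 := by
    refine le_antisymm ((lintegral_liminf_le hmeas).trans ?_) zero_le
    rw [← hlim.liminf_eq]
    refine liminf_le_liminf ?_
    filter_upwards [eventually_ge_atTop k] with N hN using hint N hN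
  rw [lintegral_eq_zero_iff (Measurable.liminf hmeas)] at hnull
  have hr : Tendsto (fun N : ℕ => ENNReal.ofReal (Real.exp (-N))) atTop (𝓝 0) := by
    rw [← ENNReal.ofReal_zero]
    exact ENNReal.tendsto_ofReal (Real.tendsto_exp_atBot.comp
      (tendsto_neg_atTop_atBot.comp tendsto_natCast_atTop_atTop))
  filter_upwards [hnull, h.ae_goodTrees hm hm'] with T hT hgood
  choose V hlen hcard hmem using fun N => exists_thin_section (mean ξ) N y T
  refine le_antisymm ?_ zero_le
  refine (Measure.mkMetric_le_liminf_tsum (lightRays (mean ξ) μ k T) _ hr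
    (fun N (u : V N) => cylinder (u : Word)) (Eventually.of_forall fun N u => ?_)
    (Eventually.of_forall fun N x hx => ?_) m₀).trans ?_
  · rw [ediam_cylinder, hlen N u u.2]
  · refine mem_iUnion.2 ⟨⟨x.trunc N, hmem N x hx.1 fun j _ => ?_⟩, mem_cylinder_trunc x N⟩
    rw [hy, siblingLevel]
    split_ifs with hjk
    · exact le_top
    · have h2 := totalMass_add_siblingMass (fst_iterate_mem_goodTrees hm' (z := (T, x)) hgood j)
        ((spineShift^[j] (T, x)).2.digit 0)
      have h3 := hx.2 j (not_lt.1 hjk)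
      rw [← fst_spineShift_iterate j (T, x), h2] at h3
      -- The factor `m` in the sibling level is the one lost here: the siblings at step `j` have
      -- mass at most `m` times that of the vertex below them.
      rw [mul_comm, ← ENNReal.div_le_iff hm hm']
      exact (ENNReal.div_le_div_right le_add_self _).trans h3
  · refine le_trans (liminf_le_liminf (Eventually.of_forall fun N => ?_)) (le_of_eq hT)
    calc ∑' u : V N, m₀ (Metric.ediam (cylinder (u : Word))) = ∑' _ : V N, 1 * γ N :=
          tsum_congr fun u => by rw [ediam_cylinder, hlen N u u.2, hm₀, one_mul]
      _ = (∑' _ : V N, 1) * γ N := ENNReal.tsum_mul_right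
      _ ≤ _ := by gcongr; exact hcard N

end BranchingLaw

/-! ### The Hausdorff measure of the boundary -/

theorem rayMeasure_compl_boundary {m : ℝ≥0∞} (hm : m ≠ 0) (hm' : m ≠ ⊤) (T : OrderedTree) :
    rayMeasure m T T.boundaryᶜ = 0 := by
  refine measure_mono_null (t := ⋃ u : {u : Word // u ∉ T.carrier}, cylinder u) (fun x hx => ?_)
    (measure_iUnion_null fun u => rayMeasure_cylinder_eq_zero hm hm' u.2)
  simp only [OrderedTree.boundary, mem_compl_iff, mem_ofPred_eq, not_forall] at hx
  obtain ⟨n, hn⟩ := hx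
  exact mem_iUnion.2 ⟨⟨_, hn⟩, mem_cylinder_trunc x n⟩

section Tree

variable {m : ℝ≥0∞} {μ : Measure OrderedTree} {T : OrderedTree}

theorem rayMeasure_cylinder_trunc (hm : m ≠ 0) (hm' : m ≠ ⊤) (hT : T ∈ goodTrees m) {n : ℕ}
    (hn : 0 < massInverse m μ (Real.log n)) (x : Ray) :
    rayMeasure m T (cylinder (x.trunc n))
      = spineRatio m μ n (T, x) * cylinderGauge m.toReal (massInverse m μ) n := by
  rw [rayMeasure_cylinder hm hm' hT, x.trunc_length, spineRatio, cylinderGauge,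
    ENNReal.ofReal_toReal hm', fst_spineShift_iterate, div_eq_mul_inv, div_eq_mul_inv,
    div_eq_mul_inv]
  have : (ENNReal.ofReal (massInverse m μ (Real.log n)))⁻¹
      * ENNReal.ofReal (massInverse m μ (Real.log n)) = 1 :=
    ENNReal.inv_mul_cancel (ENNReal.ofReal_pos.2 hn).ne' ENNReal.ofReal_ne_top
  calc _ = totalMass m (T.shift (x.trunc n)) * 1 * (m ^ n)⁻¹ := by rw [mul_one]
    _ = _ := by rw [← this]; ring

/-- A deterministic statement for one tree. Where `L = ℓ`, the comparisons hold with every `a < ℓ`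
and every `b > ℓ`, and letting these tend to `ℓ` gives equality. The remaining issue is that the set
where `L ≠ ℓ`, null for `M`, is also null for the Hausdorff measure. -/
theorem mkMetric_restrict_boundary (hm : m ≠ 0) (hm' : m ≠ ⊤) (hT : T ∈ goodTrees m)
    (hG : ∀ n : ℕ, 3 ≤ n → 0 < massInverse m μ (Real.log n)) {m₀ : ℝ≥0∞ → ℝ≥0∞}
    (hm₀ : ∀ n : ℕ, m₀ (ENNReal.ofReal (Real.exp (-n)))
      = cylinderGauge m.toReal (massInverse m μ) n)
    (hγ : Tendsto (cylinderGauge m.toReal (massInverse m μ)) atTop (𝓝 0))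
    (hlight : ∀ k : ℕ, 3 ≤ k → Measure.mkMetric m₀ (lightRays m μ k T) = 0) {ℓ : ℝ≥0}
    (hℓ : 0 < ℓ)
    (hlim : ∀ᵐ x ∂(rayMeasure m T), limsup (fun n => spineRatio m μ n (T, x)) atTop = ℓ) :
    (Measure.mkMetric m₀).restrict T.boundary = ((ℓ⁻¹ : ℝ≥0) : ℝ≥0∞) • rayMeasure m T := by
  set M := rayMeasure m T with hM
  set H : Measure Ray := Measure.mkMetric m₀ with hH
  set L : Ray → ℝ≥0∞ := fun x => limsup (fun n => spineRatio m μ n (T, x)) atTop with hL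
  have lower : ∀ (a : ℝ≥0) (A : Set Ray), a ≠ 0 → (∀ x ∈ A, a < L x) → a * H A ≤ M A := by
    intro a A ha hA
    refine mul_mkMetric_le_measure hm₀ (by exact_mod_cast ha) ENNReal.coe_ne_top fun x hx => ?_
    refine ((frequently_lt_of_lt_limsup (by isBoundedDefault) (hA x hx)).and_eventually
      (eventually_ge_atTop 3)).mono fun n hn => ?_
    rw [hM, rayMeasure_cylinder_trunc hm hm' hT (hG n hn.2)]
    gcongr
    exact hn.1.le
  have upper : ∀ (b : ℝ≥0) (A : Set Ray), b ≠ 0 → (∀ x ∈ A, L x < b) → M A ≤ b * H A := by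
    intro b A hb hA
    refine measure_le_mul_mkMetric hm₀ hγ (by exact_mod_cast hb) ENNReal.coe_ne_top fun x hx => ?_
    filter_upwards [eventually_lt_of_limsup_lt (hA x hx), eventually_ge_atTop 3] with n hn hn3
    rw [hM, rayMeasure_cylinder_trunc hm hm' hT (hG n hn3)]
    gcongr
  set E : Set Ray := {x | x ∈ T.boundary ∧ L x ≠ ℓ} with hE
  have hME : M E = 0 := measure_mono_null (fun x hx => hx.2) hlim
  -- The cut at `1/8` is strictly below `1/4`: above it, null sets of `M` are null for `H`, and at
  -- or below it the ratio is eventually less than `1/4`, which is the definition of a light ray.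
  have hHE : H E = 0 := by
    have h1 : H {x | x ∈ E ∧ (1 / 8 : ℝ≥0) < L x} = 0 := by
      have := lower (1 / 8) {x | x ∈ E ∧ (1 / 8 : ℝ≥0) < L x} (by norm_num) fun x hx => hx.2
      rw [measure_mono_null (fun x hx => hx.1) hME, nonpos_iff_eq_zero, mul_eq_zero] at this
      exact this.resolve_left (by norm_num)
    have h2 : H (⋃ k : ℕ, lightRays m μ (k + 3) T) = 0 :=
      measure_iUnion_null fun k => hlight _ (Nat.le_add_left 3 k)
    refine measure_mono_null (fun x hx => ?_) (measure_union_null h1 h2)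
    by_cases hx8 : (1 / 8 : ℝ≥0) < L x
    · exact Or.inl ⟨hx, hx8⟩
    · have h4 : L x < 1 / 4 := by
        refine (not_lt.1 hx8).trans_lt ?_
        rw [ENNReal.coe_div (by norm_num)]
        norm_num
      obtain ⟨k, hk⟩ := eventually_atTop.1 (eventually_lt_of_limsup_lt h4)
      refine Or.inr (mem_iUnion.2 ⟨k, hx.1, fun n hn => ?_⟩)
      have h5 := (hk n (by omega)).le
      have hpos := hG n (by omega)
      rw [spineRatio, fst_spineShift_iterate,
        ENNReal.div_le_iff (ENNReal.ofReal_pos.2 hpos).ne' ENNReal.ofReal_ne_top] at h5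
      refine h5.trans (le_of_eq ?_)
      have e : (1 / 4 : ℝ≥0∞) = ENNReal.ofReal (1 / 4) := by
        rw [ENNReal.ofReal_div_of_pos (by norm_num)]; simp
      have e2 : (2 : ℝ≥0∞) = ENNReal.ofReal 2 := by simp
      rw [e, e2, ← ENNReal.ofReal_mul (by norm_num), ← ENNReal.ofReal_div_of_pos (by norm_num)]
      congr 1
      ring
  have hℓ' : (ℓ : ℝ≥0∞) ≠ 0 := by exact_mod_cast hℓ.ne'
  ext A hA
  rw [Measure.restrict_apply hA, Measure.smul_apply, smul_eq_mul]
  have hH1 : H (A ∩ T.boundary) = H ((A ∩ T.boundary) \ E) := (measure_sdiff_null hHE).symm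
  have hM1 : M A = M ((A ∩ T.boundary) \ E) := by
    rw [measure_sdiff_null hME]
    refine (measure_inter_conull ?_).symm
    exact rayMeasure_compl_boundary hm hm' T
  have hA1 : ∀ x ∈ (A ∩ T.boundary) \ E, L x = ℓ := fun x hx => by
    by_contra hne
    exact hx.2 ⟨hx.1.2, hne⟩
  rw [hH1, hM1]
  set A1 := (A ∩ T.boundary) \ E
  -- The limit is legitimate even if `H A1` were infinite, because `ℓ` is not zero.
  have hcoe : Tendsto (fun a : ℝ≥0 => (a : ℝ≥0∞) * H A1) (𝓝 ℓ) (𝓝 (ℓ * H A1)) :=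
    ENNReal.Tendsto.mul_const (ENNReal.tendsto_coe.2 tendsto_id) (Or.inl hℓ')
  have hle : M A1 ≤ ℓ * H A1 := by
    refine ge_of_tendsto (hcoe.mono_left (nhdsWithin_le_nhds (s := Ioi ℓ))) ?_
    filter_upwards [self_mem_nhdsWithin] with b hb
    refine upper b A1 (pos_of_gt hb).ne' fun x hx => ?_
    rw [hA1 x hx]
    exact_mod_cast hb
  have hge : ℓ * H A1 ≤ M A1 := by
    have : (𝓝[<] ℓ).NeBot := nhdsLT_neBot_of_exists_lt ⟨0, hℓ⟩
    refine le_of_tendsto (hcoe.mono_left (nhdsWithin_le_nhds (s := Iio ℓ))) ?_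
    filter_upwards [self_mem_nhdsWithin, (eventually_gt_nhds hℓ).filter_mono nhdsWithin_le_nhds]
      with a ha ha0
    refine lower a A1 ha0.ne' fun x hx => ?_
    rw [hA1 x hx]
    exact_mod_cast ha
  rw [le_antisymm hle hge, ENNReal.coe_inv hℓ.ne', ← mul_assoc,
    ENNReal.inv_mul_cancel hℓ' ENNReal.coe_ne_top, one_mul]

end Tree

/-! ### Densities along balls -/

theorem ball_exp_neg_eq_cylinder (x : Ray) {n : ℕ} {s : ℝ} (h1 : (n : ℝ) - 1 ≤ s) (h2 : s < n) :
    Metric.ball x (Real.exp (-s)) = cylinder (x.trunc n) := by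
  ext y
  rw [Metric.mem_ball, Ray.dist_lt_iff y x n _ (Real.exp_lt_exp.2 (by linarith))
    (Real.exp_le_exp.2 (by linarith))]
  simp [cylinder, Ray.trunc_length]

theorem limsup_comp_le {α β : Type*} {l : Filter α} {l' : Filter β} {u : β → ℝ≥0∞} {φ : α → β}
    (h : Tendsto φ l l') : limsup (u ∘ φ) l ≤ limsup u l' :=
  limsup_le_limsup_of_le (f := map φ l) h

section Tree

variable {m : ℝ≥0∞} {μ : Measure OrderedTree} {T : OrderedTree}

/-- With `n = ⌊s⌋` the ball is the cylinder of length `n + 1`, while the gauge at `s` is at least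
`m^{-(n+1)} G(log n)`. Keeping `G(log n)`, and not `G(log (n+1))`, costs one index, which is exactly
the ratio of the shifted ray; no regularity of `G` between consecutive scales is used. -/
theorem measure_ball_div_gauge_le (h1 : 1 < m) (hm' : m ≠ ⊤) (hT : T ∈ goodTrees m)
    (hG : ∀ n : ℕ, 3 ≤ n → 0 < massInverse m μ (Real.log n)) (hmono : Monotone (massInverse m μ))
    (x : Ray) {s : ℝ} (hs : 3 ≤ s) :
    rayMeasure m T (Metric.ball x (Real.exp (-s)))
        / ENNReal.ofReal (gauge m.toReal (massInverse m μ) (Real.exp (-s)))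
      ≤ spineRatio m μ ⌊s⌋₊ (spineShift (T, x)) := by
  have hm : m ≠ 0 := (zero_lt_one.trans h1).ne'
  have h1r : 1 < m.toReal := by
    rw [← ENNReal.toReal_one]; exact (ENNReal.toReal_lt_toReal ENNReal.one_ne_top hm').2 h1
  have h0r : 0 < m.toReal := zero_lt_one.trans h1r
  set n := ⌊s⌋₊ with hn
  have hns : (n : ℝ) ≤ s := Nat.floor_le (by linarith)
  have hsn : s < n + 1 := Nat.lt_floor_add_one s
  have hn3 : 3 ≤ n := Nat.le_floor (by exact_mod_cast hs)
  have hn0 : (0 : ℝ) < n := by exact_mod_cast (by omega : 0 < n)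
  have hpos := hG n hn3
  rw [ball_exp_neg_eq_cylinder x (n := n + 1) (by push_cast; linarith) (by push_cast; linarith),
    rayMeasure_cylinder hm hm' hT, x.trunc_length, spineRatio,
    ← Function.iterate_succ_apply spineShift n, fst_spineShift_iterate]
  have hg : ENNReal.ofReal (massInverse m μ (Real.log n)) / m ^ (n + 1)
      ≤ ENNReal.ofReal (gauge m.toReal (massInverse m μ) (Real.exp (-s))) := by
    have hpow : m ^ (n + 1) = ENNReal.ofReal (m.toReal ^ (n + 1)) := by
      rw [ENNReal.ofReal_pow h0r.le, ENNReal.ofReal_toReal hm']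
    rw [hpow, ← ENNReal.ofReal_div_of_pos (by positivity)]
    refine ENNReal.ofReal_le_ofReal ?_
    rw [gauge_exp_neg, div_eq_inv_mul]
    refine mul_le_mul ?_ (hmono (Real.log_le_log hn0 hns)) hpos.le (Real.exp_pos _).le
    rw [Real.exp_neg, mul_comm, Real.exp_mul, Real.exp_log h0r, ← Real.rpow_natCast]
    refine inv_anti₀ (by positivity) (Real.rpow_le_rpow_of_exponent_le h1r.le ?_)
    push_cast
    exact hsn.le
  refine (ENNReal.div_le_div_left hg _).trans (le_of_eq ?_)
  have hp0 : m ^ (n + 1) ≠ 0 := pow_ne_zero _ hm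
  have hpt : m ^ (n + 1) ≠ ⊤ := ENNReal.pow_ne_top hm'
  rw [ENNReal.div_eq_inv_mul, ENNReal.inv_div (Or.inl hpt) (Or.inl hp0), div_eq_mul_inv,
    div_eq_mul_inv, div_eq_mul_inv]
  calc _ = (m ^ (n + 1) * (m ^ (n + 1))⁻¹) * (totalMass m (T.shift (x.trunc (n + 1)))
        * (ENNReal.ofReal (massInverse m μ (Real.log n)))⁻¹) := by ring
    _ = _ := by rw [ENNReal.mul_inv_cancel hp0 hpt, one_mul]

/-- The radius `e^{-n}` itself gives the open ball of length `n + 1`. A slightly larger one, with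
exponent `n - 1/n`, gives the cylinder of length `n`, at the price of a factor `m^{1/n}` that tends
to one. -/
theorem spineRatio_le_measure_ball (h1 : 1 < m) (hm' : m ≠ ⊤) (hT : T ∈ goodTrees m)
    (hG : ∀ n : ℕ, 3 ≤ n → 0 < massInverse m μ (Real.log n)) (hmono : Monotone (massInverse m μ))
    (x : Ray) {n : ℕ} (hn : 4 ≤ n) :
    spineRatio m μ n (T, x)
      ≤ rayMeasure m T (Metric.ball x (Real.exp (-(n - (n : ℝ)⁻¹))))
        / ENNReal.ofReal (gauge m.toReal (massInverse m μ) (Real.exp (-(n - (n : ℝ)⁻¹))))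
        * ENNReal.ofReal (Real.exp ((n : ℝ)⁻¹ * Real.log m.toReal)) := by
  have hm : m ≠ 0 := (zero_lt_one.trans h1).ne'
  have h1r : 1 < m.toReal := by
    rw [← ENNReal.toReal_one]; exact (ENNReal.toReal_lt_toReal ENNReal.one_ne_top hm').2 h1
  have h0r : 0 < m.toReal := zero_lt_one.trans h1r
  have hn4 : (4 : ℝ) ≤ n := by exact_mod_cast hn
  have hi0 : 0 < (n : ℝ)⁻¹ := by positivity
  have hi1 : (n : ℝ)⁻¹ ≤ 1 := inv_le_one_of_one_le₀ (by linarith)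
  have hpos3 := hG 3 le_rfl
  set s : ℝ := n - (n : ℝ)⁻¹ with hs
  have hs3 : 3 ≤ s := by rw [hs]; linarith
  have hpos : 0 < massInverse m μ (Real.log s) :=
    hpos3.trans_le (hmono (Real.log_le_log (by norm_num) (by exact_mod_cast hs3)))
  have hle : massInverse m μ (Real.log s) ≤ massInverse m μ (Real.log n) :=
    hmono (Real.log_le_log (by linarith) (by linarith))
  rw [ball_exp_neg_eq_cylinder x (n := n) (by linarith) (by linarith),
    rayMeasure_cylinder hm hm' hT, x.trunc_length, spineRatio, fst_spineShift_iterate]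
  have hgpos : 0 < gauge m.toReal (massInverse m μ) (Real.exp (-s)) := by
    rw [gauge_exp_neg]; positivity
  have hg : ENNReal.ofReal (gauge m.toReal (massInverse m μ) (Real.exp (-s)))
      ≤ ENNReal.ofReal (massInverse m μ (Real.log n))
        * (ENNReal.ofReal (Real.exp ((n : ℝ)⁻¹ * Real.log m.toReal)) * (m ^ n)⁻¹) := by
    have hpow : m ^ n = ENNReal.ofReal (m.toReal ^ n) := by
      rw [ENNReal.ofReal_pow h0r.le, ENNReal.ofReal_toReal hm']
    rw [hpow, ← ENNReal.ofReal_inv_of_pos (by positivity), ← ENNReal.ofReal_mul (Real.exp_pos _).le,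
      ← ENNReal.ofReal_mul (hpos.le.trans hle)]
    refine ENNReal.ofReal_le_ofReal ?_
    rw [gauge_exp_neg, mul_comm]
    refine mul_le_mul hle (le_of_eq ?_) (Real.exp_pos _).le (hpos.le.trans hle)
    conv_rhs => rw [← Real.exp_log (pow_pos h0r n), ← Real.exp_neg, ← Real.exp_add, Real.log_pow]
    congr 1
    rw [hs]; ring
  have hgne : ENNReal.ofReal (gauge m.toReal (massInverse m μ) (Real.exp (-s))) ≠ 0 :=
    (ENNReal.ofReal_pos.2 hgpos).ne'
  rw [ENNReal.div_le_iff (ENNReal.ofReal_pos.2 (hpos.trans_le hle)).ne' ENNReal.ofReal_ne_top]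
  set w := totalMass m (T.shift (x.trunc n))
  set g := ENNReal.ofReal (gauge m.toReal (massInverse m μ) (Real.exp (-s)))
  calc w = w * (g⁻¹ * g) := by rw [ENNReal.inv_mul_cancel hgne ENNReal.ofReal_ne_top, mul_one]
    _ ≤ w * (g⁻¹ * (ENNReal.ofReal (massInverse m μ (Real.log n))
        * (ENNReal.ofReal (Real.exp ((n : ℝ)⁻¹ * Real.log m.toReal)) * (m ^ n)⁻¹))) := by gcongr
    _ = _ := by rw [div_eq_mul_inv, div_eq_mul_inv]; ring

/-- The upper bound sees the ray through its shift and the lower bound sees it directly, which is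
why both limsups are assumed equal to `ℓ`. -/
theorem limsup_measure_ball (h1 : 1 < m) (hm' : m ≠ ⊤) (hT : T ∈ goodTrees m)
    (hG : ∀ n : ℕ, 3 ≤ n → 0 < massInverse m μ (Real.log n)) (hmono : Monotone (massInverse m μ))
    {x : Ray} {ℓ : ℝ≥0∞} (hℓ : limsup (fun n => spineRatio m μ n (T, x)) atTop = ℓ)
    (hℓ' : limsup (fun n => spineRatio m μ n (spineShift (T, x))) atTop = ℓ) :
    limsup (fun r : ℝ => rayMeasure m T (Metric.ball x r)
      / ENNReal.ofReal (gauge m.toReal (massInverse m μ) r)) (𝓝[>] 0) = ℓ := by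
  set f : ℝ → ℝ≥0∞ := fun r => rayMeasure m T (Metric.ball x r)
      / ENNReal.ofReal (gauge m.toReal (massInverse m μ) r) with hf
  apply le_antisymm
  · rw [← hℓ']
    have hlog : Tendsto (fun r : ℝ => -Real.log r) (𝓝[>] 0) atTop :=
      tendsto_neg_atBot_atTop.comp Real.tendsto_log_nhdsGT_zero
    refine le_trans (limsup_le_limsup ?_)
      (limsup_comp_le (u := fun n => spineRatio m μ n (spineShift (T, x)))
        (tendsto_nat_floor_atTop.comp hlog))
    filter_upwards [hlog.eventually_ge_atTop 3, self_mem_nhdsWithin] with r hr hr0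
    have := measure_ball_div_gauge_le h1 hm' hT hG hmono x hr
    rw [neg_neg, Real.exp_log hr0] at this
    exact this
  · rw [← hℓ]
    have hinv : Tendsto (fun n : ℕ => (n : ℝ)⁻¹) atTop (𝓝 0) :=
      tendsto_inv_atTop_zero.comp tendsto_natCast_atTop_atTop
    have he : Tendsto (fun n : ℕ => ENNReal.ofReal (Real.exp ((n : ℝ)⁻¹ * Real.log m.toReal)))
        atTop (𝓝 1) := by
      have := ENNReal.tendsto_ofReal ((Real.continuous_exp.tendsto _).comp
        (hinv.mul_const (Real.log m.toReal)))
      simpa using this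
    have hr : Tendsto (fun n : ℕ => Real.exp (-(n - (n : ℝ)⁻¹))) atTop (𝓝[>] 0) := by
      refine tendsto_nhdsWithin_iff.2 ⟨Real.tendsto_exp_neg_atTop_nhds_zero.comp ?_,
        Eventually.of_forall fun n => Real.exp_pos _⟩
      simp_rw [sub_eq_add_neg]
      exact tendsto_natCast_atTop_atTop.atTop_add hinv.neg
    calc limsup (fun n => spineRatio m μ n (T, x)) atTop
        ≤ limsup ((f ∘ fun n : ℕ => Real.exp (-(n - (n : ℝ)⁻¹))) *
          fun n : ℕ => ENNReal.ofReal (Real.exp ((n : ℝ)⁻¹ * Real.log m.toReal))) atTop := by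
          refine limsup_le_limsup ?_
          filter_upwards [eventually_ge_atTop 4] with n hn
          exact spineRatio_le_measure_ball h1 hm' hT hG hmono x hn
      _ ≤ limsup (f ∘ fun n : ℕ => Real.exp (-(n - (n : ℝ)⁻¹))) atTop * 1 := by
          refine (ENNReal.limsup_mul_le' ?_ ?_).trans ?_
          · right; rw [he.limsup_eq]; exact ENNReal.one_ne_top
          · right; rw [he.limsup_eq]; exact one_ne_zero
          · rw [he.limsup_eq]
      _ ≤ limsup f (𝓝[>] 0) := by rw [mul_one]; exact limsup_comp_le hr

end Tree

/-! ### Existence of the constant -/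

/-- The branching measure `M` of almost every tree has exact Hausdorff gauge `g`, with constant
`c`. -/
structure IsGaugeConstant (ξ : PMF ℕ) (μ : Measure OrderedTree) (c : ℝ≥0) : Prop where
  pos : 0 < c
  limsup_ball : ∀ᵐ T ∂μ, ∀ᵐ x ∂(branchingMeasure (mean ξ) T),
    limsup (fun r : ℝ => branchingMeasure (mean ξ) T (Metric.ball x r)
      / ENNReal.ofReal (gauge (mean ξ).toReal (massInverse (mean ξ) μ) r)) (𝓝[>] 0)
      = (c : ℝ≥0∞)⁻¹
  hausdorff : ∀ᵐ T ∂μ, (hausdorffMeasure (gauge (mean ξ).toReal (massInverse (mean ξ) μ))).restrict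
    T.boundary = (c : ℝ≥0∞) • branchingMeasure (mean ξ) T

namespace BranchingLaw

variable {ξ : PMF ℕ} {μ : Measure OrderedTree}

/-- When `W = 0` almost surely, `F⁻¹`, the gauge and the branching measure all vanish, so any
constant would do. The Hausdorff measure for the zero gauge is zero by the density comparison with
the zero measure. -/
theorem isGaugeConstant_one_of_null (h : BranchingLaw ξ μ) (h1 : 1 < mean ξ) (hm' : mean ξ ≠ ⊤)
    (h0 : ∀ᵐ T ∂μ, totalMass (mean ξ) T = 0) : IsGaugeConstant ξ μ 1 := by
  have hm : mean ξ ≠ 0 := (zero_lt_one.trans h1).ne'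
  have hzero : ∀ᵐ T ∂μ, branchingMeasure (mean ξ) T = 0 := by
    filter_upwards [h0, h.ae_goodTrees hm hm'] with T hT hgood
    have := (isBranchingMeasure_branchingMeasure hm hm' hgood).cylinder_eq []
    rw [limitMass_eq, OrderedTree.shift_nil, hT, ENNReal.zero_div, cylinder_nil] at this
    exact Measure.measure_univ_eq_zero.1 this
  have hG : gauge (mean ξ).toReal (massInverse (mean ξ) μ) = 0 := by
    ext r
    simp [gauge, massInverse, rightInverse_eq_zero h0]
  refine ⟨one_pos, ?_, ?_⟩
  · filter_upwards [hzero] with T hT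
    rw [hT]; simp
  · filter_upwards [hzero] with T hT
    have hH : hausdorffMeasure 0 = 0 := by
      have := mul_mkMetric_le_measure (M := 0) (m₀ := fun d => ENNReal.ofReal ((0 : ℝ → ℝ) d.toReal))
        (γ := 0) (fun n => by simp) one_ne_zero ENNReal.one_ne_top (A := univ)
        (fun x _ => Frequently.of_forall fun n => by simp)
      rw [one_mul, Measure.coe_zero, Pi.zero_apply, nonpos_iff_eq_zero] at this
      exact Measure.measure_univ_eq_zero.1 this
    rw [hT, hG, hH]; simp

theorem exists_isGaugeConstant (h : BranchingLaw ξ μ) (h1 : 1 < mean ξ) (hm' : mean ξ ≠ ⊤)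
    (hd : doublingSup (massInverse (mean ξ) μ) < ⊤) : ∃ c, IsGaugeConstant ξ μ c := by
  have hm : mean ξ ≠ 0 := (zero_lt_one.trans h1).ne'
  by_cases h0 : ∀ᵐ T ∂μ, totalMass (mean ξ) T = 0
  · exact ⟨1, h.isGaugeConstant_one_of_null h1 hm' h0⟩
  obtain ⟨ℓ, hℓ, hlim⟩ := h.exists_limsup_spineRatio_eq h1 hm' h0 hd
  have hlim' := ae_ae_of_ae_spineLaw hm hm' hlim
  have hG : ∀ n : ℕ, 3 ≤ n → 0 < massInverse (mean ξ) μ (Real.log n) :=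
    fun n hn => h.massInverse_log_pos hm hm' h0 hd hn
  have hm0 : 0 < (mean ξ).toReal := ENNReal.toReal_pos hm hm'
  refine ⟨ℓ⁻¹, inv_pos.2 hℓ, ?_, ?_⟩
  · filter_upwards [hlim', h.ae_goodTrees hm hm'] with T hT hgood
    rw [← rayMeasure_of_mem hgood]
    filter_upwards [hT] with x hx
    rw [limsup_measure_ball h1 hm' hgood hG (h.massInverse_mono hm hm') hx.1 hx.2,
      ENNReal.coe_inv hℓ.ne', inv_inv]
  · have hlight := ae_all_iff.2 fun k : ℕ => ae_all_iff.2 fun hk : 3 ≤ k =>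
      h.ae_mkMetric_lightRays h1 hm' h0 hd
        (m₀ := fun d => ENNReal.ofReal (gauge (mean ξ).toReal (massInverse (mean ξ) μ) d.toReal))
        (ofReal_gauge_exp_neg hm0 (massInverse (mean ξ) μ)) hk
    filter_upwards [hlim', h.ae_goodTrees hm hm', hlight] with T hT hgood hl
    rw [← rayMeasure_of_mem hgood]
    exact mkMetric_restrict_boundary hm hm' hgood hG
      (ofReal_gauge_exp_neg hm0 (massInverse (mean ξ) μ)) (h.tendsto_cylinderGauge h1 hm' hd)
      hl hℓ (hT.mono fun x hx => hx.1)

end BranchingLaw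

/-- The constant is chosen before the law, hence depends on `ξ` only: all Galton–Watson laws for `ξ`
coincide, so a constant found for one of them serves for all. -/
theorem exists_isGaugeConstant (ξ : PMF ℕ) (h1 : 1 < mean ξ) (hm' : mean ξ ≠ ⊤) :
    ∃ c : ℝ≥0, 0 < c ∧ ∀ μ, BranchingLaw ξ μ → doublingSup (massInverse (mean ξ) μ) < ⊤ →
      IsGaugeConstant ξ μ c := by
  by_cases h : ∃ μ, BranchingLaw ξ μ ∧ doublingSup (massInverse (mean ξ) μ) < ⊤
  · obtain ⟨μ, hμ, hd⟩ := h
    obtain ⟨c, hc⟩ := hμ.exists_isGaugeConstant h1 hm' hd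
    exact ⟨c, hc.pos, fun ν hν _ => hμ.unique hν ▸ hc⟩
  · push Not at h
    exact ⟨1, one_pos, fun μ hμ hd => absurd hd (not_lt.2 (h μ hμ))⟩

theorem tailExponent_map {Ω Ω' : Type*} [MeasurableSpace Ω] [MeasurableSpace Ω'] {P : Measure Ω}
    {X : Ω → Ω'} (hX : Measurable X) {W : Ω' → ℝ≥0∞} (hW : Measurable W) :
    tailExponent P (fun ω => W (X ω)) = tailExponent (P.map X) W := by
  ext x
  rw [tailExponent, tailExponent, Measure.map_apply hX (measurableSet_lt measurable_const hW)]
  rfl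

end GW

theorem theorem1 (ξ : PMF ℕ) (hξ : GW.Hyp ξ) :
    ∃ c : ℝ≥0, 0 < c ∧
      ∀ (Ω : Type*) [MeasurableSpace Ω] (P : Measure Ω) [IsProbabilityMeasure P]
        (T : Ω → GW.OrderedTree), GW.IsGaltonWatson ξ P T →
      ∀ (W : Ω → ℝ≥0∞) (Finv g : ℝ → ℝ) (M : Ω → Measure GW.Ray),
        (W = fun ω => GW.limitMass (GW.mean ξ) (T ω) []) →
        Finv = GW.rightInverse (GW.tailExponent P W) →
        g = GW.gauge (GW.mean ξ).toReal Finv →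
        (M = fun ω => GW.branchingMeasure (GW.mean ξ) (T ω)) →
        GW.doublingSup Finv < ⊤ →
        (∀ᵐ ω ∂P, GW.IsBranchingMeasure (GW.mean ξ) (T ω) (M ω)) ∧
        (∀ᵐ ω ∂P, ∀ᵐ x ∂(M ω),
          limsup (fun r : ℝ => M ω (Metric.ball x r) / ENNReal.ofReal (g r)) (𝓝[>] 0)
            = (c : ℝ≥0∞)⁻¹) ∧
        (∀ᵐ ω ∂P, (GW.hausdorffMeasure g).restrict (T ω).boundary = (c : ℝ≥0∞) • M ω) := by
  have hm' : GW.mean ξ ≠ ⊤ := hξ.mean_lt_top.ne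
  have hm : GW.mean ξ ≠ 0 := (zero_lt_one.trans hξ.one_lt_mean).ne'
  obtain ⟨c, hc, hgauge⟩ := GW.exists_isGaugeConstant ξ hξ.one_lt_mean hm'
  refine ⟨c, hc, ?_⟩
  rintro Ω _ P _ T hT W Finv g M hW hFinv rfl rfl hd
  have hlaw := hT.branchingLaw
  -- The tail of `W` depends only on the law of the tree, so the statement can be proved under the
  -- image measure and pulled back.
  have hFinv' : Finv = GW.massInverse (GW.mean ξ) (P.map T) := by
    rw [hFinv, hW, GW.massInverse,
      ← GW.tailExponent_map hT.measurable (GW.measurable_totalMass (GW.mean ξ))]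
    simp only [GW.limitMass_eq, GW.OrderedTree.shift_nil]
  subst hFinv'
  have hc' := hgauge _ hlaw hd
  refine ⟨?_, ae_of_ae_map hT.measurable.aemeasurable hc'.limsup_ball,
    ae_of_ae_map hT.measurable.aemeasurable hc'.hausdorff⟩
  filter_upwards [ae_of_ae_map hT.measurable.aemeasurable (hlaw.ae_goodTrees hm hm')] with ω hω
  exact GW.isBranchingMeasure_branchingMeasure hm hm' hω
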